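/- Let $k$ be a field and, for $q\in k$, let $\Lambda=\Lambda_q=k\langle x,y\rangle/(x^2,\,xy+q\,yx,\,y^2)$. Let $\mathrm{HH}^n(\Lambda)$ be the cohomology of the Hochschild complex $\operatorname{Hom}_k(\Lambda^{\otimes n},\Lambda)$, and let $\mathrm{HH}^*(\Lambda)=\bigoplus_{n\ge 0}\mathrm{HH}^n(\Lambda)$ be the Hochschild cohomology ring with the cup product $(f\cup g)(a_1,\dots,a_{m+n})=f(a_1,\dots,a_m)\,g(a_{m+1},\dots,a_{m+n})$. For $0\le i\le n$ let $f^n_i\in\Lambda^{\otimes n}$ be the sum of all $n$-fold tensors of $x$'s and $y$'s with exactly $i$ factors $y$, each with coefficient $q^{\alpha}$, where $\alpha$ is the number of pairs formed by a factor $y$ and a factor $x$ to the right of it. A tuple $(\lambda_0,\dots,\lambda_n)\in\Lambda^{n+1}$ (a bimodule map $P^n=\bigoplus_i\Lambda\otimes f^n_i\otimes\Lambda\to\Lambda$ on the Koszul resolution) is said to represent a class $h\in \mathrm{HH}^n(\Lambda)$ if there is a Hochschild $n$-cocycle $c$ with $c(f^n_i)=\lambda_i$ for all $i$, and every such cocycle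 has class $h$. Write $a e_j$ for the tuple with $a\in\Lambda$ in position $j$ and $0$ elsewhere, and $e_j=1e_j$. "Basis" below means that the listed tuples represent a basis of $\mathrm{HH}^n(\Lambda)$. Polynomial variables are central, $\wedge(\dots)$ is the exterior algebra over $k$, all fibre products over $k$ are taken along the augmentations that send all generators to $0$, and the isomorphisms are isomorphisms of $k$-algebras that match the named generators with the classes represented by the given tuples (and so respect the grading). Let $q\in k$ be a primitive $r$-th root of unity, $r\ge 1$. Then $\mathrm{HH}^n(\Lambda)$ is finite dimensional for all $n$; write $H(t)=\sum_{n\ge0}\dim_k\mathrm{HH}^n(\Lambda)\,t^n$. (a) Let $r>1$ be odd and $\operatorname{char}k\ne2$. Bases: $\{e_0,\ yx\,e_0\}$ for $n=0$; $\{e_{tr}\}_{0\le t\le 2s}$ for $n=2sr$, $s\ge1$; $\{x e_{tr},\ y e_{tr+1}\}_{0\le t\le2s}$ for $n=2sr+1$, $s\ge0$; $\{yx\,e_{tr+1}\}_{0\le t\le 2s}$ for $n=2sr+2$, $s\ge0$; and $\mathrm{HH}^n(\Lambda)=0$ for all other $n$. Moreover $$\mathrm{HH}^*(\Lambda)\cong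 k[z]/(z^2)\times_k\bigl(\wedge(u_0,u_1)[w_0,w_1,w_2]/(w_0w_2-w_1^2)\bigr),$$ with $z=yx\,e_0$ in degree $0$, $u_0=x e_0$, $u_1=y e_1$ in degree $1$, $w_i=e_{ir}$ in degree $2r$, and $H(t)=1+\frac{(1+t)^2(1+t^{2r})}{(1-t^{2r})^2}$. In particular $\mathrm{HH}^n(\Lambda)=0$ for $3\le n<2r$ and $\mathrm{HH}^{2r}(\Lambda)\neq0$. (b) Let $\operatorname{char}k=2$ and $q\ne1$, or $\operatorname{char}k\neq2$ and $r>2$ even. Bases: $\{e_0,\ yx\,e_0\}$ for $n=0$; $\{e_{tr}\}_{0\le t\le s}$ for $n=sr$, $s\ge1$; $\{x e_{tr},\ y e_{tr+1}\}_{0\le t\le s}$ for $n=sr+1$, $s\ge0$; $\{yx\,e_{tr+1}\}_{0\le t\le s}$ for $n=sr+2$, $s\ge0$; and $\mathrm{HH}^n(\Lambda)=0$ for all other $n$. Moreover $$\mathrm{HH}^*(\Lambda)\cong k[z]/(z^2)\times_k\wedge(u_0,u_1)[w_0,w_1],$$ with $z=yx\,e_0$ in degree $0$, $u_0=x e_0$,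 $u_1=y e_1$ in degree $1$, $w_i=e_{ir}$ in degree $r$, and $H(t)=1+\frac{(1+t)^2}{(1-t^r)^2}$. In particular $r\ge3$, $\mathrm{HH}^n(\Lambda)=0$ for $3\le n<r$ and $\mathrm{HH}^{r}(\Lambda)\neq0$. (c) Let $\operatorname{char}k=2$ and $q=1$. For every $n$ a basis is $\{e_j,\ x e_j,\ y e_j,\ yx\,e_j\}_{0\le j\le n}$. Moreover $\mathrm{HH}^*(\Lambda)\cong\Lambda[w_0,w_1]$, where $a\in\Lambda$ corresponds to $a e_0$ in degree $0$ and $w_i=e_i$ in degree $1$, and $H(t)=\frac{4}{(1-t)^2}$. (d) Let $\operatorname{char}k\ne2$ and $q=-1$. Bases: $\{e_0,\ x e_0,\ y e_0,\ yx\,e_0\}$ for $n=0$; $\{e_{2t}\}_{0\le t\le m}\cup\{y e_0,\ x e_{2m}\}\cup\{yx\,e_{2t+1}\}_{0\le t<m}$ for $n=2m$, $m\ge1$; $\{x e_{2t},\ y e_{2t+1}\}_{0\le t\le m}\cup\{yx\,e_0,\ yx\,e_{2m+1}\}$ for $n=2m+1$, $m\ge0$. Moreover $$\mathrm{HH}^*(\Lambda)\cong(\Lambda\otimes_k\wedge(u_0,u_1))[w_0,w_1]/(xu_0,\,yu_1,\,xw_0,\,yw_1),$$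 where $a\in\Lambda$ corresponds to $a e_0$ in degree $0$, $u_0=x e_0$, $u_1=y e_1$ in degree $1$, $w_0=e_0$, $w_1=e_2$ in degree $2$, and $H(t)=\frac{4-4t+t^2}{(1-t)^2}$. (e) Let $\operatorname{char}k\ne2$ and $q=1$. A basis is $\{e_j,\ yx\,e_j\}_{0\le j\le n}$ for $n$ even and $\{x e_j,\ y e_j\}_{0\le j\le n}$ for $n$ odd. Moreover $$\mathrm{HH}^*(\Lambda)\cong\bigl(k[z]/(z^2)\times_k\wedge(u_0,u_1,u_2,u_3)\bigr)[w_0,w_1,w_2]/I,$$ with $z=yx\,e_0$ in degree $0$, $u_0=x e_0$, $u_1=y e_0$, $u_2=x e_1$, $u_3=y e_1$ in degree $1$, $w_i=e_i$ in degree $2$, where $I$ is generated by $u_0u_2$, $u_1u_3$, $u_0u_1+zw_0$, $u_0u_3+zw_1$, $u_2u_3+zw_2$, $u_1u_2-zw_1$, $u_0w_1-u_2w_0$, $u_1w_1-u_3w_0$, $u_0w_2-u_2w_1$, $u_1w_2-u_3w_1$, $w_0w_2-w_1^2$; and $H(t)=\frac{2}{(1-t)^2}$. Consequently, if $k$ contains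 a primitive $r$-th root of unity for every $r$ not divisible by $\operatorname{char}k$, then for every $M$ there are a root of unity $q\in k$ and $N>M$, $N\ge3$, such that $\mathrm{HH}^n(\Lambda_q)=0$ for $3\le n<N$ and $\mathrm{HH}^N(\Lambda_q)\ne0$. -/

import Mathlib

open scoped TensorProduct DirectSum

namespace Hochschild

section Complex

variable (k A : Type*) [Field k] [Ring A] [Algebra k A]

/-- Hochschild `n`-cochains of `A` with coefficients in `A`, that is, `Hom_k(A^{⊗n}, A)`. -/
abbrev Cochain (n : ℕ) : Type _ := MultilinearMap k (fun _ : Fin n => A) A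

instance (n : ℕ) : AddCommGroup (Cochain k A n) := MultilinearMap.instAddCommGroup

instance (n : ℕ) : AddCommMonoid (Cochain k A n) := AddCommGroup.toAddCommMonoid

instance (n : ℕ) : Module k (Cochain k A n) := MultilinearMap.instModule

variable {k A}

theorem contractNth_update {n : ℕ} (i : Fin n) (v : Fin (n + 1) → A) (j : Fin (n + 1)) :
    ∃ (l : Fin n) (φ : A →ₗ[k] A),
      ∀ x, i.castSucc.contractNth (· * ·) (Function.update v j x) =
        Function.update (i.castSucc.contractNth (· * ·) v) l (φ x) := by
  rcases lt_trichotomy (j : ℕ) i with h | h | h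
  · refine ⟨⟨j, by omega⟩, LinearMap.id, fun x => funext fun l => ?_⟩
    simp only [Fin.contractNth, Function.update_apply, Fin.ext_iff, Fin.val_castSucc, Fin.val_succ,
      LinearMap.id_apply]
    grind
  · refine ⟨i, LinearMap.mulRight k (v i.succ), fun x => funext fun l => ?_⟩
    simp only [Fin.contractNth, Function.update_apply, Fin.ext_iff, Fin.val_castSucc, Fin.val_succ,
      LinearMap.mulRight_apply]
    have : ∀ l : Fin n, (l : ℕ) = i → l = i := fun l hl => Fin.ext hl
    grind
  · by_cases h' : (j : ℕ) = i + 1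
    · refine ⟨i, LinearMap.mulLeft k (v i.castSucc), fun x => funext fun l => ?_⟩
      simp only [Fin.contractNth, Function.update_apply, Fin.ext_iff, Fin.val_castSucc,
        Fin.val_succ, LinearMap.mulLeft_apply]
      have : ∀ l : Fin n, (l : ℕ) = i → l = i := fun l hl => Fin.ext hl
      grind
    · refine ⟨⟨j - 1, by omega⟩, LinearMap.id, fun x => funext fun l => ?_⟩
      simp only [Fin.contractNth, Function.update_apply, Fin.ext_iff, Fin.val_castSucc,
        Fin.val_succ, LinearMap.id_apply]
      grind

/-- `(a₀, …, aₙ) ↦ f(a₀, …, aᵢaᵢ₊₁, …, aₙ)`. -/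
def contract {n : ℕ} (f : Cochain k A n) (i : Fin n) : Cochain k A (n + 1) where
  toFun v := f (i.castSucc.contractNth (· * ·) v)
  map_update_add' {inst} v j x y := by
    obtain rfl : inst = instDecidableEqFin _ := Subsingleton.elim _ _
    obtain ⟨l, φ, h⟩ := contractNth_update (k := k) i v j
    simp only [h, map_add, MultilinearMap.map_update_add]
  map_update_smul' {inst} v j c x := by
    obtain rfl : inst = instDecidableEqFin _ := Subsingleton.elim _ _
    obtain ⟨l, φ, h⟩ := contractNth_update (k := k) i v j
    simp only [h, map_smul, MultilinearMap.map_update_smul]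

/-- `(a₀, …, aₙ) ↦ a₀ f(a₁, …, aₙ)`. -/
def leftTerm {n : ℕ} (f : Cochain k A n) : Cochain k A (n + 1) where
  toFun v := v 0 * f (Fin.tail v)
  map_update_add' {inst} v j x y := by
    obtain rfl : inst = instDecidableEqFin _ := Subsingleton.elim _ _
    induction j using Fin.cases with
    | zero => simp [Fin.tail_update_zero, add_mul]
    | succ j => simp [Fin.tail_update_succ, mul_add, Fin.ext_iff]
  map_update_smul' {inst} v j c x := by
    obtain rfl : inst = instDecidableEqFin _ := Subsingleton.elim _ _
    induction j using Fin.cases with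
    | zero => simp [Fin.tail_update_zero]
    | succ j => simp [Fin.tail_update_succ, Fin.ext_iff]

/-- `(a₀, …, aₙ) ↦ f(a₀, …, aₙ₋₁) aₙ`. -/
def rightTerm {n : ℕ} (f : Cochain k A n) : Cochain k A (n + 1) where
  toFun v := f (Fin.init v) * v (Fin.last n)
  map_update_add' {inst} v j x y := by
    obtain rfl : inst = instDecidableEqFin _ := Subsingleton.elim _ _
    induction j using Fin.lastCases with
    | last => simp [Fin.init_update_last, mul_add]
    | cast j => simp [Fin.init_update_castSucc, add_mul, Fin.ext_iff, j.isLt.ne']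
  map_update_smul' {inst} v j c x := by
    obtain rfl : inst = instDecidableEqFin _ := Subsingleton.elim _ _
    induction j using Fin.lastCases with
    | last => simp [Fin.init_update_last]
    | cast j => simp [Fin.init_update_castSucc, Fin.ext_iff, j.isLt.ne']

/-- The Hochschild differential
`(df)(a₀, …, aₙ) = a₀ f(a₁, …, aₙ) + ∑ᵢ (-1)ⁱ⁺¹ f(a₀, …, aᵢaᵢ₊₁, …, aₙ)
  + (-1)ⁿ⁺¹ f(a₀, …, aₙ₋₁) aₙ`. -/
def hochschildD (n : ℕ) : Cochain k A n →ₗ[k] Cochain k A (n + 1) where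
  toFun f := leftTerm f + ∑ i : Fin n, (-1 : k) ^ ((i : ℕ) + 1) • contract f i
    + (-1 : k) ^ (n + 1) • rightTerm f
  map_add' f g := by
    ext v
    simp [leftTerm, contract, rightTerm, mul_add, add_mul, Finset.sum_add_distrib]
    abel
  map_smul' c f := by
    ext v
    simp [leftTerm, contract, rightTerm, Finset.smul_sum, smul_comm c]

theorem append_update {A : Type*} {m n : ℕ} (v : Fin (m + n) → A) :
    (∀ (j : Fin m) x, (fun i => Function.update v (Fin.castAdd n j) x (Fin.castAdd n i))
      = Function.update (fun i => v (Fin.castAdd n i)) j x) ∧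
    (∀ (j : Fin m) x, (fun i => Function.update v (Fin.castAdd n j) x (Fin.natAdd m i))
      = fun i => v (Fin.natAdd m i)) ∧
    (∀ (j : Fin n) x, (fun i => Function.update v (Fin.natAdd m j) x (Fin.natAdd m i))
      = Function.update (fun i => v (Fin.natAdd m i)) j x) ∧
    (∀ (j : Fin n) x, (fun i => Function.update v (Fin.natAdd m j) x (Fin.castAdd n i))
      = fun i => v (Fin.castAdd n i)) := by
  refine ⟨fun j x => funext fun i => ?_, fun j x => funext fun i => ?_,
    fun j x => funext fun i => ?_, fun j x => funext fun i => ?_⟩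
  · simp [Function.update_apply]
  · have := j.isLt
    simp [Function.update_apply, Fin.ext_iff]; omega
  · simp [Function.update_apply]
  · have := i.isLt
    simp [Function.update_apply, Fin.ext_iff]; omega

/-- The cup product of cochains,
`(f ∪ g)(a₁, …, aₘ₊ₙ) = f(a₁, …, aₘ) g(aₘ₊₁, …, aₘ₊ₙ)`. -/
def cup {m n : ℕ} (f : Cochain k A m) (g : Cochain k A n) : Cochain k A (m + n) where
  toFun v := f (fun i => v (Fin.castAdd n i)) * g (fun i => v (Fin.natAdd m i))
  map_update_add' {inst} v j x y := by
    obtain rfl : inst = instDecidableEqFin _ := Subsingleton.elim _ _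
    obtain ⟨h₁, h₂, h₃, h₄⟩ := append_update v
    induction j using Fin.addCases with
    | left j => simp [h₁, h₂, add_mul]
    | right j => simp [h₃, h₄, mul_add]
  map_update_smul' {inst} v j c x := by
    obtain rfl : inst = instDecidableEqFin _ := Subsingleton.elim _ _
    obtain ⟨h₁, h₂, h₃, h₄⟩ := append_update v
    induction j using Fin.addCases with
    | left j => simp [h₁, h₂]
    | right j => simp [h₃, h₄]

/-- Evaluation of a cochain at the first `n` terms of a sequence. -/
def ev {n : ℕ} (f : Cochain k A n) (a : ℕ → A) : A := f fun i => a i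

theorem ext_ev {n : ℕ} {f g : Cochain k A n} (h : ∀ a, ev f a = ev g a) : f = g := by
  ext v
  have := h fun i => if hi : i < n then v ⟨i, hi⟩ else 0
  simpa [ev] using this

/-- The sequence `(a₀, …, aᵢaᵢ₊₁, …)`. -/
def contractSeq (i : ℕ) (a : ℕ → A) : ℕ → A :=
  fun j => if j < i then a j else if j = i then a j * a (j + 1) else a (j + 1)

theorem ev_d {n : ℕ} (f : Cochain k A n) (a : ℕ → A) :
    ev (hochschildD n f) a = a 0 * ev f (fun i => a (i + 1))
      + ∑ i ∈ Finset.range n, (-1 : k) ^ (i + 1) • ev f (contractSeq i a)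
      + (-1 : k) ^ (n + 1) • (ev f a * a n) := by
  rw [Finset.sum_range]
  simp only [ev, hochschildD, leftTerm, rightTerm, contract, LinearMap.coe_mk, AddHom.coe_mk,
    add_apply, sum_apply, smul_apply, MultilinearMap.coe_mk]
  congr 2

theorem ev_cup {m n : ℕ} (f : Cochain k A m) (g : Cochain k A n) (a : ℕ → A) :
    ev (cup f g) a = ev f a * ev g (fun i => a (m + i)) := rfl

theorem ev_congr {n : ℕ} (f : Cochain k A n) {a b : ℕ → A} (h : ∀ i < n, a i = b i) :
    ev f a = ev f b := by
  unfold ev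
  congr 1
  funext i
  exact h i i.isLt

theorem leibniz_ev {m n : ℕ} (f : Cochain k A m) (g : Cochain k A n) (a : ℕ → A) :
    ev (hochschildD (m + n) (cup f g)) a
      = ev (cup (hochschildD m f) g) a + (-1 : k) ^ m • ev (cup f (hochschildD n g)) a := by
  have h₁ : ∀ i ∈ Finset.range m, (-1 : k) ^ (i + 1) • ev (cup f g) (contractSeq i a)
      = ((-1 : k) ^ (i + 1) • ev f (contractSeq i a)) * ev g (fun i => a (m + 1 + i)) := by
    intro i hi
    have hi := Finset.mem_range.1 hi
    rw [ev_cup, smul_mul_assoc]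
    congr 2
    refine ev_congr _ fun j _ => ?_
    simp only [contractSeq]
    rw [if_neg (by omega), if_neg (by omega)]
    congr 1; omega
  have h₂ : ∀ i ∈ Finset.range n, (-1 : k) ^ (m + i + 1) • ev (cup f g) (contractSeq (m + i) a)
      = (-1 : k) ^ m • (ev f a * ((-1 : k) ^ (i + 1) •
          ev g (contractSeq i fun i => a (m + i)))) := by
    intro i hi
    rw [ev_cup, mul_smul_comm, smul_smul, ← pow_add, add_assoc]
    congr 2
    · refine ev_congr _ fun j hj => ?_
      simp only [contractSeq]
      rw [if_pos (by omega)]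
    · refine ev_congr _ fun j hj => ?_
      simp only [contractSeq, add_lt_add_iff_left, add_right_inj, add_assoc]
  rw [ev_d, Finset.sum_range_add, Finset.sum_congr rfl h₁, Finset.sum_congr rfl h₂]
  simp only [ev_cup, ev_d, add_mul, mul_add, Finset.sum_mul, Finset.mul_sum, smul_add,
    Finset.smul_sum]
  have e₁ : (fun i => a (m + i + 1)) = fun i => a (m + 1 + i) := by
    funext i; congr 1; omega
  have e₂ : (fun i => a (m + (i + 1))) = fun i => a (m + 1 + i) := by
    funext i; congr 1; omega
  simp only [e₁, e₂, smul_mul_assoc, mul_smul_comm, add_zero, pow_add, pow_one, mul_neg, mul_one,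
    neg_smul, neg_mul, smul_smul, mul_assoc, smul_neg]
  abel

variable (k A) in
/-- Hochschild cocycles of degree `n`. -/
def cocycles (n : ℕ) : Submodule k (Cochain k A n) := LinearMap.ker (hochschildD n)

variable (k A) in
/-- Hochschild coboundaries of degree `n`. -/
def coboundaries : (n : ℕ) → Submodule k (Cochain k A n)
  | 0 => ⊥
  | n + 1 => LinearMap.range (hochschildD n)

theorem mem_cocycles_iff {n : ℕ} {f : Cochain k A n} :
    f ∈ cocycles k A n ↔ ∀ a, ev (hochschildD n f) a = 0 := by
  rw [cocycles, LinearMap.mem_ker]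
  exact ⟨fun h a => by rw [h]; rfl, fun h => ext_ev h⟩

theorem mem_coboundaries_of_ev {n p : ℕ} (h : p + 1 = n) {f : Cochain k A n} (e : Cochain k A p)
    (he : ∀ a, ev f a = ev (hochschildD p e) a) : f ∈ coboundaries k A n := by
  subst h
  exact ⟨e, (ext_ev he).symm⟩

theorem cup_mem_cocycles {m n : ℕ} {f : Cochain k A m} {g : Cochain k A n}
    (hf : f ∈ cocycles k A m) (hg : g ∈ cocycles k A n) : cup f g ∈ cocycles k A (m + n) := by
  rw [mem_cocycles_iff] at hf hg ⊢
  intro a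
  rw [leibniz_ev, ev_cup, ev_cup, hf, hg]
  simp

theorem cup_mem_coboundaries_left {m n : ℕ} {f : Cochain k A m} {g : Cochain k A n}
    (hf : f ∈ coboundaries k A m) (hg : g ∈ cocycles k A n) :
    cup f g ∈ coboundaries k A (m + n) := by
  rw [mem_cocycles_iff] at hg
  cases m with
  | zero =>
    obtain rfl : f = 0 := hf
    have : cup (0 : Cochain k A 0) g = 0 := ext_ev fun a => by rw [ev_cup]; simp [ev]
    rw [this]
    exact zero_mem _
  | succ m =>
    obtain ⟨e, rfl⟩ := hf
    refine mem_coboundaries_of_ev (by omega) (cup e g) fun a => ?_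
    rw [leibniz_ev, ev_cup e, hg]
    simp

theorem cup_mem_coboundaries_right {m n : ℕ} {f : Cochain k A m} {g : Cochain k A n}
    (hf : f ∈ cocycles k A m) (hg : g ∈ coboundaries k A n) :
    cup f g ∈ coboundaries k A (m + n) := by
  rw [mem_cocycles_iff] at hf
  cases n with
  | zero =>
    obtain rfl : g = 0 := hg
    have : cup f (0 : Cochain k A 0) = 0 := ext_ev fun a => by rw [ev_cup]; simp [ev]
    rw [this]
    exact zero_mem _
  | succ n =>
    obtain ⟨e, rfl⟩ := hg
    refine mem_coboundaries_of_ev (p := m + n) (by omega) ((-1 : k) ^ m • cup f e) fun a => ?_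
    have : ev (hochschildD (m + n) ((-1 : k) ^ m • cup f e)) a
        = (-1 : k) ^ m • ev (hochschildD (m + n) (cup f e)) a := by
      rw [map_smul]; rfl
    rw [this, leibniz_ev, ev_cup (hochschildD m f), hf, zero_mul, zero_add, smul_smul, ← mul_pow]
    simp

variable (k A) in
/-- The cup product on cocycles. -/
def cupCocycles (m n : ℕ) :
    cocycles k A m →ₗ[k] cocycles k A n →ₗ[k] cocycles k A (m + n) :=
  LinearMap.mk₂ k (fun f g => ⟨cup f.1 g.1, cup_mem_cocycles f.2 g.2⟩)
    (fun _ _ _ => Subtype.ext (MultilinearMap.ext fun _ => add_mul _ _ _))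
    (fun _ _ _ => Subtype.ext (MultilinearMap.ext fun _ => smul_mul_assoc _ _ _))
    (fun _ _ _ => Subtype.ext (MultilinearMap.ext fun _ => mul_add _ _ _))
    (fun _ _ _ => Subtype.ext (MultilinearMap.ext fun _ => mul_smul_comm _ _ _))

end Complex

section Cohomology

variable (k A : Type*) [Field k] [Ring A] [Algebra k A]

/-- The Hochschild cohomology group `HHⁿ(A) = HHⁿ(A, A)`. -/
def HH (n : ℕ) : Type _ := cocycles k A n ⧸ (coboundaries k A n).submoduleOf (cocycles k A n)

instance (n : ℕ) : AddCommGroup (HH k A n) :=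
  inferInstanceAs (AddCommGroup (cocycles k A n ⧸ _))

instance (n : ℕ) : Module k (HH k A n) :=
  inferInstanceAs (Module k (cocycles k A n ⧸ _))

/-- The class of a cocycle. -/
def HH.mk (n : ℕ) : cocycles k A n →ₗ[k] HH k A n := Submodule.mkQ _

variable {k A}

theorem HH.mk_surjective (n : ℕ) : Function.Surjective (HH.mk k A n) := Submodule.mkQ_surjective _

theorem HH.mk_eq_zero {n : ℕ} {f : cocycles k A n} :
    HH.mk k A n f = 0 ↔ f.1 ∈ coboundaries k A n :=
  (Submodule.Quotient.mk_eq_zero _).trans Iff.rfl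

variable (k A) in
/-- The cup product on Hochschild cohomology. -/
def HH.mul (m n : ℕ) : HH k A m →ₗ[k] HH k A n →ₗ[k] HH k A (m + n) :=
  Submodule.liftQ _
    ((LinearMap.flip (Submodule.liftQ _
      ((LinearMap.compr₂ (cupCocycles k A m n) (HH.mk k A (m + n))).flip)
      (fun g hg => by
        refine LinearMap.ext fun f => HH.mk_eq_zero.2 ?_
        exact cup_mem_coboundaries_right f.2 hg))) :
      cocycles k A m →ₗ[k] HH k A n →ₗ[k] HH k A (m + n))
    (fun f hf => by
      refine LinearMap.ext fun g => ?_
      obtain ⟨g, rfl⟩ := HH.mk_surjective n g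
      exact HH.mk_eq_zero.2 (cup_mem_coboundaries_left hf g.2))

theorem HH.mul_mk {m n : ℕ} (f : cocycles k A m) (g : cocycles k A n) :
    HH.mul k A m n (HH.mk k A m f) (HH.mk k A n g) = HH.mk k A (m + n) (cupCocycles k A m n f g) :=
  rfl

variable (k A) in
/-- The unit `0`-cocycle. -/
def oneCocycle : cocycles k A 0 :=
  ⟨MultilinearMap.constOfIsEmpty k _ 1, mem_cocycles_iff.2 fun a => by
    rw [ev_d]; simp [ev]⟩

theorem gradedMk_eq {m n : ℕ} (h : m = n) (f : cocycles k A m) (g : cocycles k A n)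
    (hfg : ∀ a, ev f.1 a = ev g.1 a) :
    GradedMonoid.mk (A := HH k A) m (HH.mk k A m f) = GradedMonoid.mk n (HH.mk k A n g) := by
  subst h
  rw [Subtype.ext (ext_ev hfg)]

instance : GradedMonoid.GMul (HH k A) where
  mul {m n} f g := HH.mul k A m n f g

instance : GradedMonoid.GOne (HH k A) where
  one := HH.mk k A 0 (oneCocycle k A)

instance : DirectSum.GRing (HH k A) where
  one_mul := by
    rintro ⟨n, f⟩
    obtain ⟨f, rfl⟩ := HH.mk_surjective n f
    refine gradedMk_eq (zero_add n) (cupCocycles k A 0 n (oneCocycle k A) f) f fun a => ?_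
    change ev (cup _ _) a = _
    rw [ev_cup]
    simp [oneCocycle, ev]
  mul_one := by
    rintro ⟨n, f⟩
    obtain ⟨f, rfl⟩ := HH.mk_surjective n f
    refine gradedMk_eq (add_zero n) (cupCocycles k A n 0 f (oneCocycle k A)) f fun a => ?_
    change ev (cup _ _) a = _
    rw [ev_cup]
    simp [oneCocycle, ev]
  mul_assoc := by
    rintro ⟨l, f⟩ ⟨m, g⟩ ⟨n, h⟩
    obtain ⟨f, rfl⟩ := HH.mk_surjective l f
    obtain ⟨g, rfl⟩ := HH.mk_surjective m g
    obtain ⟨h, rfl⟩ := HH.mk_surjective n h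
    refine gradedMk_eq (add_assoc l m n)
      (cupCocycles k A (l + m) n (cupCocycles k A l m f g) h)
      (cupCocycles k A l (m + n) f (cupCocycles k A m n g h)) fun a => ?_
    change ev (cup (cup _ _) _) a = ev (cup _ (cup _ _)) a
    simp only [ev_cup, mul_assoc, add_assoc]
  mul_zero f := map_zero _
  zero_mul g := by change HH.mul k A _ _ 0 g = 0; simp
  mul_add f g h := map_add _ _ _
  add_mul f g h := by change HH.mul k A _ _ (f + g) h = _; rw [map_add]; rfl
  natCast n := n • HH.mk k A 0 (oneCocycle k A)
  natCast_zero := zero_smul _ _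
  natCast_succ n := succ_nsmul _ _
  intCast n := n • HH.mk k A 0 (oneCocycle k A)
  intCast_ofNat n := natCast_zsmul _ _
  intCast_negSucc_ofNat n := negSucc_zsmul _ _

instance : DirectSum.GAlgebra k (HH k A) where
  toFun :=
    { toFun := fun r => HH.mk k A 0 (r • oneCocycle k A)
      map_zero' := by simp
      map_add' := fun r s => by simp [add_smul] }
  map_one := congrArg _ (one_smul k (oneCocycle k A))
  map_mul r s := by
    refine gradedMk_eq rfl ((r * s) • oneCocycle k A)
      (cupCocycles k A 0 0 (r • oneCocycle k A) (s • oneCocycle k A)) fun a => ?_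
    change _ = ev (cup _ _) a
    rw [ev_cup]
    simp [oneCocycle, ev, mul_smul, smul_comm r s]
  commutes := by
    rintro r ⟨n, f⟩
    obtain ⟨f, rfl⟩ := HH.mk_surjective n f
    refine gradedMk_eq (by omega) (cupCocycles k A 0 n (r • oneCocycle k A) f)
      (cupCocycles k A n 0 f (r • oneCocycle k A)) fun a => ?_
    change ev (cup _ _) a = ev (cup _ _) a
    simp only [ev_cup]
    simp [oneCocycle, ev]
  smul_def := by
    rintro r ⟨n, f⟩
    obtain ⟨f, rfl⟩ := HH.mk_surjective n f
    refine gradedMk_eq (by omega) (r • f) (cupCocycles k A 0 n (r • oneCocycle k A) f) fun a => ?_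
    change _ = ev (cup _ _) a
    simp only [ev_cup]
    simp [oneCocycle, ev]

variable (k A) in
/-- The Hochschild cohomology ring `HH*(A) = ⨁ₙ HHⁿ(A)`. -/
abbrev HHRing : Type _ := ⨁ n, HH k A n

/-- The Hochschild cohomology of `A` is finite dimensional in each degree, and its Hilbert series
`∑ₙ dim HHⁿ(A) tⁿ` is `P`. -/
def HasHilbertSeries (k A : Type*) [Field k] [Ring A] [Algebra k A] (P : PowerSeries ℚ) : Prop :=
  (∀ n, Module.Finite k (HH k A n)) ∧
    PowerSeries.mk (fun n => (Module.finrank k (HH k A n) : ℚ)) = P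

/-- `N` is the first degree `≥ 3` in which the Hochschild cohomology of `A` is nonzero. -/
def FirstNonzeroFromThree (k A : Type*) [Field k] [Ring A] [Algebra k A] (N : ℕ) : Prop :=
  3 ≤ N ∧ (∀ n, 3 ≤ n → n < N → Subsingleton (HH k A n)) ∧ Nontrivial (HH k A N)

end Cohomology

end Hochschild

namespace QuantumPlane

open Hochschild

section Algebra

variable {k : Type*} [Field k] (q : k)

/-- The relations `x² = 0`, `xy + q yx = 0`, `y² = 0` on the free algebra on `x = X₀`, `y = X₁`. -/
inductive Rel : FreeAlgebra k (Fin 2) → FreeAlgebra k (Fin 2) → Prop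
  | x_sq : Rel (FreeAlgebra.ι k 0 * FreeAlgebra.ι k 0) 0
  | x_y : Rel (FreeAlgebra.ι k 0 * FreeAlgebra.ι k 1
      + q • (FreeAlgebra.ι k 1 * FreeAlgebra.ι k 0)) 0
  | y_sq : Rel (FreeAlgebra.ι k 1 * FreeAlgebra.ι k 1) 0

/-- The algebra `Λ_q = k⟨x, y⟩ / (x², xy + q yx, y²)`. -/
abbrev Lam : Type _ := RingQuot (Rel q)

/-- The generator `x` of `Λ_q`. -/
def Lam.x : Lam q := RingQuot.mkAlgHom k (Rel q) (FreeAlgebra.ι k 0)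

/-- The generator `y` of `Λ_q`. -/
def Lam.y : Lam q := RingQuot.mkAlgHom k (Rel q) (FreeAlgebra.ι k 1)

variable {q}

/-- The value of an `n`-cochain at `fⁿᵢ`, the sum over all words of length `n` in `x` and `y` with
`i` letters `y` of the corresponding `n`-fold tensors, the coefficient being `q` to the number of
pairs consisting of a `y` and an `x` to the right of it; `S` is the set of positions of the letters
`y`. For `i > n` this is `0`. -/
noncomputable def koszulValue {n : ℕ} (c : Cochain k (Lam q) n) (i : ℕ) : Lam q :=
  ∑ S ∈ Finset.powersetCard i (Finset.univ : Finset (Fin n)),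
    q ^ (Finset.univ.filter fun p : Fin n × Fin n => p.1 < p.2 ∧ p.1 ∈ S ∧ p.2 ∉ S).card •
      c fun a => if a ∈ S then Lam.y q else Lam.x q

/-- The class `h ∈ HHⁿ(Λ_q)` is represented by the map `Pⁿ = ⨁ᵢ Λ ⊗ fⁿᵢ ⊗ Λ → Λ` of bimodules on
the Koszul resolution `P`, a subcomplex of the bar resolution, that sends `1 ⊗ fⁿᵢ ⊗ 1` to `v i`:
this map extends to a Hochschild cocycle, and `h` is the class of every such cocycle. -/
def IsRepBy {n : ℕ} (h : HH k (Lam q) n) (v : ℕ → Lam q) : Prop :=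
  (∃ c : cocycles k (Lam q) n, ∀ i, koszulValue c.1 i = v i) ∧
    ∀ c : cocycles k (Lam q) n, (∀ i, koszulValue c.1 i = v i) → HH.mk k (Lam q) n c = h

/-- The maps in `S` represent a basis of `HHⁿ(Λ_q)` (different maps representing different
elements of the basis). -/
def RepBasis (q : k) (n : ℕ) (S : Set (ℕ → Lam q)) : Prop :=
  ∃ b : Module.Basis S k (HH k (Lam q) n), ∀ v : S, IsRepBy (b v) v

/-- The map `Pⁿ → Λ` that sends the `j`-th generator to `a` and the others to `0`. -/
def eVec (a : Lam q) (j : ℕ) : ℕ → Lam q := Pi.single j a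

/-- The map `F` sends the class in `HHⁿ(Λ_q)` that is represented by the map `v : Pⁿ → Λ` to `t`. -/
def Sends {T : Type*} (F : HHRing k (Lam q) → T) (n : ℕ) (v : ℕ → Lam q) (t : T) : Prop :=
  ∃ h : HH k (Lam q) n, IsRepBy h v ∧ F (DirectSum.of (HH k (Lam q)) n h) = t

end Algebra

section Presentations

variable (k : Type*) [Field k]

/-- The fibre product `R ×_k S` of augmented `k`-algebras. -/
abbrev FibreProduct {k R S : Type*} [Field k] [Ring R] [Ring S] [Algebra k R] [Algebra k S]
    (f : R →ₐ[k] k) (g : S →ₐ[k] k) : Subalgebra k (R × S) :=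
  AlgHom.equalizer (f.comp (AlgHom.fst k R S)) (g.comp (AlgHom.snd k R S))

/-- The exterior algebra `∧(u₀, …, uₙ₋₁)` over `k`. -/
abbrev ExtAlg (n : ℕ) : Type _ := ExteriorAlgebra k (Fin n → k)

/-- The generator `uᵢ` of the exterior algebra. -/
abbrev extGen {n : ℕ} (i : Fin n) : ExtAlg k n := ExteriorAlgebra.ι k (Pi.single i 1)

/-- The polynomial ring `R[w₀, …, wₙ₋₁]` in central variables. -/
abbrev Poly (R : Type*) [Ring R] [Algebra k R] (n : ℕ) : Type _ := R ⊗[k] MvPolynomial (Fin n) k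

variable {k}

/-- A constant in `R[w₀, …, wₙ₋₁]`. -/
noncomputable abbrev cst {R : Type*} [Ring R] [Algebra k R] {n : ℕ} (a : R) : Poly k R n := a ⊗ₜ 1

variable (k) in
/-- The variable `wᵢ` of `R[w₀, …, wₙ₋₁]`. -/
noncomputable abbrev polyVar (R : Type*) [Ring R] [Algebra k R] {n : ℕ} (i : Fin n) : Poly k R n :=
  1 ⊗ₜ MvPolynomial.X i

/-- The quotient of a ring by the two-sided ideal generated by `S`. -/
abbrev QuotBy {R : Type*} [Ring R] (S : Set R) : Type _ := RingQuot fun a b => a ∈ S ∧ b = 0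

variable (k) in
/-- The quotient map. -/
abbrev quotMk {R : Type*} [Ring R] [Algebra k R] (S : Set R) : R →ₐ[k] QuotBy S :=
  RingQuot.mkAlgHom k _

variable (k)

/-- The augmentation of `∧(u₀, …)[w₀, …]` that sends all generators to `0`. -/
noncomputable def extPolyAug (m n : ℕ) : Poly k (ExtAlg k m) n →ₐ[k] k :=
  Algebra.TensorProduct.lift ExteriorAlgebra.algebraMapInv (MvPolynomial.aeval fun _ => 0)
    fun _ _ => Commute.all _ _

/-- The relation `w₀w₂ - w₁²`. -/
noncomputable abbrev conicRel : Set (Poly k (ExtAlg k 2) 3) :=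
  {polyVar k (ExtAlg k 2) 0 * polyVar k (ExtAlg k 2) 2 - polyVar k (ExtAlg k 2) 1 ^ 2}

/-- The augmentation of `∧(u₀, u₁)[w₀, w₁, w₂]/(w₀w₂ - w₁²)`. -/
noncomputable def conicAug : QuotBy (conicRel k) →ₐ[k] k :=
  RingQuot.liftAlgHom k ⟨extPolyAug k 2 3, by
    rintro a b ⟨rfl, rfl⟩
    simp [extPolyAug]⟩

/-- `k[z]/(z²) ×_k (∧(u₀, u₁)[w₀, w₁, w₂]/(w₀w₂ - w₁²))`. -/
abbrev PresA : Type _ :=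
  FibreProduct (TrivSqZeroExt.fstHom k k k : DualNumber k →ₐ[k] k) (conicAug k)

/-- `k[z]/(z²) ×_k ∧(u₀, u₁)[w₀, w₁]`. -/
abbrev PresB : Type _ :=
  FibreProduct (TrivSqZeroExt.fstHom k k k : DualNumber k →ₐ[k] k) (extPolyAug k 2 2)

/-- `Λ_q[w₀, w₁]`. -/
abbrev PresC {k : Type*} [Field k] (q : k) : Type _ := Poly k (Lam q) 2

/-- The relations `xu₀, yu₁, xw₀, yw₁` in `(Λ_q ⊗ ∧(u₀, u₁))[w₀, w₁]`. -/
noncomputable abbrev relD {k : Type*} [Field k] (q : k) : Set (Poly k (Lam q ⊗[k] ExtAlg k 2) 2) :=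
  {cst (Lam.x q ⊗ₜ extGen k 0), cst (Lam.y q ⊗ₜ extGen k 1), cst (Lam.x q ⊗ₜ 1) * polyVar k _ 0,
    cst (Lam.y q ⊗ₜ 1) * polyVar k _ 1}

/-- `(Λ_q ⊗ ∧(u₀, u₁))[w₀, w₁]/(xu₀, yu₁, xw₀, yw₁)`. -/
abbrev PresD {k : Type*} [Field k] (q : k) : Type _ := QuotBy (relD q)

/-- `k[z]/(z²) ×_k ∧(u₀, u₁, u₂, u₃)`. -/
abbrev BaseE : Type _ :=
  FibreProduct (TrivSqZeroExt.fstHom k k k : DualNumber k →ₐ[k] k)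
    (ExteriorAlgebra.algebraMapInv : ExtAlg k 4 →ₐ[k] k)

/-- The generator `z` of `(k[z]/(z²) ×_k ∧(u₀, u₁, u₂, u₃))[w₀, w₁, w₂]`. -/
noncomputable abbrev zE : Poly k (BaseE k) 3 := cst ⟨(DualNumber.eps, 0), by simp⟩

/-- The generator `uᵢ` of `(k[z]/(z²) ×_k ∧(u₀, u₁, u₂, u₃))[w₀, w₁, w₂]`. -/
noncomputable abbrev uE (i : Fin 4) : Poly k (BaseE k) 3 :=
  cst ⟨(0, extGen k i), by simp [ExteriorAlgebra.algebraMapInv]⟩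

/-- The generator `wᵢ` of `(k[z]/(z²) ×_k ∧(u₀, u₁, u₂, u₃))[w₀, w₁, w₂]`. -/
noncomputable abbrev wE (i : Fin 3) : Poly k (BaseE k) 3 := polyVar k (BaseE k) i

/-- The generators of the ideal `I`. -/
noncomputable abbrev relE : Set (Poly k (BaseE k) 3) :=
  {uE k 0 * uE k 2, uE k 1 * uE k 3,
    uE k 0 * uE k 1 + zE k * wE k 0, uE k 0 * uE k 3 + zE k * wE k 1,
    uE k 2 * uE k 3 + zE k * wE k 2, uE k 1 * uE k 2 - zE k * wE k 1,
    uE k 0 * wE k 1 - uE k 2 * wE k 0, uE k 1 * wE k 1 - uE k 3 * wE k 0,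
    uE k 0 * wE k 2 - uE k 2 * wE k 1, uE k 1 * wE k 2 - uE k 3 * wE k 1,
    wE k 0 * wE k 2 - wE k 1 ^ 2}

/-- `(k[z]/(z²) ×_k ∧(u₀, u₁, u₂, u₃))[w₀, w₁, w₂]/I`. -/
abbrev PresE : Type _ := QuotBy (relE k)

end Presentations

end QuantumPlane

open Hochschild QuantumPlane

/-! ### The algebra `Λ_q`: its basis `1, x, y, yx`. -/

namespace QuantumPlane

section Structure

variable {k : Type*} [Field k] (q : k)

/-! The Koszul elements `fⁿᵢ` span a subcomplex of the bar resolution that is again a resolution, so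
Hochschild cohomology is computed by tuples `(λ₀, …, λₙ)`. This is made explicit. With coefficients
in an arbitrary bimodule `M`, an `(n+1)`-cochain is an `n`-cochain with coefficients in `Hom_k(Λ,
M)`. The restriction `kap` to the Koszul elements, the extension `extK` of tuples to cochains and
the homotopy `hC` between the identity and `extK ∘ kap` are built by recursion on the degree with
`M` varying (`kap_extK`, `dC_extK`, `kap_dC`, `dhC_add_hC`). The only computational input is a null
homotopy `sK` of Koszul complexes (`sK_dK_add`).

In the monomials `1, x, y, yx` the Koszul complex falls apart (`coord_dLam`). For `p` letters `x`
and `s` letters `y`, with `n = p + s`, there is a square `1 eₛ → x eₛ, y eₛ₊₁ → yx eₛ₊₁` whose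
arrows are, up to sign and a factor `q`, the two scalars `1 - (-1)ⁿ qˢ` and `qᵖ - (-1)ⁿ`. As `q ≠
0`, the square is exact unless both scalars vanish (`Sq`), and then all four corners survive. What
remains are the boundary pieces `x eₙ → yx eₙ₊₁` and `y e₀ → yx e₀`, whose arrow is `1 + (-1)ⁿ q` up
to sign, and `yx e₀` in degree zero. So the surviving monomial tuples represent a basis
(`repBasis_survSet`), and the Hilbert series follows (`hasHilbertSeries_of`). The cases of the
theorem differ in which `(p, s)` satisfy `Sq`, and in whether `q = ±1` lets boundary pieces survive.

For the ring structure, `fᵐ⁺ⁿᵢ = ∑ q^(j(n-l)) fᵐⱼ ⊗ fⁿₗ` over `j + l = i`, so the cup product of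
tuples is explicit (`koszulValue_cup`), and monomial classes multiply like monomials of `Λ_q` up to
a power of `q` (`cls_mul_cls`). For each presentation the relations are checked on classes, which
gives an algebra map to the cohomology ring. Normal forms that span the presented algebra go to
nonzero multiples of the basis, so the map is bijective (`bijective_of_span`). -/

theorem Lam.x_mul_x : Lam.x q * Lam.x q = 0 := by
  rw [Lam.x, ← map_mul, RingQuot.mkAlgHom_rel k Rel.x_sq, map_zero]

theorem Lam.y_mul_y : Lam.y q * Lam.y q = 0 := by
  rw [Lam.y, ← map_mul, RingQuot.mkAlgHom_rel k Rel.y_sq, map_zero]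

theorem Lam.x_mul_y : Lam.x q * Lam.y q = (-q) • (Lam.y q * Lam.x q) := by
  have h := RingQuot.mkAlgHom_rel k (Rel.x_y (q := q))
  rw [map_add, map_smul, map_mul, map_mul, map_zero] at h
  exact (eq_neg_of_add_eq_zero_left h).trans (neg_smul q (Lam.y q * Lam.x q)).symm

/-- The matrices of left multiplication by `x` and `y` in the basis `1, x, y, yx`. -/
def leftMulMatrix : Fin 2 → Matrix (Fin 4) (Fin 4) k :=
  ![!![0, 0, 0, 0; 1, 0, 0, 0; 0, 0, 0, 0; 0, 0, -q, 0],
    !![0, 0, 0, 0; 0, 0, 0, 0; 1, 0, 0, 0; 0, 1, 0, 0]]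

/-- The left regular representation of `Λ_q`. -/
def leftRegular : Lam q →ₐ[k] Matrix (Fin 4) (Fin 4) k :=
  RingQuot.liftAlgHom k ⟨FreeAlgebra.lift k (leftMulMatrix q), by
    intro a b h
    cases h <;> ext i j <;> fin_cases i <;> fin_cases j <;>
      simp [leftMulMatrix, Matrix.mul_apply, Fin.sum_univ_four]⟩

/-- The coordinates with respect to `1, x, y, yx`. -/
def Lam.coord (i : Fin 4) : Lam q →ₗ[k] k :=
  Matrix.entryLinearMap k k i 0 ∘ₗ (leftRegular q).toLinearMap

theorem leftRegular_x : leftRegular q (Lam.x q) = leftMulMatrix q 0 := by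
  simp [leftRegular, Lam.x]

theorem leftRegular_y : leftRegular q (Lam.y q) = leftMulMatrix q 1 := by
  simp [leftRegular, Lam.y]

@[simp] theorem Lam.coord_one (i : Fin 4) : Lam.coord q i 1 = if i = 0 then 1 else 0 := by
  simp [Lam.coord, Matrix.one_apply]

@[simp] theorem Lam.coord_x (i : Fin 4) : Lam.coord q i (Lam.x q) = if i = 1 then 1 else 0 := by
  fin_cases i <;> simp [Lam.coord, leftRegular_x, leftMulMatrix]

@[simp] theorem Lam.coord_y (i : Fin 4) : Lam.coord q i (Lam.y q) = if i = 2 then 1 else 0 := by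
  fin_cases i <;> simp [Lam.coord, leftRegular_y, leftMulMatrix]

@[simp] theorem Lam.coord_yx (i : Fin 4) :
    Lam.coord q i (Lam.y q * Lam.x q) = if i = 3 then 1 else 0 := by
  fin_cases i <;> simp [Lam.coord, leftRegular_x, leftRegular_y, leftMulMatrix]

/-- Every element is a combination of words in the generators, and a word arises from `1` by
successive left multiplications. -/
theorem Lam.mem_of_mul_mem {V : Submodule k (Lam q)} (h1 : (1 : Lam q) ∈ V)
    (hx : ∀ a ∈ V, Lam.x q * a ∈ V) (hy : ∀ a ∈ V, Lam.y q * a ∈ V) (a : Lam q) : a ∈ V := by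
  obtain ⟨a, rfl⟩ := RingQuot.mkAlgHom_surjective k (Rel q) a
  suffices h : ∀ b ∈ V, RingQuot.mkAlgHom k (Rel q) a * b ∈ V by simpa using h 1 h1
  induction a using FreeAlgebra.induction with
  | grade0 r => intro b hb; simpa [Algebra.algebraMap_eq_smul_one] using V.smul_mem r hb
  | grade1 i => intro b hb; fin_cases i; exacts [hx b hb, hy b hb]
  | mul a b iha ihb => intro c hc; rw [map_mul, mul_assoc]; exact iha _ (ihb _ hc)
  | add a b iha ihb => intro c hc; rw [map_add, add_mul]; exact V.add_mem (iha _ hc) (ihb _ hc)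

/-- The span of the four monomials is stable under left multiplication by `x` and `y`, hence
everything. The coefficients are then found by applying the coordinate functionals of the regular
representation. -/
theorem Lam.eq_sum (a : Lam q) :
    a = Lam.coord q 0 a • (1 : Lam q) + Lam.coord q 1 a • Lam.x q + Lam.coord q 2 a • Lam.y q
      + Lam.coord q 3 a • (Lam.y q * Lam.x q) := by
  have hV : ∀ a, a ∈ Submodule.span k {1, Lam.x q, Lam.y q, Lam.y q * Lam.x q} := by
    have e1 := Lam.x_mul_x q
    have e2 := Lam.x_mul_y q
    have e3 := Lam.y_mul_y q
    have m1 : Lam.x q * (Lam.y q * Lam.x q) = 0 := by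
      rw [← mul_assoc, e2, smul_mul_assoc, mul_assoc, e1, mul_zero, smul_zero]
    have m2 : Lam.y q * (Lam.y q * Lam.x q) = 0 := by rw [← mul_assoc, e3, zero_mul]
    set V := Submodule.span k {1, Lam.x q, Lam.y q, Lam.y q * Lam.x q}
    have g1 : (1 : Lam q) ∈ V := Submodule.subset_span (by simp)
    have gx : Lam.x q ∈ V := Submodule.subset_span (by simp)
    have gy : Lam.y q ∈ V := Submodule.subset_span (by simp)
    have gyx : Lam.y q * Lam.x q ∈ V := Submodule.subset_span (by simp)
    have key : ∀ c : Lam q, (c ∈ V ∧ c * Lam.x q ∈ V ∧ c * Lam.y q ∈ V ∧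
        c * (Lam.y q * Lam.x q) ∈ V) → ∀ a ∈ V, c * a ∈ V := by
      rintro c ⟨h1, h2, h3, h4⟩ a ha
      have : V ≤ V.comap (LinearMap.mulLeft k c) := by
        refine Submodule.span_le.2 ?_
        rintro b (rfl | rfl | rfl | rfl) <;> simpa
      exact this ha
    refine Lam.mem_of_mul_mem q g1 (key _ ⟨gx, ?_, ?_, ?_⟩) (key _ ⟨gy, gyx, ?_, ?_⟩)
    · rw [e1]; exact V.zero_mem
    · rw [e2]; exact V.smul_mem _ gyx
    · rw [m1]; exact V.zero_mem
    · rw [e3]; exact V.zero_mem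
    · rw [m2]; exact V.zero_mem
  refine Submodule.span_induction (p := fun a _ => a = Lam.coord q 0 a • (1 : Lam q) +
    Lam.coord q 1 a • Lam.x q + Lam.coord q 2 a • Lam.y q +
    Lam.coord q 3 a • (Lam.y q * Lam.x q)) ?_ ?_ ?_ ?_ (hV a)
  · rintro b (rfl | rfl | rfl | rfl) <;> simp
  · simp
  · intro a b _ _ ha hb
    nth_rw 1 [ha, hb]
    simp only [map_add, add_smul]
    abel
  · intro c a _ ha
    nth_rw 1 [ha]
    simp only [map_smul, smul_add, smul_smul, smul_eq_mul]

theorem Lam.linearMap_ext {M : Type*} [AddCommGroup M] [Module k M] {f g : Lam q →ₗ[k] M}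
    (h1 : f 1 = g 1) (hx : f (Lam.x q) = g (Lam.x q)) (hy : f (Lam.y q) = g (Lam.y q))
    (hyx : f (Lam.y q * Lam.x q) = g (Lam.y q * Lam.x q)) : f = g := by
  ext a
  rw [Lam.eq_sum q a]
  simp only [map_add, map_smul, h1, hx, hy, hyx]

end Structure

end QuantumPlane

/-! ### Hochschild cochains with bimodule coefficients, in curried form. -/

namespace Hochschild

universe u v

/-- An `A`-bimodule over `k`, with the two actions given as bilinear maps. -/
structure Bimod (k : Type u) (A : Type v) [Field k] [Ring A] [Algebra k A] where
  carrier : Type v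
  [addCommGroup : AddCommGroup carrier]
  [module : Module k carrier]
  left : A →ₗ[k] carrier →ₗ[k] carrier
  right : A →ₗ[k] carrier →ₗ[k] carrier
  left_one : ∀ m, left 1 m = m
  left_mul : ∀ a b m, left (a * b) m = left a (left b m)
  right_one : ∀ m, right 1 m = m
  right_mul : ∀ a b m, right (a * b) m = right b (right a m)
  left_right : ∀ a b m, left a (right b m) = right b (left a m)

namespace Bimod

variable {k : Type u} {A : Type v} [Field k] [Ring A] [Algebra k A]

instance : CoeSort (Bimod k A) (Type v) := ⟨carrier⟩

instance (M : Bimod k A) : AddCommGroup M := M.addCommGroup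

instance (M : Bimod k A) : Module k M := M.module

variable (k A) in
/-- The regular bimodule. -/
@[reducible] def regular : Bimod k A where
  carrier := A
  left := LinearMap.mul k A
  right := (LinearMap.mul k A).flip
  left_one := by simp
  left_mul := by simp [mul_assoc]
  right_one := by simp
  right_mul := by simp [mul_assoc]
  left_right := by simp [mul_assoc]

/-- The bimodule `Hom_k(A, M)` with `(aφ)(b) = φ(ba)` and `(φa)(b) = φ(b)a`. -/
def coind (M : Bimod k A) : Bimod k A where
  carrier := A →ₗ[k] M
  left := LinearMap.mk₂ k (fun a φ => φ ∘ₗ LinearMap.mulRight k a)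
    (fun _ _ _ => by ext; simp [mul_add]) (fun _ _ _ => by ext; simp)
    (fun _ _ _ => by ext; simp) (fun _ _ _ => by ext; simp)
  right := LinearMap.mk₂ k (fun a φ => M.right a ∘ₗ φ)
    (fun _ _ _ => by ext; simp) (fun _ _ _ => by ext; simp)
    (fun _ _ _ => by ext; simp) (fun _ _ _ => by ext; simp)
  left_one := fun _ => by ext; simp
  left_mul := fun _ _ _ => by ext; simp [mul_assoc]
  right_one := fun _ => by ext; simp [M.right_one]
  right_mul := fun _ _ _ => by ext; simp [M.right_mul]
  left_right := fun _ _ _ => by ext; simp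

/-- The value of `φ ∈ Hom_k(A, M)` at an element of `A`. -/
def ap {M : Bimod k A} : M.coind →ₗ[k] A →ₗ[k] M := LinearMap.id

/-- A linear map `A → M` as an element of the coinduced bimodule. -/
def mkCoind {M : Bimod k A} : (A →ₗ[k] M) →ₗ[k] M.coind := LinearMap.id

@[simp] theorem ap_mkCoind {M : Bimod k A} (φ : A →ₗ[k] M) : ap (mkCoind φ) = φ := rfl

theorem ap_ext {M : Bimod k A} {φ ψ : M.coind} (h : ∀ b, ap φ b = ap ψ b) : φ = ψ :=
  LinearMap.ext h

@[simp] theorem ap_left (M : Bimod k A) (a b : A) (φ : M.coind) :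
    ap (M.coind.left a φ) b = ap φ (b * a) := rfl

@[simp] theorem ap_right (M : Bimod k A) (a b : A) (φ : M.coind) :
    ap (M.coind.right a φ) b = M.right a (ap φ b) := rfl

/-- A map of right modules. -/
def IsRightLinear {M N : Bimod k A} (f : M →ₗ[k] N) : Prop :=
  ∀ a m, f (M.right a m) = N.right a (f m)

/-- A map of left modules. -/
def IsLeftLinear {M N : Bimod k A} (f : M →ₗ[k] N) : Prop :=
  ∀ a m, f (M.left a m) = N.left a (f m)

/-- The map induced on coinduced bimodules by a linear map. -/
def coindMap {M N : Bimod k A} (f : M →ₗ[k] N) : M.coind →ₗ[k] N.coind :=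
  mkCoind ∘ₗ LinearMap.compRight k f ∘ₗ ap

@[simp] theorem ap_coindMap {M N : Bimod k A} (f : M →ₗ[k] N) (φ : M.coind) (b : A) :
    ap (coindMap f φ) b = f (ap φ b) := rfl

/-- The embedding `m ↦ (b ↦ bm)`. -/
def unit (M : Bimod k A) : M →ₗ[k] M.coind := mkCoind ∘ₗ M.left.flip

@[simp] theorem ap_unit (M : Bimod k A) (m : M) (b : A) :
    ap (M.unit m) b = M.left b m := rfl

/-- The map `m ↦ (b ↦ mb)`. -/
def rightUnit (M : Bimod k A) : M →ₗ[k] M.coind := mkCoind ∘ₗ M.right.flip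

@[simp] theorem ap_rightUnit (M : Bimod k A) (m : M) (b : A) :
    ap (M.rightUnit m) b = M.right b m := rfl

/-- Evaluation at `1`. -/
def evalOne (M : Bimod k A) : M.coind →ₗ[k] M := ap.flip 1

theorem isRightLinear_coindMap {M N : Bimod k A} {f : M →ₗ[k] N} (hf : IsRightLinear f) :
    IsRightLinear (coindMap f) := fun _ _ => ap_ext fun _ => hf _ _

theorem isLeftLinear_coindMap {M N : Bimod k A} (f : M →ₗ[k] N) :
    IsLeftLinear (coindMap f) := fun _ _ => rfl

theorem isRightLinear_unit (M : Bimod k A) : IsRightLinear M.unit :=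
  fun _ _ => ap_ext fun _ => M.left_right _ _ _

theorem isLeftLinear_unit (M : Bimod k A) : IsLeftLinear M.unit :=
  fun _ _ => ap_ext fun _ => (M.left_mul _ _ _).symm

/-- Only the right action is respected. The failure of left linearity is what turns evaluation at
`1` into a contraction in `dC_mapC_evalOne`. -/
theorem isRightLinear_evalOne (M : Bimod k A) : IsRightLinear M.evalOne := fun _ _ => rfl

theorem unit_comp {M N : Bimod k A} {f : M →ₗ[k] N} (hf : IsLeftLinear f) :
    N.unit ∘ₗ f = coindMap f ∘ₗ M.unit :=
  LinearMap.ext fun _ => ap_ext fun _ => (hf _ _).symm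

theorem rightUnit_comp {M N : Bimod k A} {f : M →ₗ[k] N} (hf : IsRightLinear f) :
    N.rightUnit ∘ₗ f = coindMap f ∘ₗ M.rightUnit :=
  LinearMap.ext fun _ => ap_ext fun _ => (hf _ _).symm

theorem evalOne_comp_unit (M : Bimod k A) : M.evalOne ∘ₗ M.unit = LinearMap.id :=
  LinearMap.ext M.left_one

/-- A triangle identity of coinduction: the value of `bφ` at `1` is `φ b`. -/
theorem coindMap_evalOne_comp_unit (M : Bimod k A) :
    coindMap M.evalOne ∘ₗ M.coind.unit = LinearMap.id :=
  LinearMap.ext fun φ => ap_ext fun b => congrArg (ap φ) (one_mul b)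

/-- Hochschild cochains with coefficients in `M` in curried form. -/
@[reducible] def C : ℕ → Bimod k A → Bimod k A
  | 0, M => M
  | n + 1, M => C n M.coind

/-- The map induced on cochains by a linear map of coefficients. -/
def mapC : (n : ℕ) → {M N : Bimod k A} → (M →ₗ[k] N) → (C n M →ₗ[k] C n N)
  | 0, _, _, f => f
  | n + 1, _, _, f => mapC n (coindMap f)

theorem mapC_succ (n : ℕ) {M N : Bimod k A} (f : M →ₗ[k] N) :
    mapC (n + 1) f = mapC n (coindMap f) := rfl

theorem mapC_comp (n : ℕ) {M N P : Bimod k A} (g : N →ₗ[k] P) (f : M →ₗ[k] N) :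
    mapC n (g ∘ₗ f) = mapC n g ∘ₗ mapC n f := by
  induction n generalizing M N P with
  | zero => rfl
  | succ n ih => exact ih (coindMap g) (coindMap f)

theorem mapC_id (n : ℕ) (M : Bimod k A) : mapC n (LinearMap.id : M →ₗ[k] M) = LinearMap.id := by
  induction n generalizing M with
  | zero => rfl
  | succ n ih => exact ih M.coind

theorem mapC_sub (n : ℕ) {M N : Bimod k A} (f g : M →ₗ[k] N) :
    mapC n (f - g) = mapC n f - mapC n g := by
  induction n generalizing M N with
  | zero => rfl
  | succ n ih => exact ih (coindMap f) (coindMap g)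

theorem mapC_zero (n : ℕ) (M N : Bimod k A) : mapC n (0 : M →ₗ[k] N) = 0 := by
  simpa using mapC_sub n (0 : M →ₗ[k] N) 0

/-- The Hochschild differential. -/
def dC : (n : ℕ) → (M : Bimod k A) → (C n M →ₗ[k] C (n + 1) M)
  | 0, M => M.unit - M.rightUnit
  -- The first term is `a₀ f(a₁, …)`. Since `a` acts on `M.coind` from the left by `φ ↦ φ(· a)`, the
  -- recursive term starts with `f(a₀a₁, …)`; the sign accounts for the shift of positions.
  | n + 1, M => mapC (n + 1) M.unit - dC n M.coind

theorem dC_succ (n : ℕ) (M : Bimod k A) :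
    dC (n + 1) M = mapC (n + 1) M.unit - dC n M.coind := rfl

/-- The left action on the coefficients enters only the leading term of the differential, so a right
linear map commutes with `dC` up to its failure to be left linear. In the induction the recursive
part commutes exactly, because `coindMap f` is always left linear. -/
theorem dC_mapC_sub {n : ℕ} {M N : Bimod k A} {f : M →ₗ[k] N} (hf : IsRightLinear f) :
    dC n N ∘ₗ mapC n f - mapC (n + 1) f ∘ₗ dC n M =
      mapC n (N.unit ∘ₗ f - coindMap f ∘ₗ M.unit) := by
  induction n generalizing M N with
  | zero =>
    change (N.unit - N.rightUnit) ∘ₗ f - coindMap f ∘ₗ (M.unit - M.rightUnit) = _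
    rw [LinearMap.sub_comp, LinearMap.comp_sub, rightUnit_comp hf]
    change _ = N.unit ∘ₗ f - coindMap f ∘ₗ M.unit
    abel
  | succ n ih =>
    have h := ih (isRightLinear_coindMap hf)
    rw [unit_comp (isLeftLinear_coindMap f), sub_self] at h
    rw [dC_succ, dC_succ, LinearMap.sub_comp, LinearMap.comp_sub]
    have e1 : mapC (n + 1) N.unit ∘ₗ mapC (n + 1) f = mapC (n + 1) (N.unit ∘ₗ f) :=
      (mapC_comp _ _ _).symm
    have e2 : mapC (n + 1 + 1) f ∘ₗ mapC (n + 1) M.unit = mapC (n + 1) (coindMap f ∘ₗ M.unit) :=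
      (mapC_comp (n + 1) (coindMap f) M.unit).symm
    rw [e1, e2, mapC_sub]
    have h' : dC n N.coind ∘ₗ mapC (n + 1) f = mapC (n + 1 + 1) f ∘ₗ dC n M.coind :=
      sub_eq_zero.1 (h.trans (mapC_zero n _ _))
    rw [h']
    abel

theorem dC_mapC {n : ℕ} {M N : Bimod k A} {f : M →ₗ[k] N} (hl : IsLeftLinear f)
    (hr : IsRightLinear f) (c : C n M) : dC n N (mapC n f c) = mapC (n + 1) f (dC n M c) := by
  have h := dC_mapC_sub (n := n) hr
  rw [unit_comp hl, sub_self, mapC_zero, sub_eq_zero] at h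
  exact LinearMap.congr_fun h c

/-- For `evalOne` the defect in `dC_mapC_sub` is `unit ∘ evalOne - id`. In particular, a cochain `c`
killed by `evalOne` is recovered from its differential by `evalOne`. -/
theorem dC_mapC_evalOne {n : ℕ} {M : Bimod k A} (c : C n M.coind) :
    dC n M (mapC n M.evalOne c) = mapC (n + 1) M.evalOne (dC n M.coind c) +
      (mapC n M.unit (mapC n M.evalOne c) - c) := by
  have h := LinearMap.congr_fun (dC_mapC_sub (n := n) M.isRightLinear_evalOne) c
  rw [coindMap_evalOne_comp_unit, mapC_sub, mapC_id, mapC_comp] at h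
  exact sub_eq_iff_eq_add'.1 h

/-- Above degree zero, `unit` is a bimodule map and so commutes with `dC`; the two mixed terms
cancel, and the square of the recursive term vanishes by induction. -/
theorem dC_dC (n : ℕ) (M : Bimod k A) (c : C n M) : dC (n + 1) M (dC n M c) = 0 := by
  induction n generalizing M with
  | zero =>
    refine ap_ext fun a => ap_ext fun b => ?_
    change M.left b (M.left a c - M.right a c) - ((M.left (b * a) c - M.right (b * a) c) -
      M.right a (M.left b c - M.right b c)) = 0
    simp only [map_sub, M.left_mul, M.right_mul, M.left_right]
    abel
  | succ n ih =>
    have e1 : dC (n + 1 + 1) M (dC (n + 1) M c) = mapC (n + 1 + 1) M.unit (dC (n + 1) M c) -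
      dC (n + 1) M.coind (dC (n + 1) M c) := rfl
    have e2 : dC (n + 1) M.coind (dC (n + 1) M c) = dC (n + 1) M.coind (mapC (n + 1) M.unit c) -
      dC (n + 1) M.coind (dC n M.coind c) := map_sub _ _ _
    rw [e1, e2, ih M.coind c, sub_zero, dC_mapC M.isLeftLinear_unit M.isRightLinear_unit, sub_self]

end Bimod
end Hochschild

/-! ### The Koszul cochain complex and its null homotopy. -/

namespace QuantumPlane

open Bimod

universe u
variable {k : Type u} [Field k] {q : k}

/-- The sequence vanishes beyond `n`. -/
def SuppLE {M : Type*} [Zero M] (n : ℕ) (v : ℕ → M) : Prop := ∀ i, n < i → v i = 0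

/-- The sequence `(0, v 0, v 1, …)`. -/
def shiftSeq {M : Type*} [Zero M] (v : ℕ → M) (i : ℕ) : M := if i = 0 then 0 else v (i - 1)

@[simp] theorem shiftSeq_zero {M : Type*} [Zero M] (v : ℕ → M) : shiftSeq v 0 = 0 := rfl

@[simp] theorem shiftSeq_succ {M : Type*} [Zero M] (v : ℕ → M) (i : ℕ) :
    shiftSeq v (i + 1) = v i := rfl

theorem shiftSeq_add {M : Type*} [AddZeroClass M] (v w : ℕ → M) (i : ℕ) :
    shiftSeq (v + w) i = shiftSeq v i + shiftSeq w i := by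
  cases i <;> simp

theorem shiftSeq_smul {M : Type*} [AddCommGroup M] [Module k M] (c : k) (v : ℕ → M) (i : ℕ) :
    shiftSeq (c • v) i = c • shiftSeq v i := by
  cases i <;> simp

/-- The differential of the Koszul cochain complex, from degree `n` to degree `n + 1`. -/
def dK (n : ℕ) (M : Bimod k (Lam q)) : (ℕ → M) →ₗ[k] (ℕ → M) where
  -- This dualizes `fⁿ⁺¹ᵢ = x ⊗ fⁿᵢ + q^(n+1-i) y ⊗ fⁿᵢ₋₁ = q^i fⁿᵢ ⊗ x + fⁿᵢ₋₁ ⊗ y`: a leading `y`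
  -- stands to the left of all `n + 1 - i` letters `x`, and a final `x` stands to the right of all
  -- `i` letters `y`.
  toFun v i := M.left (Lam.x q) (v i) + ((-1) ^ (n + 1) * q ^ i) • M.right (Lam.x q) (v i)
    + q ^ (n + 1 - i) • M.left (Lam.y q) (shiftSeq v i)
    + (-1 : k) ^ (n + 1) • M.right (Lam.y q) (shiftSeq v i)
  map_add' v w := by
    ext i
    simp only [shiftSeq_add, Pi.add_apply, map_add, smul_add]
    abel
  map_smul' c v := by
    ext i
    simp only [shiftSeq_smul, Pi.smul_apply, map_smul, smul_add, RingHom.id_apply,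
      smul_comm _ c]

theorem dK_apply (n : ℕ) (M : Bimod k (Lam q)) (v : ℕ → M) (i : ℕ) :
    dK n M v i = M.left (Lam.x q) (v i) + ((-1) ^ (n + 1) * q ^ i) • M.right (Lam.x q) (v i)
    + q ^ (n + 1 - i) • M.left (Lam.y q) (shiftSeq v i)
    + (-1 : k) ^ (n + 1) • M.right (Lam.y q) (shiftSeq v i) := rfl

/-- The contracting homotopy of the Koszul complex, from degree `n + 1` to degree `n`. -/
def sK (n : ℕ) (M : Bimod k (Lam q)) : (ℕ → M) →ₗ[k] (ℕ → M.coind) where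
  -- Dually, `x ⊗ fⁿᵢ` is lifted to `fⁿ⁺¹ᵢ`, `y ⊗ fⁿₙ` to `fⁿ⁺¹ₙ₊₁` and the other `y ⊗ fⁿᵢ` to `0`.
  -- The values at `yx`, with their extra term for `i = n`, are those that make `sK_dK_add` true.
  toFun v i := mkCoind (if i < n then (Lam.coord q 1).smulRight (v i) +
        (Lam.coord q 3).smulRight (M.left (Lam.y q) (v i))
    else if i = n then (Lam.coord q 1).smulRight (v i) + (Lam.coord q 2).smulRight (v (n + 1)) +
      (Lam.coord q 3).smulRight
        (M.left (Lam.y q) (v i) + ((-1) ^ n * q ^ n) • M.right (Lam.x q) (v (n + 1)))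
    else 0)
  map_add' v w := by
    funext i
    refine ap_ext fun b => ?_
    simp only [Pi.add_apply, map_add, LinearMap.add_apply, ap_mkCoind]
    split_ifs
    · simp; abel
    · simp; abel
    · simp
  map_smul' c v := by
    funext i
    refine ap_ext fun b => ?_
    simp only [Pi.smul_apply, map_smul, LinearMap.smul_apply, ap_mkCoind, RingHom.id_apply]
    split_ifs
    · simp [smul_comm c]
    · simp [smul_comm c]
    · simp

section

variable (n i : ℕ) (M : Bimod k (Lam q)) (v : ℕ → M)

theorem sK_of_lt {n i : ℕ} (h : n < i) : sK n M v i = 0 := by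
  have h1 : ¬ i < n := by omega
  have h2 : i ≠ n := by omega
  simp [sK, h1, h2]

theorem sK_one : ap (sK n M v i) 1 = 0 := by
  simp only [sK, LinearMap.coe_mk, AddHom.coe_mk, ap_mkCoind]
  split_ifs <;> simp

theorem sK_x (h : SuppLE (n + 1) v) : ap (sK n M v i) (Lam.x q) = if i = n + 1 then 0 else v i := by
  simp only [sK, LinearMap.coe_mk, AddHom.coe_mk, ap_mkCoind]
  split_ifs with h1 h2 h3 h4 <;> try simp
  · omega
  · omega
  · rw [h i (by omega)]

theorem sK_y : ap (sK n M v i) (Lam.y q) = if i = n then v (n + 1) else 0 := by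
  simp only [sK, LinearMap.coe_mk, AddHom.coe_mk, ap_mkCoind]
  split_ifs with h1 h2 h3 <;> try simp
  omega

theorem sK_yx (h : SuppLE (n + 1) v) : ap (sK n M v i) (Lam.y q * Lam.x q) =
    if i = n + 1 then 0 else M.left (Lam.y q) (v i) +
      if i = n then ((-1) ^ n * q ^ n) • M.right (Lam.x q) (v (n + 1)) else 0 := by
  simp only [sK, LinearMap.coe_mk, AddHom.coe_mk, ap_mkCoind]
  split_ifs with h1 h2 h3 h4 <;> try simp
  any_goals omega
  rw [h i (by omega), map_zero]

end

theorem SuppLE.dK {n : ℕ} {M : Bimod k (Lam q)} {v : ℕ → M} (h : SuppLE n v) :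
    SuppLE (n + 1) (dK n M v) := by
  intro i hi
  have h2 : shiftSeq v i = 0 := by
    rw [shiftSeq, if_neg (by omega), h _ (by omega)]
  rw [dK_apply, h i (by omega), h2]
  simp

theorem suppLE_sK (n : ℕ) (M : Bimod k (Lam q)) (v : ℕ → M) : SuppLE n (sK n M v) :=
  fun _ hi => sK_of_lt M v hi

theorem Lam.yx_mul_x (q : k) : Lam.y q * Lam.x q * Lam.x q = 0 := by
  rw [mul_assoc, Lam.x_mul_x, mul_zero]

theorem Lam.yx_mul_y (q : k) : Lam.y q * Lam.x q * Lam.y q = 0 := by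
  rw [mul_assoc, Lam.x_mul_y, mul_smul_comm, ← mul_assoc, Lam.y_mul_y, zero_mul, smul_zero]

theorem ap_shiftSeq (M : Bimod k (Lam q)) (w : ℕ → M.coind) (b : Lam q) (i : ℕ) :
    ap (shiftSeq w i) b = shiftSeq (fun j => ap (w j) b) i := by
  cases i <;> rfl

/-- The dual form of the exactness of the Koszul resolution: the map induced by `unit` is null
homotopic. Both sides are linear maps on `Λ_q`, so it suffices to compare them at `1, x, y, yx`. -/
theorem sK_dK_add (n : ℕ) (M : Bimod k (Lam q)) {v : ℕ → M} (h : SuppLE (n + 1) v) (i : ℕ) :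
    sK (n + 1) M (dK (n + 1) M v) i + dK n M.coind (sK n M v) i = M.unit (v i) := by
  have hyy (m : M) : M.left (Lam.y q) (M.left (Lam.y q) m) = 0 := by
    rw [← M.left_mul, Lam.y_mul_y, map_zero, LinearMap.zero_apply]
  have rxx (m : M) : M.right (Lam.x q) (M.right (Lam.x q) m) = 0 := by
    rw [← M.right_mul, Lam.x_mul_x, map_zero, LinearMap.zero_apply]
  have rxy (m : M) : M.right (Lam.y q) (M.right (Lam.x q) m) =
      (-q) • M.right (Lam.x q) (M.right (Lam.y q) m) := by
    rw [← M.right_mul, Lam.x_mul_y, map_smul, LinearMap.smul_apply, M.right_mul]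
  rcases lt_or_ge (n + 1) i with hi | hi
  · have h2 : SuppLE n (sK n M v) := suppLE_sK n M v
    rw [h2.dK i hi, sK_of_lt _ _ hi, h i hi]; simp
  have hd := h.dK
  refine ap_ext fun b => LinearMap.congr_fun (Lam.linearMap_ext q (f := ap _) (g := ap _)
    ?_ ?_ ?_ ?_) b
  · simp only [map_add, LinearMap.add_apply, map_smul, LinearMap.smul_apply, dK_apply,
      ap_left, ap_right, ap_shiftSeq, one_mul, sK_one, sK_x _ _ _ _ h, sK_y, M.left_one, ap_unit]
    rcases i with _ | i
    · simp
    · by_cases hn : i = n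
      · subst hn; simp
      · simp [hn]
  · simp only [map_add, LinearMap.add_apply, map_smul, LinearMap.smul_apply, dK_apply n,
      ap_left, ap_right, ap_shiftSeq, ap_unit, Lam.x_mul_x, Lam.x_mul_y, map_zero,
      sK_x _ _ _ _ h, sK_x _ _ _ _ hd, sK_yx _ _ _ _ h]
    rcases i with _ | i
    · simp [dK_apply]
      module
    -- The current index is `i + 1`, so `t = 0` is the top index `n + 1` and `t = 1` is the index
    -- `n`, where `sK` has its exceptional values. Writing `n = i + t` also removes the truncated
    -- subtractions.
    · obtain ⟨t, rfl⟩ : ∃ t, n = i + t := ⟨n - i, by omega⟩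
      rcases t with _ | t
      · simp [dK_apply]
        module
      · have e1 : i + (t + 1) + 1 + 1 - (i + 1) = t + 1 + 1 := by omega
        have e2 : i + (t + 1) + 1 - (i + 1) = t + 1 := by omega
        have e3 : ¬ i = i + (t + 1) + 1 := by omega
        simp [dK_apply, e1, e2, e3]
        module
  · simp only [map_add, LinearMap.add_apply, map_smul, LinearMap.smul_apply, dK_apply n,
      ap_left, ap_right, ap_shiftSeq, ap_unit, Lam.y_mul_y, map_zero, sK_y, sK_yx _ _ _ _ h]
    rcases i with _ | i
    · rcases n with _ | n
      · simp
      · simp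
    · obtain ⟨t, rfl⟩ : ∃ t, n = i + t := ⟨n - i, by omega⟩
      rcases t with _ | _ | t
      · simp [dK_apply, h (i + 1 + 1)]
        module
      · simp
        module
      · simp
  · simp only [map_add, LinearMap.add_apply, map_smul, LinearMap.smul_apply, dK_apply n,
      ap_left, ap_right, ap_shiftSeq, ap_unit, Lam.yx_mul_y, Lam.yx_mul_x, map_zero,
      sK_yx _ _ _ _ hd, sK_yx _ _ _ _ h, M.left_mul]
    rcases i with _ | i
    · rcases n with _ | n
      · simp [dK_apply, rxx, M.left_right]
      · simp [dK_apply, M.left_right]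
        module
    · obtain ⟨t, rfl⟩ : ∃ t, n = i + t := ⟨n - i, by omega⟩
      rcases t with _ | _ | t
      · simp [dK_apply, h (i + 1 + 1), M.left_right, hyy, rxy]
        module
      · have e3 : ¬ i = i + 1 + 1 := by omega
        simp [dK_apply, e3, rxx, M.left_right, hyy]
        module
      · have e3 : ¬ i = i + (t + 1 + 1) + 1 := by omega
        simp [dK_apply, e3, M.left_right, hyy]
        module

/-- In degree zero the right action survives as a correction, and `sK ∘ dK` becomes the Hochschild
differential; this starts the induction for `dC_extK`. -/
theorem sK_dK_zero (M : Bimod k (Lam q)) {v : ℕ → M} (h : SuppLE 0 v) (i : ℕ) :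
    sK 0 M (dK 0 M v) i = (M.unit - M.rightUnit) (v i) := by
  rcases Nat.eq_zero_or_pos i with rfl | hi
  · refine ap_ext fun b => LinearMap.congr_fun (Lam.linearMap_ext q (f := ap _) (g := ap _)
      ?_ ?_ ?_ ?_) b
    · rw [sK_one]
      simp [M.left_one, M.right_one]
    · rw [sK_x _ _ _ _ h.dK]
      simp [dK_apply, sub_eq_add_neg]
    · rw [sK_y]
      simp [dK_apply, h 1, sub_eq_add_neg]
    · rw [sK_yx _ _ _ _ h.dK]
      simp [dK_apply, h 1, sub_eq_add_neg, M.left_mul, M.right_mul, M.left_right]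
  · rw [sK_of_lt _ _ hi, h i hi, map_zero]

end QuantumPlane

/-! ### Comparison of Hochschild and Koszul cochains. -/

namespace QuantumPlane

open Bimod

universe u
variable {k : Type u} [Field k] {q : k}

/-- From a value at `fⁿ` of a cochain with coefficients in `Hom_k(Λ, M)` to the value at `fⁿ⁺¹`. -/
def kapStep (n : ℕ) (M : Bimod k (Lam q)) : (ℕ → M.coind) →ₗ[k] (ℕ → M) where
  toFun w i := ap (w i) (Lam.x q) + q ^ (n + 1 - i) • ap (shiftSeq w i) (Lam.y q)
  map_add' v w := by
    ext i
    simp only [shiftSeq_add, Pi.add_apply, map_add, smul_add, LinearMap.add_apply]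
    abel
  map_smul' c v := by
    ext i
    simp only [shiftSeq_smul, Pi.smul_apply, map_smul, smul_add, RingHom.id_apply,
      LinearMap.smul_apply, smul_comm _ c]

theorem kapStep_apply (n : ℕ) (M : Bimod k (Lam q)) (w : ℕ → M.coind) (i : ℕ) :
    kapStep n M w i = ap (w i) (Lam.x q) + q ^ (n + 1 - i) • ap (shiftSeq w i) (Lam.y q) := rfl

/-- The restriction of cochains to the Koszul complex. -/
def kap : (n : ℕ) → (M : Bimod k (Lam q)) → (C n M →ₗ[k] (ℕ → M))
  | 0, M => LinearMap.single k (fun _ => (M : Type u)) 0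
  | n + 1, M => kapStep n M ∘ₗ kap n M.coind

theorem kap_zero (M : Bimod k (Lam q)) (c : M) : kap 0 M c = Pi.single 0 c := rfl

theorem kap_succ (n : ℕ) (M : Bimod k (Lam q)) (c : C n M.coind) :
    kap (n + 1) M c = kapStep n M (kap n M.coind c) := rfl

/-- The extension of Koszul cochains to Hochschild cochains. -/
def extK : (n : ℕ) → (M : Bimod k (Lam q)) → ((ℕ → M) →ₗ[k] C n M)
  | 0, _ => LinearMap.proj 0
  | n + 1, M => extK n M.coind ∘ₗ sK n M

theorem extK_succ (n : ℕ) (M : Bimod k (Lam q)) (v : ℕ → M) :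
    extK (n + 1) M v = extK n M.coind (sK n M v) := rfl

theorem shiftSeq_eq_zero {M : Type*} [Zero M] {n : ℕ} {v : ℕ → M} (h : SuppLE n v) {i : ℕ}
    (hi : n + 1 < i) : shiftSeq v i = 0 := by
  rw [shiftSeq, if_neg (by omega), h _ (by omega)]

theorem suppLE_kap (n : ℕ) (M : Bimod k (Lam q)) (c : C n M) : SuppLE n (kap n M c) := by
  induction n generalizing M with
  | zero =>
    intro i hi
    rw [kap_zero, Pi.single_eq_of_ne hi.ne']
  | succ n ih =>
    intro i hi
    rw [kap_succ, kapStep_apply, ih _ _ i (by omega), shiftSeq_eq_zero (ih _ _) hi]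
    simp

theorem kap_mapC (n : ℕ) {M N : Bimod k (Lam q)} (f : M →ₗ[k] N) (c : C n M) (i : ℕ) :
    kap n N (mapC n f c) i = f (kap n M c i) := by
  induction n generalizing M N i with
  | zero =>
    change kap 0 N (f c) i = _
    rw [kap_zero, kap_zero, ← Pi.apply_single (fun _ => f) (fun _ => map_zero f)]
  | succ n ih =>
    have h := ih (coindMap f) c
    have e : kap (n + 1) N (mapC (n + 1) f c) = kapStep n N (kap n N.coind (mapC n (coindMap f) c)) :=
      rfl
    rw [e, kap_succ, kapStep_apply, kapStep_apply, map_add, map_smul]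
    rw [h]
    have e2 : ap (shiftSeq (kap n N.coind (mapC n (coindMap f) c)) i) (Lam.y q) =
        f (ap (shiftSeq (kap n M.coind c) i) (Lam.y q)) := by
      cases i with
      | zero => simp
      | succ i => rw [shiftSeq_succ, h]; rfl
    rw [e2]
    rfl

/-- Whereas `kap` uses no module structure and is natural for all linear maps, `sK` multiplies by
`y` on the left and by `x` on the right, so naturality of `extK` needs a bimodule map. -/
theorem extK_mapC (n : ℕ) {M N : Bimod k (Lam q)} {f : M →ₗ[k] N} (hl : IsLeftLinear f)
    (hr : IsRightLinear f) (v : ℕ → M) : extK n N (fun i => f (v i)) = mapC n f (extK n M v) := by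
  induction n generalizing M N with
  | zero => rfl
  | succ n ih =>
    have h := ih (isLeftLinear_coindMap f) (isRightLinear_coindMap hr) (sK n M v)
    rw [extK_succ, extK_succ, mapC_succ]
    refine Eq.trans ?_ h
    congr 1
    funext i
    refine ap_ext fun b => ?_
    simp only [sK, LinearMap.coe_mk, AddHom.coe_mk, ap_mkCoind, ap_coindMap]
    split_ifs
    · simp [hl _ _]
    · simp [hl _ _, hr _ _]
    · simp

/-- Unwinding `dC` once leaves `extK` of `unit v - dK (sK v)`, which is `sK (dK v)` by the null
homotopy. -/
theorem dC_extK (n : ℕ) (M : Bimod k (Lam q)) {v : ℕ → M} (h : SuppLE n v) :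
    dC n M (extK n M v) = extK (n + 1) M (dK n M v) := by
  induction n generalizing M with
  | zero => exact (sK_dK_zero M h 0).symm
  | succ n ih =>
    have e : dC (n + 1) M (extK (n + 1) M v) = mapC (n + 1) M.unit (extK (n + 1) M v) -
        dC n M.coind (extK n M.coind (sK n M v)) := rfl
    rw [e, ih _ (suppLE_sK n M v), ← extK_mapC _ M.isLeftLinear_unit M.isRightLinear_unit,
      extK_succ (n + 1), ← map_sub]
    congr 1
    funext i
    exact sub_eq_of_eq_add (sK_dK_add n M h i).symm

/-- `kapStep` reads `sK v` at `x` and `y`: the values at `x` return all entries except the top one,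
which is the single nonzero value at `y`. -/
theorem kap_extK (n : ℕ) (M : Bimod k (Lam q)) {v : ℕ → M} (h : SuppLE n v) :
    kap n M (extK n M v) = v := by
  induction n generalizing M with
  | zero =>
    funext i
    change kap 0 M (v 0) i = v i
    rw [kap_zero]
    cases i with
    | zero => simp
    | succ i => simp [h (i + 1)]
  | succ n ih =>
    have e : kap (n + 1) M (extK (n + 1) M v) =
        kapStep n M (kap n M.coind (extK n M.coind (sK n M v))) := rfl
    rw [e, ih _ (suppLE_sK n M v)]
    funext i
    rw [kapStep_apply, ap_shiftSeq, sK_x _ _ _ _ h]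
    cases i with
    | zero => simp
    | succ i =>
      simp only [shiftSeq_succ, sK_y, Nat.add_right_cancel_iff]
      split_ifs with hi
      · subst hi; simp
      · simp

/-- The left action on `M.coind` creates the products `x²`, `y²`, `xy` and `yx`. The first two
vanish and the mixed ones cancel by `xy = -q yx`: this is why the `fⁿᵢ` span a subcomplex of the bar
resolution. -/
theorem kap_dC (n : ℕ) (M : Bimod k (Lam q)) (c : C n M) :
    kap (n + 1) M (dC n M c) = dK n M (kap n M c) := by
  induction n generalizing M with
  | zero =>
    funext i
    rw [kap_succ, kapStep_apply, kap_zero, dK_apply, kap_zero]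
    change ap ((Pi.single 0 (M.unit c - M.rightUnit c) : ℕ → M.coind) i) _ +
      q ^ _ • ap (shiftSeq (Pi.single 0 (M.unit c - M.rightUnit c) : ℕ → M.coind) i) _ = _
    rcases i with _ | _ | i
    · simp [sub_eq_add_neg]
    · simp [sub_eq_add_neg]
    · simp
  | succ n ih =>
    have hn := suppLE_kap n M.coind c
    have e : kap (n + 1 + 1) M (dC (n + 1) M c) = kapStep (n + 1) M
      (kap (n + 1) M.coind (mapC (n + 1) M.unit c) - kap (n + 1) M.coind (dC n M.coind c)) := by
      rw [← map_sub]; rfl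
    have e1 : kap (n + 1) M.coind (mapC (n + 1) M.unit c) =
        fun i => M.unit (kap (n + 1) M c i) := funext fun i => kap_mapC (n + 1) M.unit c i
    rw [e, ih M.coind c, e1, kap_succ]
    generalize kap n M.coind c = w at hn
    funext i
    simp only [kapStep_apply, dK_apply, Pi.sub_apply, map_sub, map_add, map_smul, ap_shiftSeq,
      LinearMap.sub_apply, LinearMap.add_apply, LinearMap.smul_apply, ap_unit, ap_left, ap_right,
      Lam.x_mul_x, Lam.x_mul_y, map_zero]
    rcases i with _ | _ | i
    · simp
      module
    · simp [Lam.y_mul_y, kapStep_apply]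
      module
    · rcases lt_or_ge n i with hi | hi
      · simp [kapStep_apply, hn i hi, hn (i + 1) (by omega), hn (i + 1 + 1) (by omega)]
      · obtain ⟨t, rfl⟩ : ∃ t, n = i + t := ⟨n - i, by omega⟩
        have e1 : i + t + 1 + 1 - (i + 1 + 1) = t := by omega
        have e2 : i + t + 1 - (i + 1) = t := by omega
        -- The subtraction is truncated for `t = 0`, but there the power of `q` multiplies an entry
        -- beyond the support.
        have e3 : i + t + 1 - (i + 1 + 1) = t - 1 := by omega
        simp [Lam.y_mul_y, kapStep_apply, e1, e2, e3]
        rcases t with _ | t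
        · simp [hn (i + 1) (by omega)]
          module
        · simp
          module

/-- The homotopy between the identity and `extK ∘ kap`, from degree `n + 1` to degree `n`. -/
def hC : (n : ℕ) → (M : Bimod k (Lam q)) → (C (n + 1) M →ₗ[k] C n M)
  | 0, _ => 0
  -- The defect of the homotopy equation, read one degree lower with coinduced coefficients, is
  -- contracted by evaluation at `1`.
  | n + 1, M => mapC (n + 1) M.evalOne ∘ₗ
      (LinearMap.id - extK (n + 1) M.coind ∘ₗ kap (n + 1) M.coind - dC n M.coind ∘ₗ hC n M.coind)

/-- The composition of `hC` with the differential, with value `0` in degree `0`. -/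
def dhC : (n : ℕ) → (M : Bimod k (Lam q)) → (C n M →ₗ[k] C n M)
  | 0, _ => 0
  | n + 1, M => dC n M ∘ₗ hC n M

/-- The recursive formula persists in degree zero, where `extK ∘ kap` is the identity and both sides
vanish. -/
theorem hC_eq (n : ℕ) (M : Bimod k (Lam q)) (c : C n M.coind) :
    hC n M c = mapC n M.evalOne (c - extK n M.coind (kap n M.coind c) - dhC n M.coind c) := by
  cases n with
  | zero =>
    change 0 = M.evalOne (c - kap 0 M.coind c 0 - 0)
    rw [kap_zero]
    simp
  | succ n => rfl

theorem dC_dhC (n : ℕ) (M : Bimod k (Lam q)) (c : C n M) : dC n M (dhC n M c) = 0 := by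
  cases n with
  | zero => exact map_zero _
  | succ n => exact dC_dC n M _

theorem hC_mapC (n : ℕ) {M N : Bimod k (Lam q)} {f : M →ₗ[k] N} (hl : IsLeftLinear f)
    (hr : IsRightLinear f) (c : C (n + 1) M) :
    hC n N (mapC (n + 1) f c) = mapC n f (hC n M c) := by
  induction n generalizing M N with
  | zero => exact (map_zero f).symm
  | succ n ih =>
    have hl' := isLeftLinear_coindMap f
    have hr' := isRightLinear_coindMap hr
    have e1 : hC (n + 1) N (mapC (n + 1 + 1) f c) = mapC (n + 1) N.evalOne
        (mapC (n + 1) (coindMap f) c - extK (n + 1) N.coind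
          (kap (n + 1) N.coind (mapC (n + 1) (coindMap f) c)) -
          dC n N.coind (hC n N.coind (mapC (n + 1) (coindMap f) c))) := rfl
    have e2 : kap (n + 1) N.coind (mapC (n + 1) (coindMap f) c) =
        fun i => coindMap f (kap (n + 1) M.coind c i) := funext fun i => kap_mapC _ _ _ i
    have e3 : N.evalOne ∘ₗ coindMap f = f ∘ₗ M.evalOne := rfl
    rw [e1, e2, extK_mapC _ hl' hr', ih hl' hr' c, dC_mapC hl' hr', ← map_sub, ← map_sub,
      ← LinearMap.comp_apply, ← mapC_comp, e3, mapC_comp]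
    rfl

/-- Together with `kap_extK` this makes `kap` and `extK` mutually inverse on cohomology. The
induction over the degree takes the statement for `M.coind` and applies the contraction
`dC_mapC_evalOne` twice. -/
theorem dhC_add_hC (n : ℕ) (M : Bimod k (Lam q)) (c : C n M) :
    dhC n M c + hC n M (dC n M c) = c - extK n M (kap n M c) := by
  induction n generalizing M with
  | zero =>
    change (0 : M) + 0 = c - kap 0 M c 0
    rw [kap_zero]
    simp
  | succ n ih =>
    let c' : C n M.coind := c
    -- By induction this defect is `hC` of the differential of `c'`, and its evaluation at `1` is
    -- `hC c`.
    set u : C n M.coind := c' - extK n M.coind (kap n M.coind c') - dhC n M.coind c' with hu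
    have hu' : u = hC n M.coind (dC n M.coind c') := by
      rw [hu, ← ih M.coind c', add_sub_cancel_left]
    have hc : hC n M c = mapC n M.evalOne u := hC_eq n M c'
    set dc : C (n + 1) M.coind := dC n M.coind c' with hdc
    have hdu : dC n M.coind u = dc - extK (n + 1) M.coind (kap (n + 1) M.coind dc) := by
      rw [hu, map_sub, map_sub, dC_dhC, sub_zero, dC_extK _ _ (suppLE_kap _ _ _), hdc, kap_dC]
    set D : C (n + 1) M.coind := dC (n + 1) M c with hD
    have hJ : dc + D = mapC (n + 1) M.unit c := add_sub_cancel _ _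
    -- Since `hC` commutes with `unit`, it sends `D = unit c - dc` to the very term by which
    -- evaluation at `1` fails to commute with the differential on `u`.
    have hw : hC n M.coind D = mapC n M.unit (hC n M c) - u := by
      have : D = mapC (n + 1) M.unit c - dc := rfl
      rw [this, map_sub, ← hu', hC_mapC n M.isLeftLinear_unit M.isRightLinear_unit]
    set w := hC n M.coind D with hw'
    have hw0 : mapC n M.evalOne w = 0 := by
      rw [hw, map_sub, ← LinearMap.comp_apply, ← mapC_comp, evalOne_comp_unit, mapC_id, hc]
      exact sub_self _
    -- As `w` is killed by evaluation at `1`, the contraction recovers it from `dC w`. This `w`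
    -- cancels the one in `h2`, and what remains is evaluation at `1` of an expression in `dc + D =
    -- unit c`.
    have h1 : mapC (n + 1) M.evalOne (dC n M.coind w) = w := by
      have := dC_mapC_evalOne w
      rw [hw0, map_zero, map_zero, zero_sub] at this
      exact eq_of_sub_eq_zero (by rw [sub_eq_add_neg]; exact this.symm)
    have h2 := dC_mapC_evalOne u
    rw [← hc, ← hw, hdu] at h2
    have h3 : hC (n + 1) M D = mapC (n + 1) M.evalOne
        (D - extK (n + 1) M.coind (kap (n + 1) M.coind D) - dC n M.coind w) := rfl
    have h4 : dhC (n + 1) M c = dC n M (hC n M c) := rfl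
    have h5 : mapC (n + 1) M.evalOne (mapC (n + 1) M.unit (c - extK (n + 1) M (kap (n + 1) M c))) =
        c - extK (n + 1) M (kap (n + 1) M c) := by
      rw [← LinearMap.comp_apply, ← mapC_comp, evalOne_comp_unit, mapC_id]
      rfl
    have e2 : (fun i => M.unit (kap (n + 1) M c i)) = kap (n + 1) M.coind (mapC (n + 1) M.unit c) :=
      funext fun i => (kap_mapC _ _ _ i).symm
    rw [map_sub, ← extK_mapC _ M.isLeftLinear_unit M.isRightLinear_unit, e2, ← hJ] at h5
    rw [h4, h2, h3, map_sub _ _ (dC n M.coind w), h1, ← h5]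
    simp only [map_sub, map_add]
    abel

theorem dC_hC (n : ℕ) (M : Bimod k (Lam q)) {c : C (n + 1) M} (h : dC (n + 1) M c = 0) :
    dC n M (hC n M c) = c - extK (n + 1) M (kap (n + 1) M c) := by
  have := dhC_add_hC (n + 1) M c
  rw [h, map_zero, add_zero] at this
  exact this

end QuantumPlane

/-! ### Curried cochains as multilinear maps. -/

namespace Hochschild

namespace Bimod

universe u v
variable {k : Type u} {A : Type v} [Field k] [Ring A] [Algebra k A]

/-- The value of a cochain in curried form at the first terms of a sequence. -/
def evC : (n : ℕ) → {M : Bimod k A} → (ℕ → A) → (C n M →ₗ[k] M)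
  | 0, _, _ => LinearMap.id
  | n + 1, _, a => ap.flip (a 0) ∘ₗ evC n (fun i => a (i + 1))

theorem evC_succ (n : ℕ) {M : Bimod k A} (a : ℕ → A) (c : C n M.coind) :
    evC (n + 1) (M := M) a c = ap (evC n (fun i => a (i + 1)) c) (a 0) := rfl

theorem evC_mapC (n : ℕ) {M N : Bimod k A} (f : M →ₗ[k] N) (a : ℕ → A) (c : C n M) :
    evC n a (mapC n f c) = f (evC n a c) := by
  induction n generalizing M N a with
  | zero => rfl
  | succ n ih =>
    have h := ih (coindMap f) (fun i => a (i + 1)) c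
    rw [mapC_succ, evC_succ, evC_succ, h, ap_coindMap]

/-- The sequence `(b, a₀, a₁, …)`. -/
def seqCons {A : Type*} (b : A) (a : ℕ → A) : ℕ → A
  | 0 => b
  | i + 1 => a i

theorem evC_ext {n : ℕ} {M : Bimod k A} {c d : C n M} (h : ∀ a, evC n a c = evC n a d) :
    c = d := by
  induction n generalizing M with
  | zero => exact h 0
  | succ n ih => exact ih (M := M.coind) fun a => ap_ext fun b => h (seqCons b a)

/-- The contraction of `a₀a₁` is the left action on the coinduced coefficients; the later
contractions come from the sum one degree lower, with the sign reversed by the shift. -/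
theorem evC_dC (n : ℕ) (M : Bimod k A) (a : ℕ → A) (c : C n M) :
    evC (n + 1) a (dC n M c) = M.left (a 0) (evC n (fun i => a (i + 1)) c)
      + ∑ i ∈ Finset.range n, (-1 : k) ^ (i + 1) • evC n (contractSeq i a) c
      + (-1 : k) ^ (n + 1) • M.right (a n) (evC n a c) := by
  induction n generalizing M a with
  | zero =>
    change M.left (a 0) c - M.right (a 0) c = M.left (a 0) c + _ + (-1 : k) ^ 1 • M.right (a 0) c
    simp [sub_eq_add_neg]
  | succ n ih =>
    have e : evC (n + 1 + 1) a (dC (n + 1) M c) = evC (n + 1 + 1) a (mapC (n + 1) M.unit c) -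
        evC (n + 1 + 1) a (dC n M.coind c) := map_sub _ _ _
    have e1 : evC (n + 1 + 1) a (mapC (n + 1) M.unit c) =
        M.left (a 0) (evC (n + 1) (fun i => a (i + 1)) c) := by
      have := evC_mapC (n + 1) M.unit (fun i => a (i + 1)) c
      rw [evC_succ, this, ap_unit]
    have e2 : evC (n + 1 + 1) a (dC n M.coind c) =
        ap (evC (n + 1) (fun i => a (i + 1)) (dC n M.coind c)) (a 0) := rfl
    rw [e, e1, e2, ih M.coind, Finset.sum_range_succ']
    simp only [map_add, map_sum, map_smul, LinearMap.add_apply, LinearMap.sum_apply,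
      LinearMap.smul_apply, ap_left, ap_right]
    have h0 : evC (n + 1) (contractSeq 0 a) c =
      ap (evC n (fun i => a (i + 1 + 1)) c) (a 0 * a (0 + 1)) := rfl
    have h1 (i : ℕ) : evC (n + 1) (contractSeq (i + 1) a) c =
        ap (evC n (contractSeq i fun i => a (i + 1)) c) (a 0) := by
      rw [evC_succ]
      have : (fun j => contractSeq (i + 1) a (j + 1)) = contractSeq i fun i => a (i + 1) := by
        funext j
        simp [contractSeq]
      rw [this]
      simp [contractSeq]
    have h2 : evC (n + 1) a c = ap (evC n (fun i => a (i + 1)) c) (a 0) := rfl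
    rw [h0, h2]
    simp only [h1]
    simp only [pow_succ _ (_ + 1), mul_neg, mul_one, neg_smul, Finset.sum_neg_distrib, zero_add,
      pow_one, one_smul]
    abel

/-- The multilinear map of a cochain in curried form. -/
def toMultilinear : (n : ℕ) → {M : Bimod k A} →
    (C n M →ₗ[k] MultilinearMap k (fun _ : Fin n => A) M)
  | 0, M => (MultilinearMap.constLinearEquivOfIsEmpty k k (fun _ : Fin 0 => A) M).toLinearMap
  | n + 1, M =>
    { toFun := fun c => LinearMap.uncurryLeft (M := fun _ : Fin (n + 1) => A)
        { toFun := fun b => (ap.flip b).compMultilinearMap (toMultilinear n (M := M.coind) c)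
          map_add' := fun _ _ => by ext; simp
          map_smul' := fun _ _ => by ext; simp }
      map_add' := fun _ _ => by ext; simp
      map_smul' := fun _ _ => by ext; simp }

theorem toMultilinear_apply (n : ℕ) {M : Bimod k A} (c : C n M) (a : ℕ → A) :
    toMultilinear n c (fun i => a i) = evC n a c := by
  induction n generalizing M a with
  | zero => rfl
  | succ n ih =>
    rw [evC_succ, ← ih (M := M.coind) c]
    rfl

theorem toMultilinear_surjective (n : ℕ) {M : Bimod k A} :
    Function.Surjective (toMultilinear (k := k) (A := A) n (M := M)) := by
  induction n generalizing M with
  | zero => exact (MultilinearMap.constLinearEquivOfIsEmpty k k (fun _ : Fin 0 => A) M).surjective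
  | succ n ih =>
    intro f
    -- The first variable is absorbed into the coefficients, matching the order of arguments in
    -- `evC`.
    let g : MultilinearMap k (fun _ : Fin n => A) M.coind :=
      { toFun := fun a => mkCoind
          { toFun := fun b => f.curryLeft b a
            map_add' := fun _ _ => by simp
            map_smul' := fun _ _ => by simp }
        map_update_add' := fun a i x y => ap_ext fun b => by simp
        map_update_smul' := fun a i x y => ap_ext fun b => by simp }
    obtain ⟨c, hc⟩ := ih g
    refine ⟨c, ?_⟩
    ext a
    change ap (toMultilinear n (M := M.coind) c (Fin.tail a)) (a 0) = _
    rw [hc]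
    change f (Fin.cons (a 0) (Fin.tail a)) = f a
    rw [Fin.cons_self_tail]

/-- Curried cochains with coefficients in `A` are Hochschild cochains. -/
noncomputable def cochainEquiv (n : ℕ) : C n (regular k A) ≃ₗ[k] Cochain k A n :=
  LinearEquiv.ofBijective (toMultilinear n (M := regular k A))
    ⟨fun c d h => evC_ext fun a => by
      rw [← toMultilinear_apply, ← toMultilinear_apply, h], toMultilinear_surjective n⟩

theorem ev_cochainEquiv (n : ℕ) (c : C n (regular k A)) (a : ℕ → A) :
    ev (cochainEquiv n c) a = evC n a c := toMultilinear_apply n c a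

theorem hochschildD_cochainEquiv (n : ℕ) (c : C n (regular k A)) :
    hochschildD n (cochainEquiv n c) = cochainEquiv (n + 1) (dC n _ c) := by
  refine ext_ev fun a => ?_
  rw [ev_d]
  simp only [ev_cochainEquiv]
  exact ((ev_cochainEquiv (n + 1) (dC n _ c) a).trans (evC_dC n _ a c)).symm

end Bimod
end Hochschild

/-! ### Values at the Koszul elements as sums over words. -/

namespace QuantumPlane

open Bimod

universe u
variable {k : Type u} [Field k] {q : k}

/-- The value at `fⁿᵢ` of a function on sequences that depends only on the first `n` terms,
by recursion on the first letter. -/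
noncomputable def kv {M : Type*} [AddCommGroup M] [Module k M] :
    (n : ℕ) → ((ℕ → Lam q) → M) → ℕ → M
  | 0, F, i => if i = 0 then F 0 else 0
  | n + 1, F, i => kv n (fun a => F (seqCons (Lam.x q) a)) i +
      q ^ (n + 1 - i) • shiftSeq (kv n fun a => F (seqCons (Lam.y q) a)) i

section

variable {M N : Type*} [AddCommGroup M] [Module k M] [AddCommGroup N] [Module k N]

theorem kv_succ (n : ℕ) (F : (ℕ → Lam q) → M) (i : ℕ) :
    kv (n + 1) F i = kv n (fun a => F (seqCons (Lam.x q) a)) i +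
      q ^ (n + 1 - i) • shiftSeq (kv n fun a => F (seqCons (Lam.y q) a)) i := rfl

theorem kv_map (n : ℕ) (f : M →ₗ[k] N) (F : (ℕ → Lam q) → M) (i : ℕ) :
    kv n (fun a => f (F a)) i = f (kv n F i) := by
  induction n generalizing F i with
  | zero => simp only [kv]; split_ifs <;> simp
  | succ n ih =>
    rw [kv_succ, kv_succ, map_add, map_smul, ih]
    cases i with
    | zero => simp
    | succ i => rw [shiftSeq_succ, shiftSeq_succ, ih]

end

theorem kap_eq_kv (n : ℕ) (M : Bimod k (Lam q)) (c : C n M) (i : ℕ) :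
    kap n M c i = kv n (fun a => evC n a c) i := by
  induction n generalizing M i with
  | zero =>
    rw [kap_zero, kv, Pi.single_apply]
    rfl
  | succ n ih =>
    have h (b : Lam q) (i : ℕ) : kv n (fun a => ap (evC n a c) b) i = ap (kap n M.coind c i) b := by
      rw [ih M.coind c]
      exact kv_map n (ap.flip b) (fun a => evC n a c) i
    rw [kap_succ, kapStep_apply, kv_succ]
    change _ = kv n (fun a => ap (evC n a c) (Lam.x q)) i + q ^ (n + 1 - i) •
      shiftSeq (kv n fun a => ap (evC n a c) (Lam.y q)) i
    rw [h]
    cases i with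
    | zero => rfl
    | succ i => rw [shiftSeq_succ, shiftSeq_succ, h]

section Words

/-- The number of pairs of a letter `y` and a letter `x` to the right of it, where `S` is the set of
positions of the letters `y`. -/
def invCount {n : ℕ} (S : Finset (Fin n)) : ℕ :=
  (Finset.univ.filter fun p : Fin n × Fin n => p.1 < p.2 ∧ p.1 ∈ S ∧ p.2 ∉ S).card

theorem invCount_eq_sum {n : ℕ} (S : Finset (Fin n)) :
    invCount S = ∑ a : Fin n, ∑ b : Fin n, if a < b ∧ a ∈ S ∧ b ∉ S then 1 else 0 := by
  rw [invCount, Finset.card_filter, Fintype.sum_prod_type]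

theorem succ_mem_map {n : ℕ} (S : Finset (Fin n)) (a : Fin n) :
    a.succ ∈ S.map (Fin.succEmb n) ↔ a ∈ S := by simp

theorem zero_notMem_map {n : ℕ} (S : Finset (Fin n)) : 0 ∉ S.map (Fin.succEmb n) := by simp

theorem invCount_map_succ {n : ℕ} (S : Finset (Fin n)) :
    invCount (S.map (Fin.succEmb n)) = invCount S := by
  rw [invCount_eq_sum, invCount_eq_sum]
  simp only [Fin.sum_univ_succ, succ_mem_map, zero_notMem_map, Fin.succ_lt_succ_iff,
    Fin.not_lt_zero, false_and, and_false, if_false, Finset.sum_const_zero, zero_add]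

/-- A new first letter `y` forms one pair with each of the `n - |S|` letters `x`. -/
theorem invCount_insert_zero {n : ℕ} (S : Finset (Fin n)) :
    invCount (insert 0 (S.map (Fin.succEmb n))) = (n - S.card) + invCount S := by
  have h : (n - S.card) = ∑ b : Fin n, if b ∉ S then 1 else 0 := by
    rw [← Finset.card_filter, Finset.filter_notMem_eq_sdiff, ← Finset.compl_eq_univ_sdiff,
      Finset.card_compl, Fintype.card_fin]
  rw [h, invCount_eq_sum, invCount_eq_sum]
  simp only [Fin.sum_univ_succ, Finset.mem_insert, succ_mem_map, Fin.succ_ne_zero, true_or,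
    not_true, Fin.succ_lt_succ_iff, Fin.not_lt_zero, and_false, if_false, false_or, Fin.succ_pos,
    true_and, zero_add]

/-- The sum that defines `koszulValue`, for an arbitrary function of words. -/
noncomputable def wordSum {M : Type*} [AddCommGroup M] [Module k M] {n : ℕ}
    (G : (Fin n → Lam q) → M) (i : ℕ) : M :=
  ∑ S ∈ Finset.powersetCard i (Finset.univ : Finset (Fin n)),
    q ^ invCount S • G fun a => if a ∈ S then Lam.y q else Lam.x q

variable {M : Type*} [AddCommGroup M] [Module k M]

theorem wordSum_succ_zero {n : ℕ} (G : (Fin (n + 1) → Lam q) → M) :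
    wordSum G 0 = wordSum (fun a => G (Fin.cons (Lam.x q) a)) 0 := by
  simp only [wordSum, Finset.powersetCard_zero, Finset.sum_singleton, Finset.notMem_empty, if_false]
  congr 2
  · simp [invCount]
  · funext a
    refine Fin.cases ?_ (fun a => ?_) a <;> rfl

/-- A quantum Pascal rule: words are sorted by their first letter. A leading `x` creates no pair, a
leading `y` creates `n - i` of them. -/
theorem wordSum_succ_succ {n : ℕ} (G : (Fin (n + 1) → Lam q) → M) (i : ℕ) :
    wordSum G (i + 1) = wordSum (fun a => G (Fin.cons (Lam.x q) a)) (i + 1) +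
      q ^ (n - i) • wordSum (fun a => G (Fin.cons (Lam.y q) a)) i := by
  have hu : (Finset.univ : Finset (Fin (n + 1))) =
      insert 0 (Finset.univ.map (Fin.succEmb n)) := by
    ext a
    refine Fin.cases ?_ (fun a => ?_) a <;> simp
  have h0 := zero_notMem_map (Finset.univ : Finset (Fin n))
  rw [wordSum, hu, Finset.powersetCard_succ_insert h0, Finset.sum_union, Finset.sum_image]
  · rw [Finset.powersetCard_map, Finset.powersetCard_map, Finset.sum_map, Finset.sum_map]
    simp only [RelEmbedding.coe_toEmbedding, Finset.mapEmbedding_apply, invCount_map_succ,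
      invCount_insert_zero]
    congr 1
    · refine Finset.sum_congr rfl fun S _ => ?_
      congr 2
      funext a
      refine Fin.cases ?_ (fun a => ?_) a
      · simp
      · simp only [succ_mem_map, Fin.cons_succ]
    · rw [wordSum, Finset.smul_sum]
      refine Finset.sum_congr rfl fun S hS => ?_
      rw [(Finset.mem_powersetCard.1 hS).2, pow_add, mul_smul]
      congr 3
      funext a
      refine Fin.cases ?_ (fun a => ?_) a
      · simp
      · simp only [Finset.mem_insert, succ_mem_map, Fin.cons_succ, Fin.succ_ne_zero, false_or]
  · intro S hS T hT h
    have hS' : 0 ∉ S := fun h => h0 ((Finset.mem_powersetCard.1 hS).1 h)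
    have hT' : 0 ∉ T := fun h => h0 ((Finset.mem_powersetCard.1 hT).1 h)
    rw [← Finset.erase_insert hS', h, Finset.erase_insert hT']
  · refine Finset.disjoint_left.2 fun S hS hT => ?_
    obtain ⟨T, -, rfl⟩ := Finset.mem_image.1 hT
    exact h0 ((Finset.mem_powersetCard.1 hS).1 (Finset.mem_insert_self _ _))

theorem kv_eq_wordSum (n : ℕ) (G : (Fin n → Lam q) → M) (i : ℕ) :
    kv n (fun a => G fun j => a j) i = wordSum G i := by
  induction n generalizing i with
  | zero =>
    rw [kv]
    rcases i with _ | i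
    · simp only [wordSum, Finset.powersetCard_zero, Finset.sum_singleton, if_true]
      simp only [invCount, Finset.univ_eq_empty, Finset.filter_empty, Finset.card_empty, pow_zero,
        one_smul]
      congr 1
      exact Subsingleton.elim _ _
    · rw [wordSum, Finset.powersetCard_eq_empty.2 (by simp)]
      rfl
  | succ n ih =>
    have h (b : Lam q) : (fun a : ℕ → Lam q => G fun j => seqCons b a j) =
        fun a : ℕ → Lam q => (fun c : Fin n → Lam q => G (Fin.cons b c)) fun j => a j := by
      funext a
      congr 1
      funext j
      refine Fin.cases ?_ (fun j => ?_) j <;> rfl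
    rw [kv_succ, h, h, ih fun c => G (Fin.cons (Lam.x q) c)]
    cases i with
    | zero => rw [wordSum_succ_zero, shiftSeq_zero, smul_zero, add_zero]
    | succ i => 
      rw [wordSum_succ_succ, shiftSeq_succ, ih fun c => G (Fin.cons (Lam.y q) c),
        Nat.add_sub_add_right]

end Words

theorem koszulValue_eq_kv {n : ℕ} (c : Cochain k (Lam q) n) (i : ℕ) :
    koszulValue c i = kv n (ev c) i := (kv_eq_wordSum n (fun a => c a) i).symm

theorem koszulValue_cochainEquiv {n : ℕ} (c : C n (regular k (Lam q))) :
    koszulValue (cochainEquiv n c) = kap n _ c := by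
  funext i
  rw [koszulValue_eq_kv, kap_eq_kv]
  congr 1
  funext a
  exact ev_cochainEquiv n c a

end QuantumPlane

/-! ### Hochschild cohomology as Koszul cohomology. -/

namespace QuantumPlane

open Bimod

universe u
variable {k : Type u} [Field k] {q : k}

variable (q) in
/-- The differential of the Koszul cochain complex with coefficients in `Λ_q`. -/
def dLam (n : ℕ) : (ℕ → Lam q) →ₗ[k] (ℕ → Lam q) := dK n (regular k (Lam q))

theorem dLam_apply (n : ℕ) (v : ℕ → Lam q) (i : ℕ) :
    dLam q n v i = Lam.x q * v i + ((-1) ^ (n + 1) * q ^ i) • (v i * Lam.x q)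
    + q ^ (n + 1 - i) • (Lam.y q * shiftSeq v i)
    + (-1 : k) ^ (n + 1) • (shiftSeq v i * Lam.y q) := rfl

variable (q) in
/-- Koszul cochains of degree `n`. -/
def koszulCochains (n : ℕ) : Submodule k (ℕ → Lam q) where
  carrier := {v | SuppLE n v}
  add_mem' := fun hv hw i hi => by simp [hv i hi, hw i hi]
  zero_mem' := fun _ _ => rfl
  smul_mem' := fun c v hv i hi => by simp [hv i hi]

variable (q) in
/-- Koszul cocycles of degree `n`. -/
def koszulCocycles (n : ℕ) : Submodule k (ℕ → Lam q) :=
  koszulCochains q n ⊓ LinearMap.ker (dLam q n)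

variable (q) in
/-- Koszul coboundaries of degree `n`. -/
def koszulCoboundaries : (n : ℕ) → Submodule k (ℕ → Lam q)
  | 0 => ⊥
  | n + 1 => (koszulCochains q n).map (dLam q n)

theorem mem_koszulCocycles {n : ℕ} {v : ℕ → Lam q} :
    v ∈ koszulCocycles q n ↔ SuppLE n v ∧ dLam q n v = 0 := Iff.rfl

theorem koszulValue_hochschildD {n : ℕ} (c : Cochain k (Lam q) n) :
    koszulValue (hochschildD n c) = dLam q n (koszulValue c) := by
  obtain ⟨c, rfl⟩ := (cochainEquiv n).surjective c
  rw [hochschildD_cochainEquiv, koszulValue_cochainEquiv, koszulValue_cochainEquiv, kap_dC]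
  rfl

theorem koszulValue_mem_cochains {n : ℕ} (c : Cochain k (Lam q) n) :
    koszulValue c ∈ koszulCochains q n := by
  obtain ⟨c, rfl⟩ := (cochainEquiv n).surjective c
  rw [koszulValue_cochainEquiv]
  exact suppLE_kap n _ c

theorem koszulValue_zero {n : ℕ} : koszulValue (0 : Cochain k (Lam q) n) = 0 := by
  rw [← map_zero (cochainEquiv n), koszulValue_cochainEquiv, map_zero]

theorem koszulValue_mem_cocycles {n : ℕ} {c : Cochain k (Lam q) n}
    (hc : c ∈ cocycles k (Lam q) n) : koszulValue c ∈ koszulCocycles q n := by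
  refine ⟨koszulValue_mem_cochains c, ?_⟩
  have h : hochschildD n c = 0 := hc
  change dLam q n (koszulValue c) = 0
  rw [← koszulValue_hochschildD, h, koszulValue_zero]

variable (q) in
/-- The extension of a Koszul cocycle to a Hochschild cocycle. -/
noncomputable def extCocycle (n : ℕ) : koszulCocycles q n →ₗ[k] cocycles k (Lam q) n :=
  LinearMap.codRestrict _
    ((cochainEquiv n).toLinearMap ∘ₗ extK n (regular k (Lam q)) ∘ₗ (koszulCocycles q n).subtype)
    fun v => by
      have h : dK n (regular k (Lam q)) v.1 = 0 := v.2.2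
      change hochschildD n (cochainEquiv n (extK n _ v.1)) = 0
      have hv : SuppLE (M := regular k (Lam q)) n v.1 := v.2.1
      rw [hochschildD_cochainEquiv, dC_extK n _ hv, h, map_zero, map_zero]

theorem koszulValue_extCocycle {n : ℕ} (v : koszulCocycles q n) :
    koszulValue (extCocycle q n v).1 = v := by
  change koszulValue (cochainEquiv n (extK n _ v.1)) = v
  rw [koszulValue_cochainEquiv]
  exact kap_extK n _ v.2.1

variable (q) in
/-- The cohomology class of a Koszul cocycle. -/
noncomputable def koszulClass (n : ℕ) : koszulCocycles q n →ₗ[k] HH k (Lam q) n :=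
  HH.mk k (Lam q) n ∘ₗ extCocycle q n

/-- A cocycle `c` differs from `extK (kap c)` by the differential of `hC c`, and if `kap c = dK μ`,
then `extK (kap c)` is the differential of `extK μ`. -/
theorem mem_coboundaries_of_koszulValue {n : ℕ} {c : Cochain k (Lam q) n}
    (hc : c ∈ cocycles k (Lam q) n) (h : koszulValue c ∈ koszulCoboundaries q n) :
    c ∈ coboundaries k (Lam q) n := by
  obtain ⟨c, rfl⟩ := (cochainEquiv n).surjective c
  have hc' : hochschildD n (cochainEquiv n c) = 0 := hc
  rw [hochschildD_cochainEquiv, LinearEquiv.map_eq_zero_iff] at hc'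
  rw [koszulValue_cochainEquiv] at h
  cases n with
  | zero =>
    have h0 : kap 0 (regular k (Lam q)) c = 0 := h
    rw [kap_zero, Pi.single_eq_zero_iff] at h0
    subst h0
    exact (coboundaries k (Lam q) 0).zero_mem
  | succ n =>
    obtain ⟨μ, hμ, h⟩ := h
    have h' : dK n (regular k (Lam q)) μ = kap (n + 1) _ c := h
    refine ⟨cochainEquiv n (extK n _ μ + hC n _ c), ?_⟩
    have hμ' : SuppLE (M := regular k (Lam q)) n μ := hμ
    rw [hochschildD_cochainEquiv, map_add, dC_hC n _ hc', dC_extK n _ hμ', h', add_sub_cancel]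

theorem koszulClass_eq_zero {n : ℕ} {v : koszulCocycles q n} :
    koszulClass q n v = 0 ↔ v.1 ∈ koszulCoboundaries q n := by
  rw [koszulClass, LinearMap.comp_apply, HH.mk_eq_zero]
  constructor
  · intro h
    rw [← koszulValue_extCocycle v]
    cases n with
    | zero =>
      have h0 : (extCocycle q 0 v).1 = 0 := h
      rw [h0, koszulValue_zero]
      exact Submodule.zero_mem _
    | succ n =>
      obtain ⟨e, he⟩ := h
      rw [← he, koszulValue_hochschildD]
      exact ⟨_, koszulValue_mem_cochains e, rfl⟩
  · intro h
    refine mem_coboundaries_of_koszulValue (extCocycle q n v).2 ?_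
    rwa [koszulValue_extCocycle]

/-- The cocycle and the extension of its Koszul value have the same Koszul value, so their
difference is a coboundary. This gives the uniqueness half of `IsRepBy`. -/
theorem mk_eq_koszulClass {n : ℕ} (c : cocycles k (Lam q) n) :
    HH.mk k (Lam q) n c = koszulClass q n ⟨koszulValue c.1, koszulValue_mem_cocycles c.2⟩ := by
  obtain ⟨w, hw⟩ : ∃ w, w = extCocycle q n ⟨koszulValue c.1, koszulValue_mem_cocycles c.2⟩ :=
    ⟨_, rfl⟩
  rw [koszulClass, LinearMap.comp_apply, ← hw, ← sub_eq_zero, ← map_sub, HH.mk_eq_zero]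
  refine mem_coboundaries_of_koszulValue (c - w).2 ?_
  have hs (c d : Cochain k (Lam q) n) : koszulValue (c - d) = koszulValue c - koszulValue d := by
    obtain ⟨c, rfl⟩ := (cochainEquiv n).surjective c
    obtain ⟨d, rfl⟩ := (cochainEquiv n).surjective d
    rw [← map_sub, koszulValue_cochainEquiv, koszulValue_cochainEquiv, koszulValue_cochainEquiv,
      map_sub]
  have : (c - w).1 = c.1 - w.1 := rfl
  rw [this, hs, hw, koszulValue_extCocycle, sub_self]
  exact Submodule.zero_mem _

theorem koszulClass_surjective (n : ℕ) : Function.Surjective (koszulClass q n) := by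
  intro h
  obtain ⟨c, rfl⟩ := HH.mk_surjective n h
  exact ⟨_, (mk_eq_koszulClass c).symm⟩

theorem isRepBy_koszulClass {n : ℕ} (v : koszulCocycles q n) :
    IsRepBy (koszulClass q n v) v.1 := by
  refine ⟨⟨extCocycle q n v, fun i => congrFun (koszulValue_extCocycle v) i⟩, fun c hc => ?_⟩
  rw [mk_eq_koszulClass]
  congr 1
  exact Subtype.ext (funext hc)

/-- Linear independence and generation modulo coboundaries give a basis. -/
theorem repBasis_of {n : ℕ} {S : Set (ℕ → Lam q)} (hS : ∀ v ∈ S, v ∈ koszulCocycles q n)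
    (φ : S → (ℕ → Lam q) →ₗ[k] k) (hφ : ∀ s, ∀ v ∈ koszulCoboundaries q n, φ s v = 0)
    (hφ1 : ∀ s, φ s s ≠ 0) (hφ0 : ∀ s t : S, s ≠ t → φ s t = 0)
    (hspan : ∀ v ∈ koszulCocycles q n, v ∈ Submodule.span k S ⊔ koszulCoboundaries q n) :
    RepBasis q n S := by
  let b : S → HH k (Lam q) n := fun v => koszulClass q n ⟨v.1, hS v.1 v.2⟩
  have hcl (f : S →₀ k) : Finsupp.linearCombination k b f =
      koszulClass q n ⟨Finsupp.linearCombination k (fun v : S => v.1) f,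
        Submodule.span_le.2 (fun v hv => hS v hv) (by
          rw [Finsupp.mem_span_iff_linearCombination]
          exact ⟨f, rfl⟩)⟩ := by
    have : Finsupp.linearCombination k b f = koszulClass q n
        (Finsupp.linearCombination k (fun v : S => (⟨v.1, hS v.1 v.2⟩ : koszulCocycles q n)) f) := by
      rw [Finsupp.apply_linearCombination]
      rfl
    rw [this]
    congr 1
    refine Subtype.ext ?_
    have := Finsupp.apply_linearCombination k (koszulCocycles q n).subtype
      (fun v : S => (⟨v.1, hS v.1 v.2⟩ : koszulCocycles q n)) f
    exact this
  have hli : LinearIndependent k b := by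
    rw [linearIndependent_iff]
    intro f hf
    rw [hcl, koszulClass_eq_zero] at hf
    ext s
    -- The functional of `s` kills the coboundary and all members of the family except `s`, so it
    -- isolates the coefficient at `s`.
    have h := hφ s _ hf
    rw [Finsupp.apply_linearCombination, Finsupp.linearCombination_apply, Finsupp.sum,
      Finset.sum_eq_single s] at h
    · exact (mul_eq_zero.1 h).resolve_right (hφ1 s)
    · intro t _ ht
      simp [hφ0 s t ht.symm]
    · intro hs
      simp [Finsupp.notMem_support_iff.1 hs]
  have hsp : ⊤ ≤ Submodule.span k (Set.range b) := by
    intro h _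
    obtain ⟨v, rfl⟩ := koszulClass_surjective n h
    obtain ⟨s, hs, t, ht, hst⟩ := Submodule.mem_sup.1 (hspan v.1 v.2)
    obtain ⟨f, rfl⟩ := (Finsupp.mem_span_iff_linearCombination k S s).1 hs
    rw [← Finsupp.range_linearCombination]
    refine ⟨f, ?_⟩
    rw [hcl, ← sub_eq_zero, ← map_sub, koszulClass_eq_zero]
    have : v.1 = _ := hst.symm
    rw [← neg_mem_iff]
    convert ht using 1
    change -(Finsupp.linearCombination k (fun v : S => v.1) f - v.1) = t
    rw [this]
    abel
  refine ⟨Module.Basis.mk hli hsp, fun v => ?_⟩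
  rw [Module.Basis.mk_apply]
  exact isRepBy_koszulClass _

end QuantumPlane

/-! ### The Koszul differential in monomials and a basis of the cohomology. -/

namespace QuantumPlane

open Bimod

universe u
variable {k : Type u} [Field k] {q : k}

theorem Lam.ext_coord {a b : Lam q} (h : ∀ i, Lam.coord q i a = Lam.coord q i b) : a = b := by
  rw [Lam.eq_sum q a, Lam.eq_sum q b, h, h, h, h]

variable (q) in
/-- The basis `1, x, y, yx` of `Λ_q`. -/
def mon : Fin 4 → Lam q := ![1, Lam.x q, Lam.y q, Lam.y q * Lam.x q]

theorem coord_mon (i j : Fin 4) : Lam.coord q i (mon q j) = if i = j then 1 else 0 := by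
  fin_cases j <;> simp [mon]

theorem sum_coord_smul_mon (a : Lam q) : ∑ i, Lam.coord q i a • mon q i = a := by
  rw [Fin.sum_univ_four]
  exact (Lam.eq_sum q a).symm

theorem Lam.x_mul_yx (q : k) : Lam.x q * (Lam.y q * Lam.x q) = 0 := by
  rw [← mul_assoc, Lam.x_mul_y, smul_mul_assoc, Lam.yx_mul_x, smul_zero]

theorem Lam.y_mul_yx (q : k) : Lam.y q * (Lam.y q * Lam.x q) = 0 := by
  rw [← mul_assoc, Lam.y_mul_y, zero_mul]

theorem coord_x_mul (a : Lam q) (i : Fin 4) : Lam.coord q i (Lam.x q * a) =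
    ![0, Lam.coord q 0 a, 0, -q * Lam.coord q 2 a] i := by
  conv_lhs => rw [Lam.eq_sum q a]
  simp only [mul_add, mul_smul_comm, mul_one, Lam.x_mul_x, Lam.x_mul_y, Lam.x_mul_yx, map_add,
    map_smul, map_zero, Lam.coord_x, Lam.coord_yx]
  fin_cases i <;> simp [mul_comm]

theorem coord_mul_x (a : Lam q) (i : Fin 4) : Lam.coord q i (a * Lam.x q) =
    ![0, Lam.coord q 0 a, 0, Lam.coord q 2 a] i := by
  conv_lhs => rw [Lam.eq_sum q a]
  simp only [add_mul, smul_mul_assoc, one_mul, Lam.x_mul_x, Lam.yx_mul_x, map_add,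
    map_smul, map_zero, Lam.coord_x, Lam.coord_yx]
  fin_cases i <;> simp

theorem coord_y_mul (a : Lam q) (i : Fin 4) : Lam.coord q i (Lam.y q * a) =
    ![0, 0, Lam.coord q 0 a, Lam.coord q 1 a] i := by
  conv_lhs => rw [Lam.eq_sum q a]
  simp only [mul_add, mul_smul_comm, mul_one, Lam.y_mul_y, Lam.y_mul_yx, map_add,
    map_smul, map_zero, Lam.coord_y, Lam.coord_yx]
  fin_cases i <;> simp

theorem coord_mul_y (a : Lam q) (i : Fin 4) : Lam.coord q i (a * Lam.y q) =
    ![0, 0, Lam.coord q 0 a, -q * Lam.coord q 1 a] i := by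
  conv_lhs => rw [Lam.eq_sum q a]
  simp only [add_mul, smul_mul_assoc, one_mul, Lam.y_mul_y, Lam.x_mul_y, Lam.yx_mul_y, map_add,
    map_smul, map_zero, Lam.coord_y, Lam.coord_yx]
  fin_cases i <;> simp [mul_comm]

/-- Arrows lead only from `1` to `x` and `y` and from these to `yx`. Hence the complex is a direct
sum of squares `1 eₛ → x eₛ, y eₛ₊₁ → yx eₛ₊₁`, of boundary pieces starting at `x eₙ` and `y e₀`,
and of `yx e₀` in degree zero. -/
theorem coord_dLam (n : ℕ) (v : ℕ → Lam q) (i : ℕ) (m : Fin 4) :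
    Lam.coord q m (dLam q n v i) = ![0, (1 - (-1) ^ n * q ^ i) * Lam.coord q 0 (v i),
      (q ^ (n + 1 - i) - (-1) ^ n) * Lam.coord q 0 (shiftSeq v i),
      (q ^ (n + 1 - i) + (-1) ^ n * q) * Lam.coord q 1 (shiftSeq v i) -
        (q + (-1) ^ n * q ^ i) * Lam.coord q 2 (v i)] m := by
  simp only [dLam_apply, map_add, map_smul, coord_x_mul, coord_mul_x, coord_y_mul, coord_mul_y]
  fin_cases m
  · simp
  · simp; ring
  · simp; ring
  · simp; ring

variable (q) in
/-- All arrows of the Koszul complex that start or end at the monomial `mon m` at a generator with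
`p` letters `x` and `s` letters `y` vanish. -/
def Surv (m : Fin 4) (p s : ℕ) : Prop :=
  -- The guards `1 ≤ p` and `1 ≤ s` belong to incoming arrows, whose source exists only if there is
  -- a letter `x`, respectively `y`, to remove.
  ![(1 - (-1) ^ (p + s) * q ^ s = 0 ∧ q ^ p - (-1) ^ (p + s) = 0 : Prop),
    (q ^ p + (-1) ^ (p + s) * q = 0 ∧ (1 ≤ p → 1 + (-1) ^ (p + s) * q ^ s = 0) : Prop),
    (q + (-1) ^ (p + s) * q ^ s = 0 ∧ (1 ≤ s → q ^ p + (-1) ^ (p + s) = 0) : Prop),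
    ((1 ≤ s → q ^ p - (-1) ^ (p + s) * q = 0) ∧ (1 ≤ p → q - (-1) ^ (p + s) * q ^ s = 0) : Prop)] m

theorem coord_eVec (m m' : Fin 4) (i j : ℕ) :
    Lam.coord q m (eVec (mon q m') j i) = if m = m' ∧ i = j then 1 else 0 := by
  rw [eVec, Pi.single_apply]
  split_ifs with h1 h2 h2
  · rw [coord_mon, if_pos h2.1]
  · rw [coord_mon, if_neg fun h => h2 ⟨h, h1⟩]
  · exact absurd h2.2 h1
  · exact map_zero _

theorem coord_shiftSeq_eVec (m m' : Fin 4) (i j : ℕ) :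
    Lam.coord q m (shiftSeq (eVec (mon q m') j) i) = if m = m' ∧ i = j + 1 then 1 else 0 := by
  cases i with
  | zero => simp
  | succ i => simp [coord_eVec]

theorem suppLE_eVec (a : Lam q) {j n : ℕ} (h : j ≤ n) : SuppLE n (eVec a j) :=
  fun i hi => by rw [eVec, Pi.single_eq_of_ne (by omega)]

theorem Surv.mem_koszulCocycles {m : Fin 4} {p s n : ℕ} (h : Surv q m p s) (hn : p + s = n) :
    eVec (mon q m) s ∈ koszulCocycles q n := by
  subst hn
  refine ⟨suppLE_eVec _ (by omega), funext fun i => Lam.ext_coord fun m' => ?_⟩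
  rw [coord_dLam, coord_eVec, coord_eVec, coord_shiftSeq_eVec, coord_shiftSeq_eVec]
  have e : p + s + 1 - (s + 1) = p := by omega
  fin_cases m <;> simp only [Surv] at h <;> fin_cases m' <;> simp
  all_goals intro hi; subst hi; simp at h; simp [h, e]

/-- No nonzero arrow ends at a surviving monomial. Its coordinate is therefore a functional on
cohomology, and these functionals separate the proposed basis. -/
theorem Surv.coord_coboundary {m : Fin 4} {p s n : ℕ} (h : Surv q m p s) (hn : p + s = n)
    {v : ℕ → Lam q} (hv : v ∈ koszulCoboundaries q n) : Lam.coord q m (v s) = 0 := by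
  cases n with
  | zero =>
    have : v = 0 := hv
    rw [this]; exact map_zero _
  | succ n =>
    obtain ⟨μ, hμ, rfl⟩ := hv
    have hμ' : SuppLE n μ := hμ
    have e : n + 1 - s = p := by omega
    rw [coord_dLam, e]
    rw [Surv, hn, pow_succ] at h
    have hp : p = 0 → μ s = 0 := fun hp => hμ' _ (by omega)
    have hs : s = 0 → shiftSeq μ s = 0 := fun hs => by rw [hs]; rfl
    have hp' := Nat.eq_zero_or_pos p
    have hs' := Nat.eq_zero_or_pos s
    fin_cases m
    · rfl
    · change (1 - (-1) ^ n * q ^ s) * _ = 0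
      rcases hp' with hp' | hp'
      · rw [hp hp', map_zero, mul_zero]
      · have := h.2 hp'
        rw [show 1 - (-1) ^ n * q ^ s = 0 by linear_combination this, zero_mul]
    · change (q ^ p - (-1) ^ n) * _ = 0
      rcases hs' with hs' | hs'
      · rw [hs hs', map_zero, mul_zero]
      · have := h.2 hs'
        rw [show q ^ p - (-1) ^ n = 0 by linear_combination this, zero_mul]
    · change (q ^ p + (-1) ^ n * q) * _ - (q + (-1) ^ n * q ^ s) * _ = 0
      have h1 : (q ^ p + (-1) ^ n * q) * Lam.coord q 1 (shiftSeq μ s) = 0 := by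
        rcases hs' with hs' | hs'
        · rw [hs hs', map_zero, mul_zero]
        · have := h.1 hs'
          rw [show q ^ p + (-1) ^ n * q = 0 by linear_combination this, zero_mul]
      have h2 : (q + (-1) ^ n * q ^ s) * Lam.coord q 2 (μ s) = 0 := by
        rcases hp' with hp' | hp'
        · rw [hp hp', map_zero, mul_zero]
        · have := h.2 hp'
          rw [show q + (-1) ^ n * q ^ s = 0 by linear_combination this, zero_mul]
      rw [h1, h2, sub_zero]

variable (q) in
/-- The tuples with a single monomial entry at which all arrows vanish. -/
def survSet (n : ℕ) : Set (ℕ → Lam q) :=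
  {v | ∃ (m : Fin 4) (p s : ℕ), p + s = n ∧ Surv q m p s ∧ v = eVec (mon q m) s}

/-- A cocycle without components at the monomials at which all arrows vanish is a coboundary. -/
theorem mem_koszulCoboundaries (hq : q ≠ 0) {n : ℕ} {v : ℕ → Lam q} (hv : v ∈ koszulCocycles q n)
    (h : ∀ m p s, p + s = n → Surv q m p s → Lam.coord q m (v s) = 0) :
    v ∈ koszulCoboundaries q n := by
  classical
  obtain ⟨hv, hd⟩ := mem_koszulCocycles.1 hv
  have hd1 (i : ℕ) : (1 - (-1) ^ n * q ^ i) * Lam.coord q 0 (v i) = 0 := by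
    rw [← map_zero (Lam.coord q 1), ← show dLam q n v i = 0 from congrFun hd i, coord_dLam]
    rfl
  have hd2 (i : ℕ) : (q ^ (n + 1 - i) - (-1) ^ n) * Lam.coord q 0 (shiftSeq v i) = 0 := by
    rw [← map_zero (Lam.coord q 2), ← show dLam q n v i = 0 from congrFun hd i, coord_dLam]
    rfl
  have hd3 (i : ℕ) : (q ^ (n + 1 - i) + (-1) ^ n * q) * Lam.coord q 1 (shiftSeq v i) -
        (q + (-1) ^ n * q ^ i) * Lam.coord q 2 (v i) = 0 := by
    rw [← map_zero (Lam.coord q 3), ← show dLam q n v i = 0 from congrFun hd i, coord_dLam]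
    rfl
  -- A cocycle with a nonzero coordinate at `1` forces both outgoing arrows to vanish, so the
  -- monomial survives. The same argument treats `x` at index `n` and `y` at index `0`, which have
  -- one outgoing arrow and no incoming one.
  have c0 (i : ℕ) : Lam.coord q 0 (v i) = 0 := by
    rcases lt_or_ge n i with hi | hi
    · rw [hv i hi, map_zero]
    by_contra hne
    refine hne (h 0 (n - i) i (by omega) ?_)
    have e : n - i + i = n := by omega
    have h2 := hd2 (i + 1)
    rw [shiftSeq_succ, Nat.add_sub_add_right] at h2
    rw [Surv, e]
    exact ⟨(mul_eq_zero.1 (hd1 i)).resolve_right hne, (mul_eq_zero.1 h2).resolve_right hne⟩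
  have c1 : Lam.coord q 1 (v n) = 0 := by
    by_contra hne
    have h3 := hd3 (n + 1)
    rw [hv (n + 1) (by omega), map_zero, mul_zero, sub_zero, shiftSeq_succ, Nat.sub_self] at h3
    refine hne (h 1 0 n (by omega) ?_)
    rw [Surv, zero_add]
    exact ⟨(mul_eq_zero.1 h3).resolve_right hne, fun h => absurd h (by omega)⟩
  have c2 : Lam.coord q 2 (v 0) = 0 := by
    by_contra hne
    have h3 := hd3 0
    rw [shiftSeq_zero, map_zero, mul_zero, zero_sub, neg_eq_zero] at h3
    refine hne (h 2 n 0 (by omega) ?_)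
    rw [Surv, add_zero]
    exact ⟨(mul_eq_zero.1 h3).resolve_right hne, fun h => absurd h (by omega)⟩
  cases n with
  | zero =>
    refine funext fun i => Lam.ext_coord fun m => ?_
    rw [Pi.zero_apply, map_zero]
    rcases i with _ | i
    · fin_cases m
      · exact c0 0
      · exact c1
      · exact c2
      · refine h 3 0 0 rfl ?_
        simp [Surv]
    · rw [hv (i + 1) (by omega), map_zero]
  | succ n =>
    -- The arrows into `yx` are those out of `1` times `±q`. After cancelling `q`, the cocycle
    -- condition says that the coordinates at `x` and `y` of a square are proportional to its first
    -- two arrows.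
    have rel (i : ℕ) (hi : i ≤ n) : (q ^ (n - i) - (-1) ^ n) * Lam.coord q 1 (v i) =
        (1 - (-1) ^ n * q ^ i) * Lam.coord q 2 (v (i + 1)) := by
      have h3 := hd3 (i + 1)
      rw [shiftSeq_succ, show n + 1 + 1 - (i + 1) = n - i + 1 by omega] at h3
      refine mul_left_cancel₀ hq ?_
      linear_combination h3
    have surv1 (i : ℕ) (hi : i ≤ n) (hP : 1 - (-1) ^ n * q ^ i = 0)
        (hQ : q ^ (n - i) - (-1) ^ n = 0) :
        Lam.coord q 1 (v i) = 0 ∧ Lam.coord q 2 (v (i + 1)) = 0 := by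
      constructor
      · refine h 1 (n - i + 1) i (by omega) ?_
        rw [Surv, show n - i + 1 + i = n + 1 by omega]
        exact ⟨by linear_combination q * hQ, fun _ => by linear_combination hP⟩
      · refine h 2 (n - i) (i + 1) (by omega) ?_
        rw [Surv, show n - i + (i + 1) = n + 1 by omega]
        exact ⟨by linear_combination q * hP, fun _ => by linear_combination hQ⟩
    let P : ℕ → k := fun i => 1 - (-1) ^ n * q ^ i
    let Q : ℕ → k := fun i => q ^ (n - i) - (-1) ^ n
    let X : ℕ → k := fun i => q ^ (n - i) + (-1) ^ n * q
    let Y : ℕ → k := fun i => q + (-1) ^ n * q ^ i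
    -- `α` inverts whichever of `P` and `Q` is nonzero. If both vanish, then `α = 0`, since division
    -- by zero gives zero, and the two coordinates vanish by `surv1`.
    let α : ℕ → k := fun i => if P i = 0 then Lam.coord q 2 (v (i + 1)) / Q i
      else Lam.coord q 1 (v i) / P i
    let β : ℕ → k := fun i => Lam.coord q 3 (v (i + 1)) / X i
    -- The monomial `yx eᵢ` is hit from `x eᵢ₋₁` and from `y eᵢ`. The second source is used only if
    -- the first is absent or has zero arrow, so that nothing is counted twice.
    let γ : ℕ → k := fun i => if i = 0 ∨ X (i - 1) = 0 then -(Lam.coord q 3 (v i) / Y i) else 0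
    let μ : ℕ → Lam q := fun i => if i ≤ n then
      α i • mon q 0 + β i • mon q 1 + γ i • mon q 2 else 0
    have hμ (m : Fin 4) (i : ℕ) (hi : i ≤ n) : Lam.coord q m (μ i) = ![α i, β i, γ i, 0] m := by
      simp only [μ, if_pos hi, map_add, map_smul, coord_mon]
      fin_cases m <;> simp
    have hμs : SuppLE n μ := fun i hi => by simp only [μ, if_neg (not_le.2 hi)]
    refine ⟨μ, hμs, funext fun i => Lam.ext_coord fun m => ?_⟩
    rcases lt_or_ge (n + 1) i with hi | hi
    · rw [hv i hi]
      have : dLam q n μ i = 0 := SuppLE.dK (M := regular k (Lam q)) hμs i hi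
      rw [this]
    rw [coord_dLam]
    fin_cases m
    · exact (c0 i).symm
    · change P i * _ = Lam.coord q 1 (v i)
      rcases Nat.lt_or_ge n i with hi' | hi'
      · obtain rfl : i = n + 1 := by omega
        rw [hμs _ hi', map_zero, mul_zero, c1]
      rw [hμ 0 i hi']
      change P i * (if P i = 0 then _ else _) = _
      split_ifs with hP
      · rw [hP, zero_mul]
        have := rel i hi'
        rw [show 1 - (-1) ^ n * q ^ i = 0 from hP, zero_mul] at this
        rcases mul_eq_zero.1 this with hQ | h0
        · exact (surv1 i hi' hP hQ).1.symm
        · exact h0.symm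
      · exact mul_div_cancel₀ _ hP
    · rcases i with _ | i
      · change _ * Lam.coord q 0 (shiftSeq μ 0) = Lam.coord q 2 (v 0)
        rw [shiftSeq_zero, map_zero, mul_zero, c2]
      have hi' : i ≤ n := by omega
      change (q ^ (n + 1 - (i + 1)) - (-1) ^ n) * Lam.coord q 0 (μ i) = Lam.coord q 2 (v (i + 1))
      rw [hμ 0 i hi', Nat.add_sub_add_right]
      change Q i * (if P i = 0 then _ else _) = _
      split_ifs with hP
      · by_cases hQ : Q i = 0
        · rw [(surv1 i hi' hP hQ).2, hQ, zero_mul]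
        · exact mul_div_cancel₀ _ hQ
      · rw [← mul_div_assoc, div_eq_iff hP, rel i hi', mul_comm]
    · change (q ^ (n + 1 - i) + (-1) ^ n * q) * Lam.coord q 1 (shiftSeq μ i) -
        Y i * Lam.coord q 2 (μ i) = Lam.coord q 3 (v i)
      have hY : (i = 0 ∨ X (i - 1) = 0) → -(Y i * Lam.coord q 2 (μ i)) = Lam.coord q 3 (v i) := by
        intro hX
        -- If neither source reaches `yx eᵢ`, the monomial survives and the hypothesis makes its
        -- coordinate zero.
        have hs : (i ≤ n → Y i = 0) → Lam.coord q 3 (v i) = 0 := by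
          intro hY
          refine h 3 (n + 1 - i) i (by omega) ?_
          rw [Surv, show n + 1 - i + i = n + 1 by omega]
          refine ⟨fun h1 => ?_, fun h1 => ?_⟩
          · have := hX.resolve_left (by omega)
            simp only [X, show n - (i - 1) = n + 1 - i by omega] at this
            linear_combination this
          · have := hY (by omega)
            linear_combination this
        rcases Nat.lt_or_ge n i with hi' | hi'
        · rw [hμs _ hi', map_zero, mul_zero, neg_zero, hs fun h => absurd h (by omega)]
        rw [hμ 2 i hi']
        change -(Y i * (if _ then _ else _)) = _
        rw [if_pos hX]
        by_cases hY : Y i = 0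
        · rw [hY, hs fun _ => hY]; simp
        · rw [mul_neg, neg_neg, mul_div_cancel₀ _ hY]
      rcases i with _ | i
      · rw [shiftSeq_zero, map_zero, mul_zero, zero_sub]
        exact hY (Or.inl rfl)
      have hi' : i ≤ n := by omega
      rw [shiftSeq_succ, hμ 1 i hi', Nat.add_sub_add_right]
      change X i * (Lam.coord q 3 (v (i + 1)) / X i) - _ = _
      by_cases hX : X i = 0
      · rw [hX, zero_mul, zero_sub]
        exact hY (Or.inr hX)
      · have : Lam.coord q 2 (μ (i + 1)) = 0 := by
          rcases Nat.lt_or_ge n (i + 1) with hi' | hi'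
          · rw [hμs _ hi', map_zero]
          · rw [hμ 2 _ hi']
            change (if _ then _ else _) = _
            rw [if_neg]
            simpa using hX
        rw [this, mul_zero, sub_zero, mul_div_cancel₀ _ hX]

/-- Coordinates at the surviving monomials give independence. For generation, subtract from a
cocycle its surviving components; the rest is a coboundary by `mem_koszulCoboundaries`. -/
theorem repBasis_survSet (hq : q ≠ 0) (n : ℕ) : RepBasis q n (survSet q n) := by
  classical
  choose m p s hps hsurv heq using fun v : survSet q n => v.2
  refine repBasis_of (φ := fun v => Lam.coord q (m v) ∘ₗ LinearMap.proj (s v)) ?_ ?_ ?_ ?_ ?_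
  · rintro v ⟨m, p, s, hn, hs, rfl⟩
    exact hs.mem_koszulCocycles hn
  · intro v w hw
    exact (hsurv v).coord_coboundary (hps v) hw
  · intro v
    rw [heq v]
    simp only [LinearMap.comp_apply, LinearMap.proj_apply, coord_eVec]
    simp
  · intro v w hvw
    rw [heq w]
    simp only [LinearMap.comp_apply, LinearMap.proj_apply, coord_eVec]
    rw [if_neg]
    rintro ⟨h1, h2⟩
    refine hvw (Subtype.ext ?_)
    rw [heq v, heq w, h1, h2]
  · intro v hv
    let w : ℕ → Lam q := ∑ s ∈ Finset.range (n + 1), ∑ m : Fin 4,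
      if Surv q m (n - s) s then Lam.coord q m (v s) • eVec (mon q m) s else 0
    have hw : w ∈ Submodule.span k (survSet q n) := by
      refine Submodule.sum_mem _ fun s hs => Submodule.sum_mem _ fun m _ => ?_
      split_ifs with h
      · refine Submodule.smul_mem _ _ (Submodule.subset_span ⟨m, n - s, s, ?_, h, rfl⟩)
        have := Finset.mem_range.1 hs
        omega
      · exact Submodule.zero_mem _
    have hwz : w ∈ koszulCocycles q n := by
      refine Submodule.span_le.2 ?_ hw
      rintro v ⟨m, p, s, hn, hs, rfl⟩
      exact hs.mem_koszulCocycles hn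
    have hb : v - w ∈ koszulCoboundaries q n := by
      refine mem_koszulCoboundaries hq (Submodule.sub_mem _ hv hwz) fun m p s hn hs => ?_
      have : Lam.coord q m (w s) = Lam.coord q m (v s) := by
        simp only [w, Finset.sum_apply, map_sum]
        rw [Finset.sum_eq_single s, Finset.sum_eq_single m]
        · rw [if_pos (by rwa [show n - s = p by omega]), Pi.smul_apply, map_smul, coord_eVec]
          simp
        · intro m' _ hm
          split_ifs
          · rw [Pi.smul_apply, map_smul, coord_eVec, if_neg fun h => hm h.1.symm, smul_zero]
          · exact map_zero _
        · simp
        · intro s' _ hs'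
          refine Finset.sum_eq_zero fun m' _ => ?_
          split_ifs
          · rw [Pi.smul_apply, map_smul, coord_eVec, if_neg fun h => hs' h.2.symm, smul_zero]
          · exact map_zero _
        · intro h
          exact absurd (Finset.mem_range.2 (by omega)) h
      rw [Pi.sub_apply, map_sub, this, sub_self]
    rw [← add_sub_cancel w v]
    exact Submodule.add_mem_sup hw hb

end QuantumPlane

/-! ### Cup products of Koszul classes. -/

namespace QuantumPlane

open Bimod

universe u
variable {k : Type u} [Field k] {q : k}

theorem kv_eq_zero {M : Type*} [AddCommGroup M] [Module k M] (n : ℕ) (F : (ℕ → Lam q) → M) {i : ℕ}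
    (hi : n < i) : kv n F i = 0 := by
  induction n generalizing F i with
  | zero => rw [kv, if_neg hi.ne']
  | succ n ih =>
    obtain ⟨i, rfl⟩ : ∃ j, i = j + 1 := ⟨i - 1, by omega⟩
    rw [kv_succ, ih _ (by omega), shiftSeq_succ, ih _ (by omega)]
    simp

/-- Cutting words after `m` letters gives `fᵐ⁺ⁿᵢ = ∑ q^(j(n-l)) fᵐⱼ ⊗ fⁿₗ` over `j + l = i`: each of
the `j` letters `y` in the first part precedes the `n - l` letters `x` of the second. -/
theorem kv_mul (m n : ℕ) (F G : (ℕ → Lam q) → Lam q) (hF : ∀ a b, (∀ i < m, a i = b i) → F a = F b)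
    (i : ℕ) : kv (m + n) (fun a => F a * G fun j => a (m + j)) i =
      ∑ j ∈ Finset.HasAntidiagonal.antidiagonal i, q ^ (j.1 * (n - j.2)) • (kv m F j.1 * kv n G j.2) := by
  induction m generalizing F i with
  | zero =>
    have h0 (a : ℕ → Lam q) : F a = F 0 := hF _ _ fun i hi => absurd hi (by omega)
    rw [Finset.sum_eq_single (0, i)]
    · simp only [h0, zero_add]
      rw [zero_mul, pow_zero, one_smul, kv, if_pos rfl]
      exact kv_map n (LinearMap.mulLeft k (F 0)) G i
    · rintro ⟨j, l⟩ hj hne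
      rw [kv, if_neg, zero_mul, smul_zero]
      rintro rfl
      exact hne (by simpa using Finset.HasAntidiagonal.mem_antidiagonal.1 hj)
    · intro h
      exact absurd (Finset.HasAntidiagonal.mem_antidiagonal.2 (zero_add i)) h
  | succ m ih =>
    have hstep (b : Lam q) : (fun a : ℕ → Lam q => F (seqCons b a) *
        G fun j => seqCons b a (m + 1 + j)) =
        fun a => (fun a => F (seqCons b a)) a * G fun j => a (m + j) := by
      funext a
      congr 2
      funext j
      rw [show m + 1 + j = m + j + 1 by omega]
      rfl
    have hF' (b : Lam q) : ∀ a a' : ℕ → Lam q, (∀ i < m, a i = a' i) →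
        F (seqCons b a) = F (seqCons b a') := by
      intro a a' h
      refine hF _ _ fun i hi => ?_
      cases i with
      | zero => rfl
      | succ i => exact h i (by omega)
    rw [show m + 1 + n = m + n + 1 by omega, kv_succ, hstep, hstep, ih _ (hF' _)]
    simp only [kv_succ m, add_mul, smul_add, Finset.sum_add_distrib]
    congr 1
    cases i with
    | zero => simp
    | succ i =>
      rw [shiftSeq_succ, ih _ (hF' _), Finset.Nat.sum_antidiagonal_succ]
      simp only [shiftSeq_zero, shiftSeq_succ, smul_zero, zero_mul, zero_add, Finset.smul_sum]
      refine Finset.sum_congr rfl fun j hj => ?_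
      have hj := Finset.HasAntidiagonal.mem_antidiagonal.1 hj
      -- Outside `j.1 ≤ m` and `j.2 ≤ n` both terms vanish; inside, the subtractions in the
      -- exponents are not truncated.
      rcases lt_or_ge m j.1 with h1 | h1
      · rw [kv_eq_zero _ _ h1]; simp
      rcases lt_or_ge n j.2 with h2 | h2
      · rw [kv_eq_zero _ _ h2]; simp
      rw [smul_mul_assoc, smul_smul, smul_smul, ← pow_add, ← pow_add]
      congr 2
      obtain ⟨t, ht⟩ := Nat.exists_eq_add_of_le h2
      obtain ⟨r, hr⟩ := Nat.exists_eq_add_of_le h1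
      rw [show n - j.2 = t by omega, show m + 1 - (j.1 + 1) = r by omega,
        show m + n + 1 - (i + 1) = r + t by omega]
      ring

theorem koszulValue_cup {m n : ℕ} (f : Cochain k (Lam q) m) (g : Cochain k (Lam q) n) (i : ℕ) :
    koszulValue (cup f g) i = ∑ j ∈ Finset.HasAntidiagonal.antidiagonal i,
      q ^ (j.1 * (n - j.2)) • (koszulValue f j.1 * koszulValue g j.2) := by
  simp only [koszulValue_eq_kv]
  exact kv_mul m n (ev f) (ev g) (fun a b h => ev_congr f h) i

theorem koszulValue_cup_eVec {m n : ℕ} {f : Cochain k (Lam q) m} {g : Cochain k (Lam q) n}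
    {a b : Lam q} {s t : ℕ} (hf : koszulValue f = eVec a s) (hg : koszulValue g = eVec b t) :
    koszulValue (cup f g) = eVec (q ^ (s * (n - t)) • (a * b)) (s + t) := by
  funext i
  rw [koszulValue_cup, hf, hg]
  simp only [eVec]
  by_cases hi : i = s + t
  · subst hi
    rw [Finset.sum_eq_single (s, t)]
    · simp
    · rintro ⟨j, l⟩ hj hne
      have hj := Finset.HasAntidiagonal.mem_antidiagonal.1 hj
      have : j ≠ s := by
        rintro rfl
        exact hne (by simp only [Prod.mk.injEq, true_and]; simp only at hj; omega)
      simp [this]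
    · intro h
      exact (h (Finset.HasAntidiagonal.mem_antidiagonal.2 rfl)).elim
  · rw [Pi.single_eq_of_ne hi]
    refine Finset.sum_eq_zero fun j hj => ?_
    have hj := Finset.HasAntidiagonal.mem_antidiagonal.1 hj
    by_cases h1 : j.1 = s
    · have : j.2 ≠ t := by omega
      simp [this]
    · simp [h1]

open Classical in
/-- The class in the Hochschild cohomology ring of the tuple with entry `a` at the generator with
`p` letters `x` and `s` letters `y`, if this tuple is a cocycle. -/
noncomputable def cls (a : Lam q) (p s : ℕ) : HHRing k (Lam q) :=
  if h : eVec a s ∈ koszulCocycles q (p + s) then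
    DirectSum.of (HH k (Lam q)) (p + s) (koszulClass q (p + s) ⟨_, h⟩) else 0

theorem cls_eq {a : Lam q} {p s n : ℕ} (hn : p + s = n) (h : eVec a s ∈ koszulCocycles q n) :
    cls a p s = DirectSum.of (HH k (Lam q)) n (koszulClass q n ⟨_, h⟩) := by
  subst hn
  rw [cls, dif_pos h]

theorem cls_eq_of_eq {a : Lam q} {p s n : ℕ} (hn : p + s = n) (v : koszulCocycles q n)
    (h : v.1 = eVec a s) : DirectSum.of (HH k (Lam q)) n (koszulClass q n v) = cls a p s := by
  obtain ⟨v, hv⟩ := v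
  subst h
  exact (cls_eq hn hv).symm

theorem eVec_smul (r : k) (a : Lam q) (s : ℕ) : eVec (r • a) s = r • eVec a s :=
  Pi.single_smul' s r a

theorem cls_zero (p s : ℕ) : cls (0 : Lam q) p s = 0 := by
  have h : eVec (0 : Lam q) s = 0 := Pi.single_zero s
  rw [cls]
  split_ifs with h1
  · have : (⟨_, h1⟩ : koszulCocycles q (p + s)) = 0 := Subtype.ext h
    rw [this, map_zero, map_zero]
  · rfl

theorem cls_smul (r : k) (a : Lam q) (p s : ℕ) : cls (r • a) p s = r • cls a p s := by
  by_cases hr : r = 0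
  · rw [hr, zero_smul, zero_smul, cls_zero]
  by_cases h : eVec a s ∈ koszulCocycles q (p + s)
  · have h' : eVec (r • a) s ∈ koszulCocycles q (p + s) := by
      rw [eVec_smul]; exact Submodule.smul_mem _ _ h
    rw [cls_eq rfl h, cls_eq rfl h']
    have : (⟨_, h'⟩ : koszulCocycles q (p + s)) = r • ⟨_, h⟩ := Subtype.ext (eVec_smul r a s)
    rw [this, map_smul]
    exact (DirectSum.lof k ℕ (HH k (Lam q)) (p + s)).map_smul r _
  · have h' : eVec (r • a) s ∉ koszulCocycles q (p + s) := by
      rw [eVec_smul]; rwa [Submodule.smul_mem_iff _ hr]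
    rw [cls, dif_neg h', cls, dif_neg h, smul_zero]

/-- The product is formed with the extended Hochschild cocycles and then evaluated at the Koszul
elements, which determines its class. -/
theorem of_koszulClass_mul {m n : ℕ} (v : koszulCocycles q m) (w : koszulCocycles q n) :
    ∃ z : koszulCocycles q (m + n), (∀ a b s t, v.1 = eVec a s → w.1 = eVec b t →
        z.1 = eVec (q ^ (s * (n - t)) • (a * b)) (s + t)) ∧
      DirectSum.of (HH k (Lam q)) m (koszulClass q m v) *
        DirectSum.of (HH k (Lam q)) n (koszulClass q n w) =
      DirectSum.of (HH k (Lam q)) (m + n) (koszulClass q (m + n) z) := by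
  let c := cupCocycles k (Lam q) m n (extCocycle q m v) (extCocycle q n w)
  refine ⟨⟨koszulValue c.1, koszulValue_mem_cocycles c.2⟩, fun a b s t hv hw => ?_, ?_⟩
  · exact koszulValue_cup_eVec ((koszulValue_extCocycle v).trans hv)
      ((koszulValue_extCocycle w).trans hw)
  · rw [DirectSum.of_mul_of, ← mk_eq_koszulClass]
    rfl

theorem cls_mul_cls {a b : Lam q} {p s p' s' : ℕ} (ha : eVec a s ∈ koszulCocycles q (p + s))
    (hb : eVec b s' ∈ koszulCocycles q (p' + s')) :
    cls a p s * cls b p' s' = q ^ (s * p') • cls (a * b) (p + p') (s + s') := by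
  obtain ⟨z, hz, h⟩ := of_koszulClass_mul ⟨_, ha⟩ ⟨_, hb⟩
  rw [cls_eq rfl ha, cls_eq rfl hb, h, cls_eq_of_eq (p := p + p') (by omega) z (hz _ _ _ _ rfl rfl),
    cls_smul, Nat.add_sub_cancel]

theorem Surv.mem {m : Fin 4} {p s : ℕ} (h : Surv q m p s) :
    eVec (mon q m) s ∈ koszulCocycles q (p + s) := h.mem_koszulCocycles rfl

/-- Either the tuple is no cocycle and `cls` takes its default value, or it is a cocycle without
surviving components and thus a coboundary. -/
theorem cls_mon_eq_zero (hq : q ≠ 0) {m : Fin 4} {p s : ℕ} (h : ¬ Surv q m p s) :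
    cls (mon q m) p s = 0 := by
  by_cases hc : eVec (mon q m) s ∈ koszulCocycles q (p + s)
  · rw [cls_eq rfl hc]
    have : koszulClass q (p + s) ⟨_, hc⟩ = 0 := by
      rw [koszulClass_eq_zero]
      refine mem_koszulCoboundaries hq hc fun m' p' s' hn hs => ?_
      rw [coord_eVec, if_neg]
      rintro ⟨rfl, rfl⟩
      obtain rfl : p' = p := by omega
      exact h hs
    rw [this, map_zero]
  · rw [cls, dif_neg hc]

theorem IsRepBy.unique {n : ℕ} {h h' : HH k (Lam q) n} {v : ℕ → Lam q} (H : IsRepBy h v)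
    (H' : IsRepBy h' v) : h = h' := by
  obtain ⟨c, hc⟩ := H.1
  rw [← H.2 c hc, ← H'.2 c hc]

variable (q) in
/-- The indices of the basis of the Hochschild cohomology ring. -/
abbrev SurvIdx : Type := {t : Fin 4 × ℕ × ℕ // Surv q t.1 t.2.1 t.2.2}

theorem eVec_mon_injective {m m' : Fin 4} {s s' : ℕ}
    (h : eVec (mon q m) s = eVec (mon q m') s') : m = m' ∧ s = s' := by
  have h1 := coord_eVec (q := q) m m s s
  rw [h, coord_eVec] at h1
  by_contra hne
  rw [if_neg hne] at h1
  simp at h1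

/-- The classes of the monomial tuples at which all arrows vanish form a basis of the Hochschild
cohomology ring. -/
theorem exists_hhBasis (hq : q ≠ 0) : ∃ B : Module.Basis (SurvIdx q) k (HHRing k (Lam q)),
    ∀ t, B t = cls (mon q t.1.1) t.1.2.1 t.1.2.2 := by
  choose b hb using fun n => repBasis_survSet hq n
  let e : SurvIdx q → Σ n, survSet q n := fun t =>
    ⟨t.1.2.1 + t.1.2.2, eVec (mon q t.1.1) t.1.2.2, t.1.1, t.1.2.1, t.1.2.2, rfl, t.2, rfl⟩
  have he : Function.Bijective e := by
    constructor
    · rintro ⟨⟨m, p, s⟩, h⟩ ⟨⟨m', p', s'⟩, h'⟩ hee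
      have h1 : p + s = p' + s' := congrArg Sigma.fst hee
      have h2 : eVec (mon q m) s = eVec (mon q m') s' :=
        congrArg (fun x : Σ n, survSet q n => x.2.1) hee
      obtain ⟨rfl, rfl⟩ := eVec_mon_injective h2
      obtain rfl : p = p' := by omega
      rfl
    · rintro ⟨n, v, m, p, s, rfl, h, rfl⟩
      exact ⟨⟨(m, p, s), h⟩, rfl⟩
  refine ⟨(DFinsupp.basis b).reindex (Equiv.ofBijective e he).symm, fun t => ?_⟩
  rw [Module.Basis.reindex_apply, Equiv.symm_symm, Equiv.ofBijective_apply, cls_eq rfl t.2.mem]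
  have h1 : (DFinsupp.basis b) (e t) = DFinsupp.single (e t).1 (b (e t).1 (e t).2) := by
    refine (DFinsupp.basis b).repr.injective ?_
    rw [Module.Basis.repr_self]
    change _ = (sigmaFinsuppLequivDFinsupp k).symm
      (DFinsupp.mapRange.linearEquiv (fun i => (b i).repr) _)
    rw [LinearEquiv.eq_symm_apply, DFinsupp.mapRange.linearEquiv_apply, DFinsupp.mapRange_single]
    refine (sigmaFinsuppEquivDFinsupp_single (e t) (1 : k)).trans ?_
    rw [Module.Basis.repr_self]
  rw [h1]
  have h2 := (hb (e t).1 (e t).2).unique (isRepBy_koszulClass ⟨_, t.2.mem⟩)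
  rw [h2]
  rfl

end QuantumPlane

/-! ### Maps out of the presented algebras, and a criterion for bijectivity. -/

namespace QuantumPlane

section Lifts

variable {k : Type*} [Field k] {T : Type*} [Ring T] [Algebra k T]

theorem extAlg_subalgebra_eq_top {n : ℕ} {S : Subalgebra k (ExtAlg k n)}
    (h : ∀ i, extGen k i ∈ S) : S = ⊤ := by
  rw [eq_top_iff, ← CliffordAlgebra.adjoin_range_ι, Algebra.adjoin_le_iff]
  rintro _ ⟨v, rfl⟩
  have hv : v = ∑ i, v i • Pi.single i (1 : k) := by
    ext j
    simp [Finset.sum_apply, Pi.single_apply]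
  rw [hv, map_sum]
  refine S.sum_mem fun i _ => ?_
  rw [map_smul]
  exact S.smul_mem (h i) _

/-- In the square of a linear combination the mixed terms cancel under `(i, j) ↦ (j, i)`. The
vanishing of the squares is a separate hypothesis because anticommutation does not imply it in
characteristic `2`. -/
theorem exists_extAlg_lift {n : ℕ} (u : Fin n → T) (h0 : ∀ i, u i * u i = 0)
    (h1 : ∀ i j, u i * u j = -(u j * u i)) :
    ∃ Φ : ExtAlg k n →ₐ[k] T, ∀ i, Φ (extGen k i) = u i := by
  let f : (Fin n → k) →ₗ[k] T := Fintype.linearCombination k u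
  have hf : ∀ v, f v * f v = 0 := by
    intro v
    simp only [f, Fintype.linearCombination_apply, Finset.sum_mul_sum, smul_mul_smul_comm]
    rw [← Finset.sum_product']
    refine Finset.sum_involution (fun p _ => (p.2, p.1)) ?_ ?_ ?_ ?_
    · rintro ⟨i, j⟩ _
      simp only
      rw [h1 i j, mul_comm (v i), smul_neg, neg_add_cancel]
    · rintro ⟨i, j⟩ _ hne hij
      simp only [Prod.mk.injEq] at hij
      obtain ⟨rfl, -⟩ := hij
      exact hne (by rw [h0, smul_zero])
    · simp
    · simp
  refine ⟨ExteriorAlgebra.lift k ⟨f, hf⟩, fun i => ?_⟩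
  rw [ExteriorAlgebra.lift_ι_apply]
  simp [f, Fintype.linearCombination_apply_single]

/-- The target need not be commutative, but the commuting `wᵢ` generate a commutative subalgebra, to
which the universal property of polynomials applies. -/
theorem exists_mvPolynomial_lift {n : ℕ} (w : Fin n → T) (h : ∀ i j, w i * w j = w j * w i) :
    ∃ Φ : MvPolynomial (Fin n) k →ₐ[k] T, ∀ i, Φ (MvPolynomial.X i) = w i := by
  have : IsMulCommutative (Algebra.adjoin k (Set.range w)) := Algebra.isMulCommutative_adjoin k (by
    rintro _ ⟨i, rfl⟩ _ ⟨j, rfl⟩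
    exact h i j)
  let _ : CommRing (Algebra.adjoin k (Set.range w)) :=
    { (inferInstance : Ring (Algebra.adjoin k (Set.range w))) with mul_comm := this.is_comm.comm }
  refine ⟨(Algebra.adjoin k (Set.range w)).val.comp (MvPolynomial.aeval fun i =>
    (⟨w i, Algebra.subset_adjoin ⟨i, rfl⟩⟩ : Algebra.adjoin k (Set.range w))), fun i => ?_⟩
  simp

theorem mvPolynomial_subalgebra_eq_top {n : ℕ} {S : Subalgebra k (MvPolynomial (Fin n) k)}
    (h : ∀ i, MvPolynomial.X i ∈ S) : S = ⊤ := by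
  rw [eq_top_iff, ← MvPolynomial.adjoin_range_X, Algebra.adjoin_le_iff]
  rintro _ ⟨i, rfl⟩
  exact h i

theorem tensor_subalgebra_eq_top {A B : Type*} [Ring A] [Algebra k A] [Ring B] [Algebra k B]
    {S : Subalgebra k (A ⊗[k] B)} (h1 : ∀ a : A, a ⊗ₜ (1 : B) ∈ S)
    (h2 : ∀ b : B, (1 : A) ⊗ₜ b ∈ S) : S = ⊤ := by
  rw [eq_top_iff]
  rintro x -
  induction x with
  | zero => exact S.zero_mem
  | tmul a b => simpa using S.mul_mem (h1 a) (h2 b)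
  | add a b ha hb => exact S.add_mem ha hb

variable {R : Type*} [Ring R] [Algebra k R]

theorem poly_subalgebra_eq_top {n : ℕ} {S : Subalgebra k (Poly k R n)}
    (h1 : ∀ a : R, cst a ∈ S) (h2 : ∀ i, polyVar k R i ∈ S) : S = ⊤ := by
  refine tensor_subalgebra_eq_top h1 fun p => ?_
  have := mvPolynomial_subalgebra_eq_top (k := k) (n := n)
    (S := S.comap (Algebra.TensorProduct.includeRight : MvPolynomial (Fin n) k →ₐ[k] Poly k R n)) h2
  have hp : p ∈ S.comap
      (Algebra.TensorProduct.includeRight : MvPolynomial (Fin n) k →ₐ[k] Poly k R n) := by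
    rw [this]; trivial
  exact hp

/-- The subalgebra of elements that commute with `t`. -/
def commutant (t : T) : Subalgebra k T := Subalgebra.centralizer k {t}

theorem mem_commutant {t a : T} : a ∈ commutant (k := k) t ↔ t * a = a * t := by
  simp [commutant, Subalgebra.mem_centralizer_iff]

theorem exists_poly_lift {n : ℕ} (Φ : R →ₐ[k] T) (w : Fin n → T)
    (h : ∀ i j, w i * w j = w j * w i) (hΦ : ∀ i a, w i * Φ a = Φ a * w i) :
    ∃ Ψ : Poly k R n →ₐ[k] T, (∀ a, Ψ (cst a) = Φ a) ∧ ∀ i, Ψ (polyVar k R i) = w i := by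
  obtain ⟨Θ, hΘ⟩ := exists_mvPolynomial_lift (k := k) w h
  have hc (a : R) (p : MvPolynomial (Fin n) k) : Commute (Φ a) (Θ p) := by
    have : (commutant (Φ a)).comap Θ = ⊤ := mvPolynomial_subalgebra_eq_top fun i =>
      (mem_commutant (k := k)).2 (by
        change Φ a * Θ (MvPolynomial.X i) = Θ (MvPolynomial.X i) * Φ a
        rw [hΘ, hΦ])
    have hp : p ∈ (commutant (Φ a)).comap Θ := by rw [this]; trivial
    exact (mem_commutant (k := k)).1 hp
  refine ⟨Algebra.TensorProduct.lift Φ Θ hc, fun a => ?_, fun i => ?_⟩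
  · simp
  · simp [hΘ]

theorem exists_quot_lift {S : Set R} (Ψ : R →ₐ[k] T) (h : ∀ a ∈ S, Ψ a = 0) :
    ∃ Φ : QuotBy S →ₐ[k] T, ∀ a, Φ (quotMk k S a) = Ψ a :=
  ⟨RingQuot.liftAlgHom k ⟨Ψ, by rintro a b ⟨ha, rfl⟩; rw [h a ha, map_zero]⟩,
    fun a => RingQuot.liftAlgHom_mkAlgHom_apply k Ψ _ a⟩

theorem quotMk_eq_zero {S : Set R} {a : R} (h : a ∈ S) : quotMk k S a = 0 := by
  rw [← map_zero (quotMk k S)]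
  exact RingQuot.mkAlgHom_rel k ⟨h, rfl⟩

/-- The algebra map from the fibre product of `k[z]/(z²)` and an augmented algebra. -/
def fibreLift {S : Type*} [Ring S] [Algebra k S] {g : S →ₐ[k] k} (Φ : S →ₐ[k] T) (z : T)
    (hz : z * z = 0) (h1 : ∀ s, Φ s * z = g s • z) (h2 : ∀ s, z * Φ s = g s • z) :
    FibreProduct (TrivSqZeroExt.fstHom k k k : DualNumber k →ₐ[k] k) g →ₐ[k] T :=
  AlgHom.ofLinearMap
    { toFun := fun a => Φ a.1.2 + a.1.1.snd • z
      map_add' := fun a b => by simp [add_smul]; abel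
      map_smul' := fun c a => by simp [mul_smul] }
    (by simp)
    (by
      intro a b
      have ha : a.1.1.fst = g a.1.2 := a.2
      have hb : b.1.1.fst = g b.1.2 := b.2
      simp only [LinearMap.coe_mk, AddHom.coe_mk, add_mul, mul_add, smul_mul_assoc, mul_smul_comm,
        h1, h2, hz, smul_zero, add_zero, Subalgebra.coe_mul, Prod.fst_mul, Prod.snd_mul, map_mul,
        TrivSqZeroExt.snd_mul, ha, hb, smul_smul, op_smul_eq_smul, smul_eq_mul, add_smul]
      rw [mul_comm (g b.1.2), add_assoc, mul_comm (g a.1.2), add_comm (_ • z)])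

theorem fibreLift_apply {S : Type*} [Ring S] [Algebra k S] {g : S →ₐ[k] k} (Φ : S →ₐ[k] T) (z : T)
    (hz : z * z = 0) (h1 : ∀ s, Φ s * z = g s • z) (h2 : ∀ s, z * Φ s = g s • z)
    (a : FibreProduct (TrivSqZeroExt.fstHom k k k : DualNumber k →ₐ[k] k) g) :
    fibreLift Φ z hz h1 h2 a = Φ a.1.2 + a.1.1.snd • z := rfl

/-- The elements on which two-sided multiplication by `z` is given by the augmentation. -/
def augActs {S : Type*} [Ring S] [Algebra k S] (g : S →ₐ[k] k) (Φ : S →ₐ[k] T) (z : T) :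
    Subalgebra k S where
  carrier := {s | Φ s * z = g s • z ∧ z * Φ s = g s • z}
  mul_mem' := by
    rintro a b ⟨h1, h2⟩ ⟨h3, h4⟩
    constructor
    · rw [map_mul, mul_assoc, h3, mul_smul_comm, h1, smul_smul, map_mul, mul_comm]
    · rw [map_mul, ← mul_assoc, h2, smul_mul_assoc, h4, smul_smul, map_mul]
  add_mem' := by
    rintro a b ⟨h1, h2⟩ ⟨h3, h4⟩
    constructor
    · rw [map_add, add_mul, h1, h3, map_add, add_smul]
    · rw [map_add, mul_add, h2, h4, map_add, add_smul]
  algebraMap_mem' r := by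
    constructor
    · rw [AlgHom.commutes, AlgHom.commutes, Algebra.smul_def]; rfl
    · rw [AlgHom.commutes, AlgHom.commutes, ← Algebra.commutes, Algebra.smul_def]; rfl

/-- The section of the projection of the fibre product to its second factor. -/
def fibreSection {S : Type*} [Ring S] [Algebra k S] (g : S →ₐ[k] k) :
    S →ₐ[k] FibreProduct (TrivSqZeroExt.fstHom k k k : DualNumber k →ₐ[k] k) g :=
  AlgHom.codRestrict (((Algebra.ofId k (DualNumber k)).comp g).prod (AlgHom.id k S)) _ (by
    intro s
    change TrivSqZeroExt.fst (algebraMap k (DualNumber k) (g s)) = g s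
    rfl)

/-- The generator `z` of the fibre product. -/
def fibreEps {S : Type*} [Ring S] [Algebra k S] (g : S →ₐ[k] k) :
    FibreProduct (TrivSqZeroExt.fstHom k k k : DualNumber k →ₐ[k] k) g :=
  ⟨(DualNumber.eps, 0), by simp⟩

/-- The fibre product is the sum of a copy of `S` and the line spanned by `z`. -/
theorem fibre_eq {S : Type*} [Ring S] [Algebra k S] {g : S →ₐ[k] k}
    (a : FibreProduct (TrivSqZeroExt.fstHom k k k : DualNumber k →ₐ[k] k) g) :
    a = fibreSection g a.1.2 + a.1.1.snd • fibreEps g := by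
  have ha : a.1.1.fst = g a.1.2 := a.2
  refine Subtype.ext (Prod.ext ?_ ?_)
  · change a.1.1 = algebraMap k (DualNumber k) (g a.1.2) + a.1.1.snd • DualNumber.eps
    refine TrivSqZeroExt.ext ?_ ?_
    · rw [← ha]; simp [TrivSqZeroExt.algebraMap_eq_inl]
    · simp [TrivSqZeroExt.algebraMap_eq_inl]
  · change a.1.2 = a.1.2 + a.1.1.snd • 0
    rw [smul_zero, add_zero]

/-- A submodule that contains `1` and is closed under left multiplication by elements that generate
the algebra is everything. -/
def leftStable (V : Submodule k T) : Subalgebra k T where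
  carrier := {a | ∀ v ∈ V, a * v ∈ V}
  mul_mem' := fun ha hb v hv => by rw [mul_assoc]; exact ha _ (hb _ hv)
  add_mem' := fun ha hb v hv => by rw [add_mul]; exact V.add_mem (ha _ hv) (hb _ hv)
  algebraMap_mem' := fun r v hv => by rw [← Algebra.smul_def]; exact V.smul_mem r hv

theorem mem_leftStable_span {ι : Type*} {g : ι → T} {a : T}
    (h : ∀ i, a * g i ∈ Submodule.span k (Set.range g)) :
    a ∈ leftStable (Submodule.span k (Set.range g)) := by
  intro v hv
  have : Submodule.span k (Set.range g) ≤
      (Submodule.span k (Set.range g)).comap (LinearMap.mulLeft k a) := by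
    refine Submodule.span_le.2 ?_
    rintro _ ⟨i, rfl⟩
    exact h i
  exact this hv

theorem eq_top_of_leftStable {V : Submodule k T} (h1 : (1 : T) ∈ V) (h : leftStable V = ⊤) :
    V = ⊤ := by
  rw [eq_top_iff]
  intro a _
  have ha : a ∈ leftStable V := by rw [h]; trivial
  simpa using ha 1 h1

/-- A spanning family that maps to nonzero multiples of a basis is itself a basis. Every
presentation is proved in this way: on the presented side only spanning has to be shown, never
independence. -/
theorem bijective_of_span {ι V W : Type*} [AddCommGroup V] [Module k V] [AddCommGroup W]
    [Module k W] (b : Module.Basis ι k V) (f : W →ₗ[k] V) (g : ι → W)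
    (hg : Submodule.span k (Set.range g) = ⊤) (c : ι → k) (hc : ∀ i, c i ≠ 0)
    (h : ∀ i, f (g i) = c i • b i) : Function.Bijective f := by
  let s : V →ₗ[k] W := b.constr k fun i => (c i)⁻¹ • g i
  have hs : f ∘ₗ s = LinearMap.id := b.ext fun i => by
    simp only [s, LinearMap.comp_apply, Module.Basis.constr_basis, map_smul, h, smul_smul,
      inv_mul_cancel₀ (hc i), one_smul, LinearMap.id_apply]
  have hsurj : Function.Surjective s := by
    rw [← LinearMap.range_eq_top, eq_top_iff, ← hg, Submodule.span_le]
    rintro _ ⟨i, rfl⟩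
    refine ⟨c i • b i, ?_⟩
    simp only [s, map_smul, Module.Basis.constr_basis, smul_smul, mul_inv_cancel₀ (hc i), one_smul]
  refine ⟨fun a a' ha => ?_, fun v => ⟨s v, LinearMap.congr_fun hs v⟩⟩
  obtain ⟨v, rfl⟩ := hsurj a
  obtain ⟨v', rfl⟩ := hsurj a'
  have h1 := LinearMap.congr_fun hs v
  have h2 := LinearMap.congr_fun hs v'
  simp only [LinearMap.comp_apply, LinearMap.id_apply] at h1 h2
  rw [h1, h2] at ha
  rw [ha]

end Lifts

end QuantumPlane

/-! ### Surviving squares and boundary pieces, and the general Hilbert series. -/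

namespace QuantumPlane

universe u
variable {k : Type u} [Field k] {q : k}

variable (q) in
/-- All arrows of the square with corner `1` at the generator with `p` letters `x` and `s` letters
`y` vanish. -/
def Sq (p s : ℕ) : Prop := q ^ s = (-1) ^ (p + s) ∧ q ^ p = (-1) ^ (p + s)

theorem neg_one_pow_mul_self (n : ℕ) : (-1 : k) ^ n * (-1) ^ n = 1 := by
  rw [← mul_pow]; simp

theorem surv_zero {p s : ℕ} : Surv q 0 p s ↔ Sq q p s := by
  have h := neg_one_pow_mul_self (k := k) (p + s)
  refine and_congr ⟨fun h1 => ?_, fun h1 => ?_⟩ sub_eq_zero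
  · linear_combination (-(-1) ^ (p + s)) * h1 + (q ^ s) * (-h)
  · linear_combination (-(-1) ^ (p + s)) * h1 - h

/-- Up to sign and a factor `q ≠ 0`, the arrows at the corner `x` are the two arrows at the corner
`1`. The same holds for the corners `y` and `yx`, so a square survives as a whole or not at all. -/
theorem surv_one_succ (hq : q ≠ 0) {p s : ℕ} : Surv q 1 (p + 1) s ↔ Sq q p s := by
  have h := neg_one_pow_mul_self (k := k) (p + s)
  have e : (-1 : k) ^ (p + 1 + s) = -(-1) ^ (p + s) := by
    rw [show p + 1 + s = p + s + 1 by omega, pow_succ]; ring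
  simp only [Surv, e, Sq]
  constructor
  · rintro ⟨h1, h2⟩
    have h2 := h2 (by omega)
    refine ⟨by linear_combination (-(-1) ^ (p + s)) * h2 + (q ^ s) * (-h),
      mul_left_cancel₀ hq ?_⟩
    linear_combination h1
  · rintro ⟨h1, h2⟩
    exact ⟨by linear_combination q * h2, fun _ => by linear_combination (-(-1) ^ (p + s)) * h1 - h⟩

theorem surv_two_succ (hq : q ≠ 0) {p s : ℕ} : Surv q 2 p (s + 1) ↔ Sq q p s := by
  have h := neg_one_pow_mul_self (k := k) (p + s)
  have e : (-1 : k) ^ (p + (s + 1)) = -(-1) ^ (p + s) := by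
    rw [show p + (s + 1) = p + s + 1 by omega, pow_succ]; ring
  simp only [Surv, e, Sq]
  constructor
  · rintro ⟨h1, h2⟩
    have h2 := h2 (by omega)
    refine ⟨mul_left_cancel₀ hq ?_, by linear_combination h2⟩
    linear_combination (-(-1) ^ (p + s)) * h1 + (q * q ^ s) * (-h)
  · rintro ⟨h1, h2⟩
    exact ⟨by linear_combination (-(-1) ^ (p + s)) * q * h1 - q * h,
      fun _ => by linear_combination h2⟩

theorem surv_three_succ (hq : q ≠ 0) {p s : ℕ} : Surv q 3 (p + 1) (s + 1) ↔ Sq q p s := by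
  have h := neg_one_pow_mul_self (k := k) (p + s)
  have e : (-1 : k) ^ (p + 1 + (s + 1)) = (-1) ^ (p + s) := by
    rw [show p + 1 + (s + 1) = p + s + 2 by omega, pow_add]; ring
  simp only [Surv, e, Sq]
  constructor
  · rintro ⟨h1, h2⟩
    have h1 := h1 (by omega)
    have h2 := h2 (by omega)
    refine ⟨mul_left_cancel₀ hq ?_, mul_left_cancel₀ hq (by linear_combination h1)⟩
    linear_combination (-(-1) ^ (p + s)) * h2 + (q * q ^ s) * (-h)
  · rintro ⟨h1, h2⟩
    exact ⟨fun _ => by linear_combination q * h2,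
      fun _ => by linear_combination (-(-1) ^ (p + s)) * q * h1 - q * h⟩

/-- Without letters `x` no arrow enters from `1`: the only condition left is the arrow of the
boundary piece. -/
theorem surv_one_zero {s : ℕ} : Surv q 1 0 s ↔ 1 + (-1) ^ s * q = 0 := by
  simp [Surv]

theorem surv_two_zero {p : ℕ} : Surv q 2 p 0 ↔ 1 + (-1) ^ p * q = 0 := by
  have h := neg_one_pow_mul_self (k := k) p
  simp only [Surv]
  constructor
  · rintro ⟨h1, -⟩
    simp only [add_zero, pow_zero, mul_one] at h1
    linear_combination (-1) ^ p * h1 - h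
  · intro h1
    refine ⟨?_, fun h => absurd h (by omega)⟩
    simp only [add_zero, pow_zero, mul_one]
    linear_combination (-1) ^ p * h1 - q * h

theorem surv_three_zero_zero : Surv q 3 0 0 := by
  simp [Surv]

theorem surv_three_zero_succ {s : ℕ} : Surv q 3 0 (s + 1) ↔ 1 + (-1) ^ s * q = 0 := by
  simp [Surv, pow_succ]

theorem surv_three_succ_zero {p : ℕ} : Surv q 3 (p + 1) 0 ↔ 1 + (-1) ^ p * q = 0 := by
  have h := neg_one_pow_mul_self (k := k) p
  simp only [Surv]
  constructor
  · rintro ⟨-, h1⟩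
    have h1 := h1 (by omega)
    simp only [add_zero, pow_zero, mul_one, pow_succ] at h1
    linear_combination (-1) ^ p * h1 - h
  · intro h1
    refine ⟨fun h => absurd h (by omega), fun _ => ?_⟩
    simp only [add_zero, pow_zero, mul_one, pow_succ]
    linear_combination (-1) ^ p * h1 - q * h

section Dimension

open Classical in
/-- The dimension of `HHⁿ(Λ_q)`. -/
theorem finrank_HH (hq : q ≠ 0) (n : ℕ) : Module.Finite k (HH k (Lam q) n) ∧
    Module.finrank k (HH k (Lam q) n) = ∑ m : Fin 4,
      ∑ t ∈ Finset.HasAntidiagonal.antidiagonal n, if Surv q m t.1 t.2 then 1 else 0 := by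
  obtain ⟨b, -⟩ := repBasis_survSet hq n
  let I : Finset (Fin 4 × ℕ × ℕ) :=
    (Finset.univ ×ˢ Finset.HasAntidiagonal.antidiagonal n).filter fun t => Surv q t.1 t.2.1 t.2.2
  have hI (t : Fin 4 × ℕ × ℕ) : t ∈ I ↔ t.2.1 + t.2.2 = n ∧ Surv q t.1 t.2.1 t.2.2 := by
    simp [I]
  let f : I → survSet q n := fun t =>
    ⟨eVec (mon q t.1.1) t.1.2.2, t.1.1, t.1.2.1, t.1.2.2, ((hI _).1 t.2).1, ((hI _).1 t.2).2, rfl⟩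
  have hf : Function.Bijective f := by
    constructor
    · rintro ⟨⟨m, p, s⟩, h⟩ ⟨⟨m', p', s'⟩, h'⟩ hee
      have h2 : eVec (mon q m) s = eVec (mon q m') s' := congrArg Subtype.val hee
      obtain ⟨rfl, rfl⟩ := eVec_mon_injective h2
      have e1 := ((hI _).1 h).1
      have e2 := ((hI _).1 h').1
      simp only at e1 e2
      obtain rfl : p = p' := by omega
      rfl
    · rintro ⟨v, m, p, s, hn, h, rfl⟩
      exact ⟨⟨(m, p, s), (hI _).2 ⟨hn, h⟩⟩, rfl⟩
  let e := Equiv.ofBijective f hf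
  have b' := b.reindex e.symm
  refine ⟨Module.Finite.of_basis b', ?_⟩
  rw [Module.finrank_eq_card_basis b', Fintype.card_coe, Finset.card_filter, Finset.sum_product]

/-- The power series `∑ X^(Nn)`. -/
noncomputable def geom (N : ℕ) : PowerSeries ℚ := PowerSeries.mk fun n => if N ∣ n then 1 else 0

theorem geom_mul {N : ℕ} (hN : 0 < N) : geom N * (1 - PowerSeries.X ^ N) = 1 := by
  ext n
  rw [mul_sub, mul_one, map_sub, PowerSeries.coeff_mul_X_pow', geom, PowerSeries.coeff_one]
  simp only [PowerSeries.coeff_mk]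
  by_cases h : N ≤ n
  · have h1 : N ∣ n - N ↔ N ∣ n := by
      obtain ⟨d, rfl⟩ := Nat.exists_eq_add_of_le h
      simp
    have h2 : n ≠ 0 := by omega
    simp [h, h1, h2]
  · rcases Nat.eq_zero_or_pos n with rfl | h0
    · simp [hN.ne']
    · have h1 : ¬ N ∣ n := fun h' => h (Nat.le_of_dvd h0 h')
      simp [h, h1, h0.ne']

open Classical in
variable (q) in
/-- The generating function of the squares all of whose arrows vanish. -/
noncomputable def sqSeries : PowerSeries ℚ := PowerSeries.mk fun n =>
  ∑ t ∈ Finset.HasAntidiagonal.antidiagonal n, if Sq q t.1 t.2 then 1 else 0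

open Classical in
variable (q) in
/-- The generating function of the boundary pieces whose arrow vanishes. -/
noncomputable def edgeSeries : PowerSeries ℚ := PowerSeries.mk fun n =>
  if 1 + (-1) ^ n * q = 0 then 1 else 0

/-- A surviving square has corners in degrees `n, n+1, n+1, n+2`, which accounts for `(1 + X)²`. A
boundary piece has its two ends in consecutive degrees, and there are two such pieces for each
degree. The isolated `1` is `yx e₀` in degree zero. -/
theorem hasHilbertSeries_of (hq : q ≠ 0) : HasHilbertSeries k (Lam q)
    (sqSeries q * (1 + PowerSeries.X) ^ 2 + 1 + 2 * edgeSeries q * (1 + PowerSeries.X)) := by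
  classical
  refine ⟨fun n => (finrank_HH hq n).1, ?_⟩
  let S : Fin 4 → PowerSeries ℚ := fun m => PowerSeries.mk fun n =>
    ∑ t ∈ Finset.HasAntidiagonal.antidiagonal n, if Surv q m t.1 t.2 then 1 else 0
  have hS : PowerSeries.mk (fun n => (Module.finrank k (HH k (Lam q) n) : ℚ)) =
      S 0 + S 1 + S 2 + S 3 := by
    ext n
    rw [PowerSeries.coeff_mk, (finrank_HH hq n).2]
    simp [S, Fin.sum_univ_four]
  have h0 : S 0 = sqSeries q := by
    simp only [S, sqSeries, surv_zero]
  have h1 : S 1 = edgeSeries q + PowerSeries.X * sqSeries q := by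
    ext n
    cases n with
    | zero =>
      simp only [S, edgeSeries, map_add, PowerSeries.coeff_mk, Finset.Nat.antidiagonal_zero,
        Finset.sum_singleton, surv_one_zero, PowerSeries.coeff_zero_X_mul, add_zero]
    | succ n =>
      rw [map_add, PowerSeries.coeff_succ_X_mul]
      simp only [S, edgeSeries, sqSeries, PowerSeries.coeff_mk, Finset.Nat.sum_antidiagonal_succ,
        surv_one_zero, surv_one_succ hq]
  have h2 : S 2 = edgeSeries q + PowerSeries.X * sqSeries q := by
    ext n
    cases n with
    | zero =>
      simp only [S, edgeSeries, map_add, PowerSeries.coeff_mk, Finset.Nat.antidiagonal_zero,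
        Finset.sum_singleton, surv_two_zero, PowerSeries.coeff_zero_X_mul, add_zero]
    | succ n =>
      rw [map_add, PowerSeries.coeff_succ_X_mul]
      simp only [S, edgeSeries, sqSeries, PowerSeries.coeff_mk, Finset.Nat.sum_antidiagonal_succ',
        surv_two_zero, surv_two_succ hq]
  have h3 : S 3 = 1 + 2 * (PowerSeries.X * edgeSeries q) +
      PowerSeries.X * (PowerSeries.X * sqSeries q) := by
    ext n
    rcases n with _ | _ | n
    · simp only [S, map_add, two_mul, PowerSeries.coeff_mk, Finset.Nat.antidiagonal_zero,
        Finset.sum_singleton, surv_three_zero_zero, PowerSeries.coeff_zero_X_mul,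
        PowerSeries.coeff_one, if_true, add_zero]
    · have e0 := surv_three_zero_succ (q := q) (s := 0)
      have e1 := surv_three_succ_zero (q := q) (p := 0)
      simp only [zero_add] at e0 e1
      simp only [map_add, two_mul, PowerSeries.coeff_one]
      simp only [zero_add, PowerSeries.coeff_succ_X_mul]
      simp only [S, edgeSeries, PowerSeries.coeff_mk, Finset.Nat.sum_antidiagonal_succ,
        Finset.Nat.antidiagonal_zero, Finset.sum_singleton, zero_add, e0, e1,
        PowerSeries.coeff_zero_X_mul, add_zero, one_ne_zero, if_false]
    · simp only [map_add, two_mul, PowerSeries.coeff_one]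
      simp only [PowerSeries.coeff_succ_X_mul]
      simp only [S, edgeSeries, sqSeries, PowerSeries.coeff_mk]
      rw [Finset.Nat.sum_antidiagonal_succ, Finset.Nat.sum_antidiagonal_succ']
      simp only [surv_three_zero_succ, surv_three_succ_zero, surv_three_succ hq]
      rw [if_neg (show ¬ n + 1 + 1 = 0 by omega)]
      ring
  rw [hS, h0, h1, h2, h3]
  ring

end Dimension

theorem subsingleton_of_repBasis_empty {n : ℕ} (h : RepBasis q n ∅) :
    Subsingleton (HH k (Lam q) n) := by
  obtain ⟨b, -⟩ := h
  exact b.repr.toEquiv.subsingleton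

theorem nontrivial_of_repBasis {n : ℕ} {S : Set (ℕ → Lam q)} (h : RepBasis q n S)
    (hS : S.Nonempty) : Nontrivial (HH k (Lam q) n) := by
  obtain ⟨b, -⟩ := h
  obtain ⟨v, hv⟩ := hS
  exact ⟨b ⟨v, hv⟩, 0, b.ne_zero _⟩

end QuantumPlane

/-! ### Which squares survive, according to `q` and the characteristic. -/

namespace QuantumPlane

universe u
variable {k : Type u} [Field k] {q : k}

theorem mem_survSet (hq : q ≠ 0) {n : ℕ} {v : ℕ → Lam q} : v ∈ survSet q n ↔
    (∃ p s, p + s = n ∧ Sq q p s ∧ v = eVec 1 s) ∨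
    (∃ p s, p + s + 1 = n ∧ Sq q p s ∧ (v = eVec (Lam.x q) s ∨ v = eVec (Lam.y q) (s + 1))) ∨
    (∃ p s, p + s + 2 = n ∧ Sq q p s ∧ v = eVec (Lam.y q * Lam.x q) (s + 1)) ∨
    (n = 0 ∧ v = eVec (Lam.y q * Lam.x q) 0) ∨
    (1 + (-1) ^ n * q = 0 ∧ (v = eVec (Lam.x q) n ∨ v = eVec (Lam.y q) 0)) ∨
    ∃ m, m + 1 = n ∧ 1 + (-1) ^ m * q = 0 ∧
      (v = eVec (Lam.y q * Lam.x q) n ∨ v = eVec (Lam.y q * Lam.x q) 0) := by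
  constructor
  · rintro ⟨m, p, s, rfl, h, rfl⟩
    fin_cases m
    · exact .inl ⟨p, s, rfl, surv_zero.1 h, rfl⟩
    · rcases p with _ | p
      · exact .inr (.inr (.inr (.inr (.inl ⟨by simpa using surv_one_zero.1 h, .inl (by simp; rfl)⟩))))
      · exact .inr (.inl ⟨p, s, by omega, (surv_one_succ hq).1 h, .inl rfl⟩)
    · rcases s with _ | s
      · exact .inr (.inr (.inr (.inr (.inl ⟨by simpa using surv_two_zero.1 h, .inr rfl⟩))))
      · exact .inr (.inl ⟨p, s, by omega, (surv_two_succ hq).1 h, .inr rfl⟩)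
    · rcases p with _ | p <;> rcases s with _ | s
      · exact .inr (.inr (.inr (.inl ⟨rfl, rfl⟩)))
      · exact .inr (.inr (.inr (.inr (.inr ⟨s, by omega, surv_three_zero_succ.1 h,
          .inl (by simp; rfl)⟩))))
      · exact .inr (.inr (.inr (.inr (.inr ⟨p, by omega, surv_three_succ_zero.1 h, .inr rfl⟩))))
      · exact .inr (.inr (.inl ⟨p, s, by omega, (surv_three_succ hq).1 h, rfl⟩))
  · rintro (⟨p, s, rfl, h, rfl⟩ | ⟨p, s, rfl, h, rfl | rfl⟩ | ⟨p, s, rfl, h, rfl⟩ | ⟨rfl, rfl⟩ |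
      ⟨h, rfl | rfl⟩ | ⟨m, rfl, h, rfl | rfl⟩)
    · exact ⟨0, p, s, rfl, surv_zero.2 h, rfl⟩
    · exact ⟨1, p + 1, s, by omega, (surv_one_succ hq).2 h, rfl⟩
    · exact ⟨2, p, s + 1, by omega, (surv_two_succ hq).2 h, rfl⟩
    · exact ⟨3, p + 1, s + 1, by omega, (surv_three_succ hq).2 h, rfl⟩
    · exact ⟨3, 0, 0, rfl, surv_three_zero_zero, rfl⟩
    · exact ⟨1, 0, n, by omega, surv_one_zero.2 h, rfl⟩
    · exact ⟨2, n, 0, by omega, surv_two_zero.2 h, rfl⟩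
    · exact ⟨3, 0, m + 1, by omega, surv_three_zero_succ.2 h, rfl⟩
    · exact ⟨3, m + 1, 0, by omega, surv_three_succ_zero.2 h, rfl⟩

theorem repBasis_of_iff (hq : q ≠ 0) {n : ℕ} {S : Set (ℕ → Lam q)}
    (h : ∀ v, v ∈ survSet q n ↔ v ∈ S) : RepBasis q n S := by
  rw [← Set.ext h]
  exact repBasis_survSet hq n

section Sparse

/-- The squares all of whose arrows vanish sit at the multiples of `r` in the degrees divisible by
`d * r ≥ 3`, and no arrow of a boundary piece vanishes. -/
structure Sparse (q : k) (d r : ℕ) : Prop where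
  ne_zero : q ≠ 0
  le : 3 ≤ d * r
  sq_iff : ∀ p s, Sq q p s ↔ ∃ c t, t ≤ d * c ∧ p + s = d * c * r ∧ s = t * r
  edge : ∀ n : ℕ, 1 + (-1) ^ n * q ≠ 0

variable {d r : ℕ}

theorem Sparse.mem_survSet (h : Sparse q d r) {n : ℕ} {v : ℕ → Lam q} : v ∈ survSet q n ↔
    (∃ c, n = d * c * r ∧ ∃ t ≤ d * c, v = eVec 1 (t * r)) ∨
    (∃ c, n = d * c * r + 1 ∧
      ∃ t ≤ d * c, v = eVec (Lam.x q) (t * r) ∨ v = eVec (Lam.y q) (t * r + 1)) ∨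
    (∃ c, n = d * c * r + 2 ∧ ∃ t ≤ d * c, v = eVec (Lam.y q * Lam.x q) (t * r + 1)) ∨
    (n = 0 ∧ v = eVec (Lam.y q * Lam.x q) 0) := by
  rw [QuantumPlane.mem_survSet h.ne_zero]
  have key (c t : ℕ) (ht : t ≤ d * c) : d * c * r - t * r + t * r = d * c * r :=
    Nat.sub_add_cancel (Nat.mul_le_mul_right r ht)
  constructor
  · rintro (⟨p, s, rfl, hs, rfl⟩ | ⟨p, s, rfl, hs, hv⟩ | ⟨p, s, rfl, hs, rfl⟩ | ⟨rfl, rfl⟩ |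
      ⟨h', -⟩ | ⟨m, rfl, h', -⟩)
    · obtain ⟨c, t, ht, e, rfl⟩ := (h.sq_iff _ _).1 hs
      exact .inl ⟨c, e, t, ht, rfl⟩
    · obtain ⟨c, t, ht, e, rfl⟩ := (h.sq_iff _ _).1 hs
      exact .inr (.inl ⟨c, by rw [e], t, ht, hv⟩)
    · obtain ⟨c, t, ht, e, rfl⟩ := (h.sq_iff _ _).1 hs
      exact .inr (.inr (.inl ⟨c, by rw [e], t, ht, rfl⟩))
    · exact .inr (.inr (.inr ⟨rfl, rfl⟩))
    · exact absurd h' (h.edge _)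
    · exact absurd h' (h.edge _)
  · rintro (⟨c, rfl, t, ht, rfl⟩ | ⟨c, rfl, t, ht, hv⟩ | ⟨c, rfl, t, ht, rfl⟩ | ⟨rfl, rfl⟩)
    · exact .inl ⟨_, t * r, key c t ht, (h.sq_iff _ _).2 ⟨c, t, ht, key c t ht, rfl⟩, rfl⟩
    · exact .inr (.inl ⟨_, t * r, by rw [key c t ht], (h.sq_iff _ _).2 ⟨c, t, ht, key c t ht, rfl⟩,
        hv⟩)
    · exact .inr (.inr (.inl ⟨_, t * r, by rw [key c t ht],
        (h.sq_iff _ _).2 ⟨c, t, ht, key c t ht, rfl⟩, rfl⟩))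
    · exact .inr (.inr (.inr (.inl ⟨rfl, rfl⟩)))

theorem Sparse.r_pos (h : Sparse q d r) : 0 < r :=
  Nat.pos_of_ne_zero fun e => by have := h.le; simp [e] at this

/-- As `d * r ≥ 3`, the numbers `i, j < 3` are remainders modulo `d * r`. Hence classes from
different corners or different values of `c` do not meet in one degree. -/
theorem Sparse.degree_unique (h : Sparse q d r) {c c' i j : ℕ} (hi : i < 3) (hj : j < 3)
    (e : d * c * r + i = d * c' * r + j) : c = c' ∧ i = j := by
  have hN := h.le
  rw [mul_right_comm, mul_right_comm d c'] at e
  set N := d * r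
  have hc : c = c' := by
    have h1 : (N * c + i) / N = c := by
      rw [Nat.mul_add_div (by omega), Nat.div_eq_of_lt (by omega), add_zero]
    have h2 : (N * c' + j) / N = c' := by
      rw [Nat.mul_add_div (by omega), Nat.div_eq_of_lt (by omega), add_zero]
    rw [← h1, ← h2, e]
  subst hc
  exact ⟨rfl, by omega⟩

theorem Sparse.mul_eq_zero (h : Sparse q d r) {c : ℕ} (hc : d * c * r = 0) : c = 0 :=
  (h.degree_unique (c' := 0) (i := 0) (j := 0) (by omega) (by omega) (by simpa using hc)).1

theorem Sparse.repBasis_zero (h : Sparse q d r) :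
    RepBasis q 0 {eVec 1 0, eVec (Lam.y q * Lam.x q) 0} := by
  refine repBasis_of_iff h.ne_zero fun v => h.mem_survSet.trans ⟨?_, ?_⟩
  · rintro (⟨c, hc, t, ht, rfl⟩ | ⟨c, hc, -⟩ | ⟨c, hc, -⟩ | ⟨-, rfl⟩)
    · obtain rfl := h.mul_eq_zero hc.symm
      obtain rfl : t = 0 := by simpa using ht
      left; simp
    · omega
    · omega
    · right; rfl
  · rintro (rfl | rfl)
    · exact .inl ⟨0, by simp, 0, by simp, by simp⟩
    · exact .inr (.inr (.inr ⟨rfl, rfl⟩))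

theorem Sparse.repBasis_one (h : Sparse q d r) {c : ℕ} (hc : 1 ≤ c) :
    RepBasis q (d * c * r) {v | ∃ t ≤ d * c, v = eVec 1 (t * r)} := by
  refine repBasis_of_iff h.ne_zero fun v => h.mem_survSet.trans ⟨?_, fun hv => .inl ⟨c, rfl, hv⟩⟩
  rintro (⟨c', e, hv⟩ | ⟨c', e, -⟩ | ⟨c', e, -⟩ | ⟨e, -⟩)
  · obtain ⟨rfl, -⟩ := h.degree_unique (i := 0) (j := 0) (by omega) (by omega) e
    exact hv
  · exact absurd (h.degree_unique (i := 0) (j := 1) (by omega) (by omega) e).2 (by omega)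
  · exact absurd (h.degree_unique (i := 0) (j := 2) (by omega) (by omega) e).2 (by omega)
  · exact absurd (h.mul_eq_zero e) (by omega)

theorem Sparse.repBasis_two (h : Sparse q d r) (c : ℕ) : RepBasis q (d * c * r + 1)
    {v | ∃ t ≤ d * c, v = eVec (Lam.x q) (t * r) ∨ v = eVec (Lam.y q) (t * r + 1)} := by
  refine repBasis_of_iff h.ne_zero fun v =>
    h.mem_survSet.trans ⟨?_, fun hv => .inr (.inl ⟨c, rfl, hv⟩)⟩
  rintro (⟨c', e, -⟩ | ⟨c', e, hv⟩ | ⟨c', e, -⟩ | ⟨e, -⟩)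
  · exact absurd (h.degree_unique (i := 1) (j := 0) (by omega) (by omega) e).2 (by omega)
  · obtain ⟨rfl, -⟩ := h.degree_unique (i := 1) (j := 1) (by omega) (by omega) e
    exact hv
  · exact absurd (h.degree_unique (i := 1) (j := 2) (by omega) (by omega) e).2 (by omega)
  · omega

theorem Sparse.repBasis_three (h : Sparse q d r) (c : ℕ) : RepBasis q (d * c * r + 2)
    {v | ∃ t ≤ d * c, v = eVec (Lam.y q * Lam.x q) (t * r + 1)} := by
  refine repBasis_of_iff h.ne_zero fun v =>
    h.mem_survSet.trans ⟨?_, fun hv => .inr (.inr (.inl ⟨c, rfl, hv⟩))⟩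
  rintro (⟨c', e, -⟩ | ⟨c', e, -⟩ | ⟨c', e, hv⟩ | ⟨e, -⟩)
  · exact absurd (h.degree_unique (i := 2) (j := 0) (by omega) (by omega) e).2 (by omega)
  · exact absurd (h.degree_unique (i := 2) (j := 1) (by omega) (by omega) e).2 (by omega)
  · obtain ⟨rfl, -⟩ := h.degree_unique (i := 2) (j := 2) (by omega) (by omega) e
    exact hv
  · omega

theorem Sparse.repBasis_empty (h : Sparse q d r) {n : ℕ} (hn : 2 < n)
    (hc : ∀ c, n ≠ d * c * r ∧ n ≠ d * c * r + 1 ∧ n ≠ d * c * r + 2) : RepBasis q n ∅ := by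
  refine repBasis_of_iff h.ne_zero fun v => h.mem_survSet.trans ⟨?_, False.elim⟩
  rintro (⟨c', e, -⟩ | ⟨c', e, -⟩ | ⟨c', e, -⟩ | ⟨e, -⟩)
  · exact (hc c').1 e
  · exact (hc c').2.1 e
  · exact (hc c').2.2 e
  · omega

/-- The surviving squares other than that at the origin start in degree `d * r` at the earliest, and
in that degree there is one. -/
theorem Sparse.firstNonzeroFromThree (h : Sparse q d r) :
    FirstNonzeroFromThree k (Lam q) (d * r) := by
  refine ⟨h.le, fun n h3 hn => subsingleton_of_repBasis_empty (h.repBasis_empty (by omega) ?_), ?_⟩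
  · intro c
    rcases Nat.eq_zero_or_pos c with rfl | hc
    · simp; omega
    · have : d * r ≤ d * c * r := by
        rw [mul_right_comm]
        exact Nat.le_mul_of_pos_right _ hc
      omega
  · have := h.repBasis_one le_rfl
    rw [mul_one] at this
    exact nontrivial_of_repBasis this ⟨_, 0, by simp, rfl⟩

theorem Sparse.edgeSeries_eq_zero (h : Sparse q d r) : edgeSeries q = 0 := by
  ext n
  simp [edgeSeries, h.edge n]

end Sparse

section Classification

theorem neg_one_pow_eq_one_iff_even' (h2 : ringChar k ≠ 2) (n : ℕ) :
    (-1 : k) ^ n = 1 ↔ Even n :=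
  neg_one_pow_eq_one_iff_even (Ring.neg_one_ne_one_of_char_ne_two h2)

theorem neg_one_eq_one (h2 : ringChar k = 2) : (-1 : k) = 1 := by
  have := ringChar.of_eq h2
  exact CharTwo.neg_eq 1

variable {r : ℕ}

theorem one_add_neg_one_pow_mul_ne_zero (h1 : q ≠ 1) (h2 : q ≠ -1) (n : ℕ) :
    1 + (-1) ^ n * q ≠ 0 := by
  rcases neg_one_pow_eq_or k n with e | e <;> rw [e]
  · intro h'
    exact h2 (by linear_combination h')
  · intro h'
    exact h1 (by linear_combination -h')

/-- From `q^(2s) = 1` and `r` odd one gets `r ∣ s`, and likewise `r ∣ p`. Then `q^s = 1`, so the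
sign is trivial and `p + s` is even; as `r` is odd, it is a multiple of `2r`, whence `d = 2`. -/
theorem sparse_of_odd (h : IsPrimitiveRoot q r) (h1 : 1 < r) (ho : Odd r) (h2 : ringChar k ≠ 2) :
    Sparse q 2 r where
  ne_zero := h.ne_zero (by omega)
  le := by omega
  sq_iff p s := by
    constructor
    · rintro ⟨hs, hp⟩
      have hd (n : ℕ) (hn : q ^ n = (-1) ^ (p + s)) : r ∣ n := by
        have : q ^ (2 * n) = 1 := by
          rw [mul_comm, pow_mul, hn, ← pow_mul, mul_comm, pow_mul]; simp
        exact (Nat.Coprime.dvd_mul_left (ho.coprime_two_right)).1 (h.dvd_of_pow_eq_one _ this)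
      obtain ⟨t, rfl⟩ := hd s hs
      obtain ⟨a, rfl⟩ := hd p hp
      have he : Even (r * a + r * t) := by
        rw [← neg_one_pow_eq_one_iff_even' h2, ← hs, pow_mul, h.pow_eq_one, one_pow]
      rw [← mul_add, Nat.even_mul] at he
      obtain ⟨c, hc⟩ := he.resolve_left (Nat.not_even_iff_odd.2 ho)
      exact ⟨c, t, by omega, by rw [← mul_add, hc]; ring, by ring⟩
    · rintro ⟨c, t, ht, e, rfl⟩
      have hs : q ^ (t * r) = 1 := by rw [mul_comm, pow_mul, h.pow_eq_one, one_pow]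
      have hps : q ^ (p + t * r) = 1 := by rw [e, mul_comm, pow_mul, h.pow_eq_one, one_pow]
      have hp : q ^ p = 1 := by rwa [pow_add, hs, mul_one] at hps
      have e1 : (-1 : k) ^ (p + t * r) = 1 := by rw [e, mul_assoc, pow_mul]; simp
      exact ⟨by rw [hs, e1], by rw [hp, e1]⟩
  edge := one_add_neg_one_pow_mul_ne_zero (fun e => by
      subst e; have := h.dvd_of_pow_eq_one 1 (by simp); have := Nat.le_of_dvd one_pos this; omega)
    (fun e => by
      subst e
      have := h.dvd_of_pow_eq_one 2 (by simp)
      have := Nat.le_of_dvd two_pos this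
      obtain rfl : r = 2 := by omega
      exact absurd ho (by decide))

/-- In characteristic `2` there are no signs. Otherwise `q^(p+s)` is the square of a sign, so `r ∣ p
+ s`; as `r` is even, the sign is `1`, and `r` divides both `p` and `s`. -/
theorem sparse_of_even (hr : 0 < r) (h : IsPrimitiveRoot q r)
    (hc : (ringChar k = 2 ∧ q ≠ 1) ∨ (ringChar k ≠ 2 ∧ 2 < r ∧ Even r)) : Sparse q 1 r := by
  have h1 : q ≠ 1 := by
    rcases hc with ⟨-, h1⟩ | ⟨-, h1, -⟩
    · exact h1
    · rintro rfl
      have := Nat.le_of_dvd one_pos (h.dvd_of_pow_eq_one 1 (by simp))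
      omega
  have hm1 : q ≠ -1 := by
    rcases hc with ⟨h2, h1⟩ | ⟨-, h1, -⟩
    · rwa [neg_one_eq_one h2]
    · rintro rfl
      have := Nat.le_of_dvd two_pos (h.dvd_of_pow_eq_one 2 (by simp))
      omega
  have h3 : 3 ≤ r := by
    by_contra h3
    rcases (by omega : r = 1 ∨ r = 2) with rfl | rfl
    · exact h1 (by simpa using h.pow_eq_one)
    · rcases sq_eq_one_iff.1 h.pow_eq_one with e | e
      exacts [h1 e, hm1 e]
  have hiff (p s : ℕ) : Sq q p s ↔ r ∣ p ∧ r ∣ s := by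
    rcases hc with ⟨h2, -⟩ | ⟨h2, -, he⟩
    · rw [Sq, neg_one_eq_one h2, one_pow, h.pow_eq_one_iff_dvd, h.pow_eq_one_iff_dvd, and_comm]
    · constructor
      · rintro ⟨hs, hp⟩
        have hps : q ^ (p + s) = 1 := by
          rw [pow_add, hs, hp, neg_one_pow_mul_self]
        have e1 : (-1 : k) ^ (p + s) = 1 := (neg_one_pow_eq_one_iff_even' h2 _).2
          (he.trans_dvd (h.dvd_of_pow_eq_one _ hps))
        rw [e1] at hs hp
        exact ⟨h.dvd_of_pow_eq_one _ hp, h.dvd_of_pow_eq_one _ hs⟩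
      · rintro ⟨hp, hs⟩
        have e1 : (-1 : k) ^ (p + s) = 1 := (neg_one_pow_eq_one_iff_even' h2 _).2
          (he.trans_dvd (dvd_add hp hs))
        rw [Sq, e1]
        exact ⟨(h.pow_eq_one_iff_dvd _).2 hs, (h.pow_eq_one_iff_dvd _).2 hp⟩
  refine ⟨h.ne_zero (by omega), by omega, fun p s => (hiff p s).trans ⟨?_, ?_⟩,
    one_add_neg_one_pow_mul_ne_zero h1 hm1⟩
  · rintro ⟨⟨a, rfl⟩, t, rfl⟩
    exact ⟨a + t, t, by omega, by ring, by ring⟩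
  · rintro ⟨c, t, -, e, rfl⟩
    refine ⟨(Nat.dvd_add_left (dvd_mul_left r t)).1 (e ▸ dvd_mul_left r _), dvd_mul_left r t⟩

theorem sq_of_char_two (h2 : ringChar k = 2) (p s : ℕ) : Sq (1 : k) p s := by
  simp [Sq, neg_one_eq_one h2]

theorem sq_neg_one_iff (h2 : ringChar k ≠ 2) {p s : ℕ} : Sq (-1 : k) p s ↔ Even p ∧ Even s := by
  have h1 := neg_one_pow_eq_one_iff_even' h2
  constructor
  · rintro ⟨hs, hp⟩
    have e (n : ℕ) : (-1 : k) ^ n ≠ 0 := pow_ne_zero _ (by simp)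
    rw [pow_add] at hs hp
    refine ⟨(h1 _).1 ?_, (h1 _).1 ?_⟩
    · exact mul_right_cancel₀ (e s) (by rw [one_mul, ← hs])
    · exact mul_left_cancel₀ (e p) (by rw [mul_one, ← hp])
  · rintro ⟨hp, hs⟩
    rw [Sq, (h1 _).2 hp, (h1 _).2 hs, (h1 _).2 (hp.add hs)]
    simp

theorem edge_neg_one_iff (h2 : ringChar k ≠ 2) {n : ℕ} : 1 + (-1) ^ n * (-1 : k) = 0 ↔ Even n := by
  rw [← neg_one_pow_eq_one_iff_even' h2]
  constructor <;> intro h <;> linear_combination -h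

theorem sq_one_iff (h2 : ringChar k ≠ 2) {p s : ℕ} : Sq (1 : k) p s ↔ Even (p + s) := by
  rw [Sq, one_pow, one_pow, and_self_iff, eq_comm, neg_one_pow_eq_one_iff_even' h2]

theorem edge_one_iff (h2 : ringChar k ≠ 2) {n : ℕ} : 1 + (-1) ^ n * (1 : k) = 0 ↔ Odd n := by
  rw [← Nat.not_even_iff_odd, ← neg_one_pow_eq_one_iff_even' h2]
  have h3 : (2 : k) ≠ 0 := Ring.two_ne_zero h2
  rcases neg_one_pow_eq_or k n with e | e <;> rw [e]
  · simp [one_add_one_eq_two, h3]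
  · simpa using Ring.neg_one_ne_one_of_char_ne_two h2

theorem surv_of_char_two (h2 : ringChar k = 2) (m : Fin 4) (p s : ℕ) : Surv (1 : k) m p s := by
  have h3 : (1 + 1 : k) = 0 := by
    have := neg_one_eq_one h2
    linear_combination -this
  fin_cases m <;> simp [Surv, neg_one_eq_one h2, h3]

/-- For `q = 1` every arrow is `0` or `±2`, depending on the parity of the degree alone. -/
theorem surv_one_iff (h2 : ringChar k ≠ 2) {m : Fin 4} {p s : ℕ} :
    Surv (1 : k) m p s ↔ Even (p + s + (if m = 1 ∨ m = 2 then 1 else 0)) := by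
  have hq : (1 : k) ≠ 0 := one_ne_zero
  fin_cases m
  · simpa using surv_zero.trans (sq_one_iff h2)
  · rcases p with _ | p
    · simpa using surv_one_zero.trans (by rw [edge_one_iff h2, Nat.even_add_one, Nat.not_even_iff_odd])
    · refine (surv_one_succ hq).trans ((sq_one_iff h2).trans ?_)
      simp only [Fin.mk_one, true_or, if_true]
      grind
  · rcases s with _ | s
    · simpa using surv_two_zero.trans (by rw [edge_one_iff h2, Nat.even_add_one, Nat.not_even_iff_odd])
    · refine (surv_two_succ hq).trans ((sq_one_iff h2).trans ?_)
      simp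
      grind
  · rcases p with _ | p <;> rcases s with _ | s
    · simpa using surv_three_zero_zero
    · refine surv_three_zero_succ.trans ((edge_one_iff h2).trans ?_)
      simp
      grind
    · refine surv_three_succ_zero.trans ((edge_one_iff h2).trans ?_)
      simp
      grind
    · refine (surv_three_succ hq).trans ((sq_one_iff h2).trans ?_)
      simp
      grind

end Classification

end QuantumPlane

/-! ### Hilbert series and bases in the individual cases. -/

namespace QuantumPlane

universe u
variable {k : Type u} [Field k] {q : k}

section Series

open PowerSeries

theorem geom_sq_eq_inv {N : ℕ} (hN : 0 < N) : geom N ^ 2 = ((1 - X ^ N) ^ 2)⁻¹ := by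
  rw [PowerSeries.eq_inv_iff_mul_eq_one, ← mul_pow, geom_mul hN, one_pow]
  simp [hN.ne']

theorem geom_eq_mul_geom {r : ℕ} (hr : 0 < r) : geom r = (1 + X ^ r) * geom (2 * r) := by
  have h1 := geom_mul hr
  have h2 := geom_mul (N := 2 * r) (by omega)
  rw [mul_comm 2 r, pow_mul, mul_comm r 2] at h2
  linear_combination -geom r * h2 + (1 + X ^ r) * geom (2 * r) * h1

theorem sqSeries_eq_geom_sq {r : ℕ} (h : ∀ p s, Sq q p s ↔ r ∣ p ∧ r ∣ s) :
    sqSeries q = geom r ^ 2 := by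
  classical
  ext n
  rw [sq, PowerSeries.coeff_mul, sqSeries, PowerSeries.coeff_mk]
  refine Finset.sum_congr rfl fun t _ => ?_
  simp only [geom, PowerSeries.coeff_mk, h]
  by_cases h1 : r ∣ t.1 <;> by_cases h2 : r ∣ t.2 <;> simp [h1, h2]

/-- The quotients `p/r` and `s/r` are both even or both odd, and `geom r - geom (2 * r)` enumerates
the odd multiples of `r`. -/
theorem sqSeries_eq_geom_sq_add {r : ℕ}
    (h : ∀ p s, Sq q p s ↔ r ∣ p ∧ r ∣ s ∧ (2 * r ∣ p ↔ 2 * r ∣ s)) :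
    sqSeries q = geom (2 * r) ^ 2 + (geom r - geom (2 * r)) ^ 2 := by
  classical
  ext n
  rw [sq, sq, map_add, PowerSeries.coeff_mul, PowerSeries.coeff_mul, sqSeries, PowerSeries.coeff_mk,
    ← Finset.sum_add_distrib]
  refine Finset.sum_congr rfl fun t _ => ?_
  simp only [geom, PowerSeries.coeff_mk, map_sub, h]
  have a1 : 2 * r ∣ t.1 → r ∣ t.1 := (dvd_mul_left r 2).trans
  have a2 : 2 * r ∣ t.2 → r ∣ t.2 := (dvd_mul_left r 2).trans
  by_cases h1 : r ∣ t.1 <;> by_cases h2 : r ∣ t.2 <;> by_cases h3 : 2 * r ∣ t.1 <;>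
    by_cases h4 : 2 * r ∣ t.2 <;> simp_all

theorem Sparse.hasHilbertSeries_one {r : ℕ} (h : Sparse q 1 r) : HasHilbertSeries k (Lam q)
    (1 + (1 + X) ^ 2 * ((1 - X ^ r) ^ 2)⁻¹) := by
  have h1 := hasHilbertSeries_of h.ne_zero
  rw [h.edgeSeries_eq_zero, sqSeries_eq_geom_sq (r := r), geom_sq_eq_inv h.r_pos] at h1
  · convert h1 using 1
    ring
  · intro p s
    rw [h.sq_iff]
    constructor
    · rintro ⟨c, t, -, e, rfl⟩
      exact ⟨(Nat.dvd_add_left (dvd_mul_left r t)).1 (e ▸ dvd_mul_left r _), dvd_mul_left r t⟩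
    · rintro ⟨⟨a, rfl⟩, t, rfl⟩
      exact ⟨a + t, t, by omega, by ring, by ring⟩

theorem Sparse.hasHilbertSeries_two {r : ℕ} (h : Sparse q 2 r) : HasHilbertSeries k (Lam q)
    (1 + (1 + X) ^ 2 * (1 + X ^ (2 * r)) * ((1 - X ^ (2 * r)) ^ 2)⁻¹) := by
  have hr := h.r_pos
  have h1 := hasHilbertSeries_of h.ne_zero
  rw [h.edgeSeries_eq_zero, sqSeries_eq_geom_sq_add (r := r), geom_eq_mul_geom h.r_pos] at h1
  · rw [← geom_sq_eq_inv (by omega)]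
    convert h1 using 1
    ring
  · intro p s
    rw [h.sq_iff]
    constructor
    · rintro ⟨c, t, -, e, rfl⟩
      have h2 : 2 * r ∣ p + t * r := by rw [e, mul_right_comm]; exact dvd_mul_right _ _
      exact ⟨(Nat.dvd_add_left (dvd_mul_left r t)).1 ((dvd_mul_left r 2).trans h2),
        dvd_mul_left r t, fun h3 => (Nat.dvd_add_right h3).1 h2, fun h3 => (Nat.dvd_add_left h3).1 h2⟩
    · rintro ⟨⟨a, rfl⟩, ⟨t, rfl⟩, h2⟩
      rw [mul_comm r, mul_comm r, Nat.mul_dvd_mul_iff_right hr, Nat.mul_dvd_mul_iff_right hr] at h2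
      obtain ⟨c, hc⟩ : 2 ∣ a + t := by omega
      exact ⟨c, t, by omega, by rw [← mul_add, hc, mul_comm], by ring⟩

theorem hasHilbertSeries_one_of_char_two (h2 : ringChar k = 2) :
    HasHilbertSeries k (Lam (1 : k)) (4 * ((1 - X) ^ 2)⁻¹) := by
  have h1 := hasHilbertSeries_of (one_ne_zero (α := k))
  have he : edgeSeries (1 : k) = geom 1 := by
    have := surv_one_zero.1 (surv_of_char_two h2 1 0 0)
    ext n
    simp_all [edgeSeries, geom, neg_one_eq_one h2]
  rw [he, sqSeries_eq_geom_sq (r := 1) (by simp [sq_of_char_two h2])] at h1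
  have e1 := geom_mul one_pos
  have e2 := geom_sq_eq_inv one_pos
  rw [pow_one] at e1 e2
  rw [← e2]
  convert h1 using 1
  linear_combination (1 + geom 1 * (X + 3)) * e1

theorem hasHilbertSeries_neg_one (h2 : ringChar k ≠ 2) :
    HasHilbertSeries k (Lam (-1 : k)) ((4 - 4 * X + X ^ 2) * ((1 - X) ^ 2)⁻¹) := by
  have h1 := hasHilbertSeries_of (neg_ne_zero.2 (one_ne_zero (α := k)))
  have he : edgeSeries (-1 : k) = geom 2 := by
    ext n
    simp only [edgeSeries, geom, edge_neg_one_iff h2, even_iff_two_dvd]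
  rw [he, sqSeries_eq_geom_sq (r := 2) fun p s => by
    rw [sq_neg_one_iff h2, even_iff_two_dvd, even_iff_two_dvd]] at h1
  have e1 := geom_mul one_pos
  have e2 := geom_sq_eq_inv one_pos
  have e3 := geom_eq_mul_geom one_pos
  rw [pow_one] at e1 e2 e3
  rw [mul_one] at e3
  rw [← e2]
  convert h1 using 1
  linear_combination (1 + (3 - X) * geom 1) * e1 + ((1 + X) * geom 2 + geom 1 + 2) * e3

theorem hasHilbertSeries_one (h2 : ringChar k ≠ 2) :
    HasHilbertSeries k (Lam (1 : k)) (2 * ((1 - X) ^ 2)⁻¹) := by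
  have h1 := hasHilbertSeries_of (one_ne_zero (α := k))
  have he : edgeSeries (1 : k) = geom 1 - geom 2 := by
    ext n
    simp only [edgeSeries, geom, edge_one_iff h2, map_sub, PowerSeries.coeff_mk, one_dvd, if_true,
      ← Nat.not_even_iff_odd, even_iff_two_dvd]
    by_cases h : 2 ∣ n <;> simp [h]
  rw [he, sqSeries_eq_geom_sq_add (r := 1) fun p s => by
    rw [sq_one_iff h2, Nat.even_add, even_iff_two_dvd, even_iff_two_dvd]; simp] at h1
  have e1 := geom_mul two_pos
  have e2 := geom_sq_eq_inv one_pos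
  have e3 := geom_eq_mul_geom one_pos
  rw [pow_one] at e2 e3
  rw [mul_one] at e3 h1
  rw [← e2]
  convert h1 using 1
  rw [e3]
  linear_combination (1 + geom 2 * (1 + X) ^ 2) * e1

end Series

theorem repBasis_one_of_char_two (h2 : ringChar k = 2) (n : ℕ) : RepBasis (1 : k) n
    {v | ∃ j ≤ n, v = eVec 1 j ∨ v = eVec (Lam.x (1 : k)) j ∨ v = eVec (Lam.y (1 : k)) j ∨
      v = eVec (Lam.y (1 : k) * Lam.x (1 : k)) j} := by
  refine repBasis_of_iff one_ne_zero fun v => ⟨?_, ?_⟩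
  · rintro ⟨m, p, s, hn, -, rfl⟩
    refine ⟨s, by omega, ?_⟩
    fin_cases m <;> simp [mon]
  · rintro ⟨j, hj, h⟩
    obtain ⟨p, rfl⟩ := Nat.exists_eq_add_of_le' hj
    rcases h with rfl | rfl | rfl | rfl
    exacts [⟨0, p, j, rfl, surv_of_char_two h2 _ _ _, rfl⟩,
      ⟨1, p, j, rfl, surv_of_char_two h2 _ _ _, rfl⟩,
      ⟨2, p, j, rfl, surv_of_char_two h2 _ _ _, rfl⟩, ⟨3, p, j, rfl, surv_of_char_two h2 _ _ _, rfl⟩]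

theorem repBasis_one_of_even (h2 : ringChar k ≠ 2) {n : ℕ} (hn : Even n) : RepBasis (1 : k) n
    {v | ∃ j ≤ n, v = eVec 1 j ∨ v = eVec (Lam.y (1 : k) * Lam.x (1 : k)) j} := by
  refine repBasis_of_iff one_ne_zero fun v => ⟨?_, ?_⟩
  · rintro ⟨m, p, s, rfl, h, rfl⟩
    refine ⟨s, by omega, ?_⟩
    rw [surv_one_iff h2] at h
    fin_cases m
    · exact .inl rfl
    · simp [Nat.even_add_one, hn] at h
    · simp [Nat.even_add_one, hn] at h
    · exact .inr rfl
  · rintro ⟨j, hj, h⟩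
    obtain ⟨p, rfl⟩ := Nat.exists_eq_add_of_le' hj
    rcases h with rfl | rfl
    exacts [⟨0, p, j, rfl, (surv_one_iff h2).2 (by simpa using hn), rfl⟩,
      ⟨3, p, j, rfl, (surv_one_iff h2).2 (by simpa using hn), rfl⟩]

theorem repBasis_one_of_odd (h2 : ringChar k ≠ 2) {n : ℕ} (hn : Odd n) : RepBasis (1 : k) n
    {v | ∃ j ≤ n, v = eVec (Lam.x (1 : k)) j ∨ v = eVec (Lam.y (1 : k)) j} := by
  rw [← Nat.not_even_iff_odd] at hn
  refine repBasis_of_iff one_ne_zero fun v => ⟨?_, ?_⟩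
  · rintro ⟨m, p, s, rfl, h, rfl⟩
    refine ⟨s, by omega, ?_⟩
    rw [surv_one_iff h2] at h
    fin_cases m
    · exact absurd (by simpa using h) hn
    · exact .inl rfl
    · exact .inr rfl
    · exact absurd (by simpa using h) hn
  · rintro ⟨j, hj, h⟩
    obtain ⟨p, rfl⟩ := Nat.exists_eq_add_of_le' hj
    rcases h with rfl | rfl
    exacts [⟨1, p, j, rfl, (surv_one_iff h2).2 (by simpa [Nat.even_add_one] using hn), rfl⟩,
      ⟨2, p, j, rfl, (surv_one_iff h2).2 (by simpa [Nat.even_add_one] using hn), rfl⟩]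

theorem mem_survSet_neg_one (h2 : ringChar k ≠ 2) {n : ℕ} {v : ℕ → Lam (-1 : k)} :
    v ∈ survSet (-1 : k) n ↔
    (∃ a b, 2 * a + 2 * b = n ∧ v = eVec 1 (2 * b)) ∨
    (∃ a b, 2 * a + 2 * b + 1 = n ∧ (v = eVec (Lam.x _) (2 * b) ∨ v = eVec (Lam.y _) (2 * b + 1))) ∨
    (∃ a b, 2 * a + 2 * b + 2 = n ∧ v = eVec (Lam.y _ * Lam.x _) (2 * b + 1)) ∨
    (n = 0 ∧ v = eVec (Lam.y _ * Lam.x _) 0) ∨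
    (Even n ∧ (v = eVec (Lam.x _) n ∨ v = eVec (Lam.y _) 0)) ∨
    (Odd n ∧ (v = eVec (Lam.y _ * Lam.x _) n ∨ v = eVec (Lam.y _ * Lam.x _) 0)) := by
  rw [mem_survSet (neg_ne_zero.2 one_ne_zero)]
  simp only [sq_neg_one_iff h2, edge_neg_one_iff h2, even_iff_exists_two_mul]
  refine or_congr ⟨?_, ?_⟩ (or_congr ⟨?_, ?_⟩ (or_congr ⟨?_, ?_⟩ (or_congr Iff.rfl
    (or_congr Iff.rfl ⟨?_, ?_⟩))))
  · rintro ⟨_, _, hn, ⟨⟨a, rfl⟩, b, rfl⟩, hv⟩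
    exact ⟨a, b, hn, hv⟩
  · rintro ⟨a, b, hn, hv⟩
    exact ⟨_, _, hn, ⟨⟨a, rfl⟩, b, rfl⟩, hv⟩
  · rintro ⟨_, _, hn, ⟨⟨a, rfl⟩, b, rfl⟩, hv⟩
    exact ⟨a, b, hn, hv⟩
  · rintro ⟨a, b, hn, hv⟩
    exact ⟨_, _, hn, ⟨⟨a, rfl⟩, b, rfl⟩, hv⟩
  · rintro ⟨_, _, hn, ⟨⟨a, rfl⟩, b, rfl⟩, hv⟩
    exact ⟨a, b, hn, hv⟩
  · rintro ⟨a, b, hn, hv⟩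
    exact ⟨_, _, hn, ⟨⟨a, rfl⟩, b, rfl⟩, hv⟩
  · rintro ⟨_, rfl, ⟨a, rfl⟩, hv⟩
    exact ⟨⟨a, rfl⟩, hv⟩
  · rintro ⟨⟨a, rfl⟩, hv⟩
    exact ⟨_, rfl, ⟨a, rfl⟩, hv⟩

theorem repBasis_neg_one_zero (h2 : ringChar k ≠ 2) : RepBasis (-1 : k) 0
    {eVec 1 0, eVec (Lam.x (-1 : k)) 0, eVec (Lam.y (-1 : k)) 0,
      eVec (Lam.y (-1 : k) * Lam.x (-1 : k)) 0} := by
  refine repBasis_of_iff (neg_ne_zero.2 one_ne_zero) fun v => (mem_survSet_neg_one h2).trans ?_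
  simp only [Set.mem_insert_iff, Set.mem_singleton_iff]
  constructor
  · rintro (⟨a, b, hn, rfl⟩ | ⟨a, b, hn, -⟩ | ⟨a, b, hn, -⟩ | ⟨-, rfl⟩ | ⟨-, rfl | rfl⟩ | ⟨hn, -⟩)
    · obtain rfl : b = 0 := by omega
      simp
    · omega
    · omega
    · simp
    · simp
    · simp
    · exact absurd hn (by decide)
  · rintro (rfl | rfl | rfl | rfl)
    · exact .inl ⟨0, 0, rfl, rfl⟩
    · simp
    · simp
    · simp

theorem repBasis_neg_one_even (h2 : ringChar k ≠ 2) {m : ℕ} (hm : 1 ≤ m) : RepBasis (-1 : k) (2 * m)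
    ({v | ∃ t ≤ m, v = eVec 1 (2 * t)} ∪ {eVec (Lam.y (-1 : k)) 0, eVec (Lam.x (-1 : k)) (2 * m)} ∪
      {v | ∃ t < m, v = eVec (Lam.y (-1 : k) * Lam.x (-1 : k)) (2 * t + 1)}) := by
  refine repBasis_of_iff (neg_ne_zero.2 one_ne_zero) fun v => (mem_survSet_neg_one h2).trans ?_
  simp only [Set.mem_insert_iff, Set.mem_singleton_iff, Set.mem_union, Set.mem_ofPred_eq]
  constructor
  · rintro (⟨a, b, hn, rfl⟩ | ⟨a, b, hn, -⟩ | ⟨a, b, hn, rfl⟩ | ⟨hn, rfl⟩ | ⟨-, rfl | rfl⟩ | ⟨hn, -⟩)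
    · exact .inl (.inl ⟨b, by omega, rfl⟩)
    · omega
    · exact .inr ⟨b, by omega, rfl⟩
    · omega
    · simp
    · simp
    · obtain ⟨a, ha⟩ := hn; omega
  · rintro ((⟨t, ht, rfl⟩ | rfl | rfl) | ⟨t, ht, rfl⟩)
    · exact .inl ⟨m - t, t, by omega, rfl⟩
    · simp
    · simp
    · exact .inr (.inr (.inl ⟨m - t - 1, t, by omega, rfl⟩))

theorem repBasis_neg_one_odd (h2 : ringChar k ≠ 2) (m : ℕ) : RepBasis (-1 : k) (2 * m + 1)
    ({v | ∃ t ≤ m, v = eVec (Lam.x (-1 : k)) (2 * t) ∨ v = eVec (Lam.y (-1 : k)) (2 * t + 1)} ∪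
      {eVec (Lam.y (-1 : k) * Lam.x (-1 : k)) 0,
        eVec (Lam.y (-1 : k) * Lam.x (-1 : k)) (2 * m + 1)}) := by
  refine repBasis_of_iff (neg_ne_zero.2 one_ne_zero) fun v => (mem_survSet_neg_one h2).trans ?_
  simp only [Set.mem_insert_iff, Set.mem_singleton_iff, Set.mem_union, Set.mem_ofPred_eq]
  constructor
  · rintro (⟨a, b, hn, rfl⟩ | ⟨a, b, hn, hv⟩ | ⟨a, b, hn, rfl⟩ | ⟨hn, rfl⟩ | ⟨hn, -⟩ |
      ⟨-, rfl | rfl⟩)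
    · omega
    · exact .inl ⟨b, by omega, hv⟩
    · omega
    · omega
    · simp at hn
    · simp
    · simp
  · rintro (⟨t, ht, hv⟩ | rfl | rfl)
    · exact .inr (.inl ⟨m - t, t, by omega, hv⟩)
    · simp
    · simp

theorem exists_firstNonzeroFromThree
    (h : ∀ r : ℕ, (r : k) ≠ 0 → ∃ ζ : k, IsPrimitiveRoot ζ r) (M : ℕ) :
    ∃ (r : ℕ) (q : k) (N : ℕ), 0 < r ∧ IsPrimitiveRoot q r ∧ M < N ∧
      FirstNonzeroFromThree k (Lam q) N := by
  -- Of the consecutive integers `M + 3` and `M + 4` at least one is nonzero in `k`.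
  obtain ⟨r, hr, hk⟩ : ∃ r, M + 3 ≤ r ∧ (r : k) ≠ 0 := by
    by_cases h0 : ((M + 3 : ℕ) : k) = 0
    · refine ⟨M + 3 + 1, by omega, ?_⟩
      rw [Nat.cast_succ, h0, zero_add]
      exact one_ne_zero
    · exact ⟨_, le_rfl, h0⟩
  obtain ⟨q, hq⟩ := h r hk
  have hq1 : q ≠ 1 := by
    rintro rfl
    have := Nat.le_of_dvd one_pos (hq.dvd_of_pow_eq_one 1 (by simp))
    omega
  by_cases h2 : ringChar k = 2
  · exact ⟨r, q, _, by omega, hq, by omega,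
      (sparse_of_even (by omega) hq (.inl ⟨h2, hq1⟩)).firstNonzeroFromThree⟩
  · rcases Nat.even_or_odd r with he | ho
    · exact ⟨r, q, _, by omega, hq, by omega,
        (sparse_of_even (by omega) hq (.inr ⟨h2, by omega, he⟩)).firstNonzeroFromThree⟩
    · exact ⟨r, q, _, by omega, hq, by omega,
        (sparse_of_odd hq (by omega) ho h2).firstNonzeroFromThree⟩

end QuantumPlane

/-! ### Multiplication of monomial classes and tools for the presentations. -/

namespace QuantumPlane

universe u
variable {k : Type u} [Field k] {q : k}

section Products

/-- The index of the product of two monomials. -/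
def monIdx : Fin 4 → Fin 4 → Fin 4 :=
  -- Where the product is zero the entry `3` is a mere filler, since `monCoeff` vanishes there.
  ![![0, 1, 2, 3], ![1, 3, 3, 3], ![2, 3, 3, 3], ![3, 3, 3, 3]]

variable (q) in
/-- The coefficient of the product of two monomials. -/
def monCoeff : Fin 4 → Fin 4 → k :=
  ![![1, 1, 1, 1], ![1, 0, -q, 0], ![1, 1, 0, 0], ![1, 0, 0, 0]]

theorem mon_mul (m m' : Fin 4) : mon q m * mon q m' = monCoeff q m m' • mon q (monIdx m m') := by
  fin_cases m <;> fin_cases m' <;>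
    simp [mon, monIdx, monCoeff, Lam.x_mul_x, Lam.y_mul_y, Lam.x_mul_y q, Lam.x_mul_yx,
      Lam.y_mul_yx, Lam.yx_mul_x, Lam.yx_mul_y]
  rw [mul_assoc, Lam.x_mul_yx, mul_zero]

variable (q) in
/-- The class of the cocycle with value the `m`-th monomial at the generator with `p` letters `x`
and `s` letters `y`. -/
noncomputable abbrev monCls (m : Fin 4) (p s : ℕ) : HHRing k (Lam q) := cls (mon q m) p s

theorem monCls_mul {m m' : Fin 4} {p s p' s' : ℕ} (h : Surv q m p s) (h' : Surv q m' p' s') :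
    monCls q m p s * monCls q m' p' s' =
      (q ^ (s * p') * monCoeff q m m') • monCls q (monIdx m m') (p + p') (s + s') := by
  rw [cls_mul_cls h.mem h'.mem, mon_mul, cls_smul, smul_smul]

theorem monCls_zero : monCls q 0 0 0 = 1 := by
  have h : Surv q 0 0 0 := by simp [Surv]
  rw [monCls, cls_eq rfl h.mem]
  change _ = DirectSum.of (HH k (Lam q)) 0 (HH.mk k (Lam q) 0 (oneCocycle k (Lam q)))
  congr 1

/-- The factors `1, u₀, u₁, u₀u₁`. -/
def extMon {S : Type*} [Ring S] (u : Fin 2 → S) : Fin 4 → S := ![1, u 0, u 1, u 0 * u 1]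

end Products

section Presentation

variable {T : Type*} [Ring T] [Algebra k T]

theorem sends_symm {P X : Type*} [Ring P] [Algebra k P] (Ψ : P ≃ₐ[k] HHRing k (Lam q)) (F : P → X)
    {a : Lam q} {p s n : ℕ} (hn : p + s = n) (h : eVec a s ∈ koszulCocycles q n) {b : P}
    (hb : Ψ b = cls a p s) {c : X} (hc : F b = c) :
    Sends (fun y => F (Ψ.symm y)) n (eVec a s) c := by
  refine ⟨koszulClass q n ⟨_, h⟩, isRepBy_koszulClass ⟨_, h⟩, ?_⟩
  change F (Ψ.symm _) = c
  rw [← cls_eq hn h, ← hb, AlgEquiv.symm_apply_apply, hc]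

theorem fibreLift_fibreSection {S : Type*} [Ring S] [Algebra k S] {g : S →ₐ[k] k} (Φ : S →ₐ[k] T)
    (z : T) (hz : z * z = 0) (h1 : ∀ s, Φ s * z = g s • z) (h2 : ∀ s, z * Φ s = g s • z) (s : S) :
    fibreLift Φ z hz h1 h2 (fibreSection g s) = Φ s := by
  rw [fibreLift_apply]
  change Φ s + (0 : k) • z = Φ s
  rw [zero_smul, add_zero]

theorem fibreLift_fibreEps {S : Type*} [Ring S] [Algebra k S] {g : S →ₐ[k] k} (Φ : S →ₐ[k] T)
    (z : T) (hz : z * z = 0) (h1 : ∀ s, Φ s * z = g s • z) (h2 : ∀ s, z * Φ s = g s • z) :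
    fibreLift Φ z hz h1 h2 (fibreEps g) = z := by
  rw [fibreLift_apply]
  change Φ 0 + (1 : k) • z = z
  rw [map_zero, one_smul, zero_add]

/-- The fibre product is spanned by `z` and the image of the section, so a spanning family of `S`
together with `z` feeds `bijective_of_span`. -/
theorem fibreLift_bijective {S : Type*} [Ring S] [Algebra k S] {g : S →ₐ[k] k} (Φ : S →ₐ[k] T)
    (z : T) (hz : z * z = 0) (h1 : ∀ s, Φ s * z = g s • z) (h2 : ∀ s, z * Φ s = g s • z)
    {ι : Type*} (B : Module.Basis (Option ι) k T) (hB : B none = z) (G : ι → S)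
    (hG : Submodule.span k (Set.range G) = ⊤) (c : ι → k) (hc : ∀ i, c i ≠ 0)
    (h : ∀ i, Φ (G i) = c i • B (some i)) : Function.Bijective (fibreLift Φ z hz h1 h2) := by
  refine bijective_of_span B (fibreLift Φ z hz h1 h2).toLinearMap
    (fun i => i.elim (fibreEps g) fun j => fibreSection g (G j)) ?_
    (fun i => i.elim 1 c) ?_ ?_
  · rw [eq_top_iff]
    rintro a -
    rw [fibre_eq a]
    refine Submodule.add_mem _ ?_ (Submodule.smul_mem _ _ (Submodule.subset_span ⟨none, rfl⟩))
    have : Submodule.span k (Set.range G) ≤ (Submodule.span k (Set.range fun i : Option ι =>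
        i.elim (fibreEps g) fun j => fibreSection g (G j))).comap (fibreSection g).toLinearMap := by
      rw [Submodule.span_le]
      rintro _ ⟨i, rfl⟩
      exact Submodule.subset_span ⟨some i, rfl⟩
    rw [hG] at this
    exact this trivial
  · rintro (_ | i)
    exacts [one_ne_zero, hc i]
  · rintro (_ | i)
    · simp [fibreLift_fibreEps, hB]
    · simp [fibreLift_fibreSection, h]

/-- A module spanned by the products of `1, u₀, u₁, u₀u₁` with monomials in central elements. -/
theorem span_extMon_mul_eq_top {n : ℕ} (u : Fin 2 → T) (w : Fin n → T)
    (hgen : ∀ A : Subalgebra k T, (∀ i, u i ∈ A) → (∀ i, w i ∈ A) → A = ⊤)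
    (h0 : ∀ i, u i * u i = 0) (h1 : u 1 * u 0 = -(u 0 * u 1)) (hw : ∀ i j, w i * u j = u j * w i)
    {ι : Type*} (W : ι → T) (hW1 : ∃ i, W i = 1) (hW : ∀ j i, ∃ i', w j * W i = W i') :
    Submodule.span k (Set.range fun t : Fin 4 × ι => extMon u t.1 * W t.2) = ⊤ := by
  set f : Fin 4 × ι → T := fun t => extMon u t.1 * W t.2 with hf
  have mem (m : Fin 4) (i : ι) : extMon u m * W i ∈ Submodule.span k (Set.range f) :=
    Submodule.subset_span ⟨(m, i), rfl⟩
  refine eq_top_of_leftStable ?_ (hgen _ (fun a => mem_leftStable_span ?_)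
    fun a => mem_leftStable_span ?_)
  · obtain ⟨i, hi⟩ := hW1
    simpa [extMon, hi] using mem 0 i
  · rintro ⟨m, i⟩
    have hx : ∃ m' : Fin 4, ∃ c : k, u a * extMon u m = c • extMon u m' := by
      fin_cases a <;> fin_cases m
      · exact ⟨1, 1, by simp [extMon]⟩
      · exact ⟨1, 0, by simp [extMon, h0]⟩
      · exact ⟨3, 1, by simp [extMon]⟩
      · exact ⟨1, 0, by simp [extMon, ← mul_assoc, h0]⟩
      · exact ⟨2, 1, by simp [extMon]⟩
      · exact ⟨3, -1, by simp [extMon, h1]⟩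
      · exact ⟨1, 0, by simp [extMon, h0]⟩
      · refine ⟨1, 0, ?_⟩
        change u 1 * (u 0 * u 1) = _
        rw [← mul_assoc, h1, neg_mul, mul_assoc, h0]; simp
    obtain ⟨m', c, hm⟩ := hx
    change u a * (extMon u m * W i) ∈ _
    rw [← mul_assoc, hm, smul_mul_assoc]
    exact Submodule.smul_mem _ _ (mem m' i)
  · rintro ⟨m, i⟩
    obtain ⟨i', hi⟩ := hW a i
    have hx : w a * extMon u m = extMon u m * w a := by
      fin_cases m
      · simp [extMon]
      · simp [extMon, hw]
      · simp [extMon, hw]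
      · change w a * (u 0 * u 1) = u 0 * u 1 * w a
        rw [← mul_assoc, hw, mul_assoc, hw, mul_assoc]
    change w a * (extMon u m * W i) ∈ _
    rw [← mul_assoc, hx, mul_assoc, hi]
    exact mem m i'

theorem extPoly_subalgebra_eq_top {m n : ℕ} {A : Subalgebra k (Poly k (ExtAlg k m) n)}
    (h1 : ∀ i, cst (extGen k i) ∈ A) (h2 : ∀ i, polyVar k (ExtAlg k m) i ∈ A) : A = ⊤ := by
  refine poly_subalgebra_eq_top (fun a => ?_) h2
  have := extAlg_subalgebra_eq_top (k := k) (n := m)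
    (S := A.comap (Algebra.TensorProduct.includeLeft : ExtAlg k m →ₐ[k] Poly k (ExtAlg k m) n)) h1
  have ha : a ∈ A.comap
      (Algebra.TensorProduct.includeLeft : ExtAlg k m →ₐ[k] Poly k (ExtAlg k m) n) := by
    rw [this]; trivial
  exact ha

theorem quot_subalgebra_eq_top {R : Type*} [Ring R] [Algebra k R] {S : Set R}
    {A : Subalgebra k (QuotBy S)} (h : A.comap (quotMk k S) = ⊤) : A = ⊤ := by
  rw [eq_top_iff]
  rintro a -
  obtain ⟨b, rfl⟩ := RingQuot.mkAlgHom_surjective k _ a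
  have : b ∈ A.comap (quotMk k S) := by rw [h]; trivial
  exact this

theorem extGen_mul_self {n : ℕ} (i : Fin n) : extGen k i * extGen k i = 0 :=
  ExteriorAlgebra.ι_sq_zero _

theorem extGen_mul_comm {n : ℕ} (i j : Fin n) : extGen k i * extGen k j = -(extGen k j * extGen k i) :=
  eq_neg_of_add_eq_zero_left (ExteriorAlgebra.ι_add_mul_swap _ _)

/-- The monomial `w₀^(a/2) w₂^(b/2) w₁^(a mod 2)` on the conic. -/
def conicMon (w : Fin 3 → T) (a b : ℕ) : T := w 0 ^ (a / 2) * w 2 ^ (b / 2) * w 1 ^ (a % 2)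

theorem mul_conicMon_zero (w : Fin 3 → T) (a b : ℕ) : w 0 * conicMon w a b = conicMon w (a + 2) b := by
  rw [conicMon, conicMon, show (a + 2) / 2 = a / 2 + 1 by omega, Nat.add_mod_right, pow_succ',
    ← mul_assoc, ← mul_assoc]

theorem mul_conicMon_two (w : Fin 3 → T) (hw : ∀ i j, w i * w j = w j * w i) (a b : ℕ) :
    w 2 * conicMon w a b = conicMon w a (b + 2) := by
  rw [conicMon, conicMon, show (b + 2) / 2 = b / 2 + 1 by omega, pow_succ', ← mul_assoc,
    ← mul_assoc, ← mul_assoc, ((show Commute (w 2) (w 0) from hw 2 0).pow_right _).eq]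

/-- For `a` and `b` even a factor `w₁` appears; for both odd, `w₁² = w₀w₂` raises both halves. Equal
parity is needed because the exponent of `w₁` records `a` only. -/
theorem mul_conicMon_one (w : Fin 3 → T) (hw : ∀ i j, w i * w j = w j * w i)
    (hc : w 0 * w 2 = w 1 ^ 2) {a b : ℕ} (hab : Even (a + b)) :
    w 1 * conicMon w a b = conicMon w (a + 1) (b + 1) := by
  have c10 : Commute (w 1) (w 0) := hw 1 0
  have c12 : Commute (w 1) (w 2) := hw 1 2
  have c02 : Commute (w 0) (w 2) := hw 0 2
  rw [conicMon, conicMon, (((c10.pow_right _).mul_right (c12.pow_right _)).mul_right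
    ((Commute.refl _).pow_right _)).eq, mul_assoc, ← pow_succ]
  rw [Nat.even_iff] at hab
  rcases Nat.mod_two_eq_zero_or_one a with ha | ha
  · rw [show (a + 1) / 2 = a / 2 by omega, show (b + 1) / 2 = b / 2 by omega, ha,
      show (a + 1) % 2 = 1 by omega]
  · rw [show (a + 1) / 2 = a / 2 + 1 by omega, show (b + 1) / 2 = b / 2 + 1 by omega, ha,
      show (a + 1) % 2 = 0 by omega, pow_zero, mul_one, ← hc, pow_succ, pow_succ, mul_assoc,
      mul_assoc]
    congr 1
    rw [← mul_assoc, (c02.symm.pow_left _).eq, mul_assoc]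

theorem map_conicMon {S : Type*} [Ring S] [Algebra k S] (Φ : S →ₐ[k] T) (w : Fin 3 → S) (a b : ℕ) :
    Φ (conicMon w a b) = conicMon (fun i => Φ (w i)) a b := by
  simp [conicMon]

end Presentation

end QuantumPlane

/-! ### The ring when the surviving squares are sparse. -/

namespace QuantumPlane

universe u
variable {k : Type u} [Field k] {q : k}

theorem Sq.add {p s p' s' : ℕ} (h : Sq q p s) (h' : Sq q p' s') : Sq q (p + p') (s + s') := by
  have e : (-1 : k) ^ (p + p' + (s + s')) = (-1) ^ (p + s) * (-1) ^ (p' + s') := by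
    rw [← pow_add]; congr 1; omega
  exact ⟨by rw [pow_add, h.1, h'.1, e], by rw [pow_add, h.2, h'.2, e]⟩

theorem sq_zero_zero : Sq q 0 0 := by simp [Sq]

theorem monCls_zero_mul {p s p' s' : ℕ} (h : Sq q p s) (hs : q ^ s = 1) (h' : Sq q p' s') :
    monCls q 0 p s * monCls q 0 p' s' = monCls q 0 (p + p') (s + s') := by
  rw [monCls_mul (surv_zero.2 h) (surv_zero.2 h'), pow_mul, hs, one_pow]
  simp [monCoeff, monIdx]

theorem monCls_zero_pow {p s : ℕ} (h : Sq q p s) (hs : q ^ s = 1) (n : ℕ) :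
    Sq q (n * p) (n * s) ∧ monCls q 0 p s ^ n = monCls q 0 (n * p) (n * s) := by
  induction n with
  | zero => simpa [monCls_zero] using sq_zero_zero
  | succ n ih =>
    rw [pow_succ', ih.2, monCls_zero_mul h hs ih.1, add_mul, add_mul, one_mul, one_mul,
      add_comm p, add_comm s]
    exact ⟨ih.1.add h, rfl⟩

/-- The generators sit at `(2p, 0)`, `(p, s)` and `(0, 2s)`; positions add under multiplication, and
`q^s = 1` removes the powers of `q`. Equal parity of `a` and `b` lets one factor `w₁` complete both
coordinates. -/
theorem monCls_conicMon {p s a b : ℕ} (h0 : Sq q (2 * p) 0) (h1 : Sq q p s)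
    (h2 : Sq q 0 (2 * s)) (hs : q ^ s = 1) (hab : Even (a + b)) :
    conicMon ![monCls q 0 (2 * p) 0, monCls q 0 p s, monCls q 0 0 (2 * s)] a b =
      monCls q 0 (a * p) (b * s) := by
  have hs2 : q ^ (2 * s) = 1 := by rw [mul_comm, pow_mul, hs, one_pow]
  obtain ⟨s0, e0⟩ := monCls_zero_pow h0 (pow_zero q) (a / 2)
  obtain ⟨s1, e1⟩ := monCls_zero_pow h1 hs (a % 2)
  obtain ⟨s2, e2⟩ := monCls_zero_pow h2 hs2 (b / 2)
  have hs3 : q ^ (a / 2 * 0 + b / 2 * (2 * s)) = 1 := by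
    rw [mul_zero, zero_add, mul_comm, pow_mul, hs2, one_pow]
  have ha : a / 2 * (2 * p) + b / 2 * 0 + a % 2 * p = a * p := by
    conv_rhs => rw [← Nat.div_add_mod a 2]
    ring
  have hb : a / 2 * 0 + b / 2 * (2 * s) + a % 2 * s = b * s := by
    rw [Nat.even_iff] at hab
    rw [show a % 2 = b % 2 by omega]
    conv_rhs => rw [← Nat.div_add_mod b 2]
    ring
  change monCls q 0 (2 * p) 0 ^ (a / 2) * monCls q 0 0 (2 * s) ^ (b / 2) * monCls q 0 p s ^ (a % 2) = _
  rw [e0, e1, e2, monCls_zero_mul s0 (by simp) s2, monCls_zero_mul (s0.add s2) hs3 s1, ha, hb]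

section Sparse

variable {d r : ℕ}

theorem Sparse.sq_pow (h : Sparse q d r) (hr : q ^ r = 1) {p s : ℕ} (hs : Sq q p s) :
    q ^ s = 1 ∧ q ^ p = 1 := by
  obtain ⟨c, t, -, e, rfl⟩ := (h.sq_iff _ _).1 hs
  have h1 : q ^ (t * r) = 1 := by rw [mul_comm, pow_mul, hr, one_pow]
  refine ⟨h1, ?_⟩
  have h2 : q ^ (p + t * r) = 1 := by rw [e, mul_comm, pow_mul, hr, one_pow]
  rwa [pow_add, h1, mul_one] at h2

/-- The shift of the first index from `1` to another monomial in a square. -/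
def shiftX : Fin 4 → ℕ := ![0, 1, 0, 1]

/-- The shift of the second index from `1` to another monomial in a square. -/
def shiftY : Fin 4 → ℕ := ![0, 0, 1, 1]

theorem Sq.surv (hq : q ≠ 0) {p s : ℕ} (h : Sq q p s) (m : Fin 4) :
    Surv q m (p + shiftX m) (s + shiftY m) := by
  fin_cases m
  · exact surv_zero.2 h
  · exact (surv_one_succ hq).2 h
  · exact (surv_two_succ hq).2 h
  · exact (surv_three_succ hq).2 h

/-- No boundary piece survives, so apart from `yx` in degree zero a basis element is a corner of a
surviving square. -/
theorem Sparse.exists_basis (h : Sparse q d r) :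
    ∃ B : Module.Basis (Option (Fin 4 × {t : ℕ × ℕ // Sq q t.1 t.2})) k (HHRing k (Lam q)),
      B none = monCls q 3 0 0 ∧
      ∀ t, B (some t) = monCls q t.1 (t.2.1.1 + shiftX t.1) (t.2.1.2 + shiftY t.1) := by
  obtain ⟨B, hB⟩ := exists_hhBasis h.ne_zero
  let e : Option (Fin 4 × {t : ℕ × ℕ // Sq q t.1 t.2}) → SurvIdx q := fun t =>
    t.elim ⟨(3, 0, 0), surv_three_zero_zero⟩ fun t =>
      ⟨(t.1, t.2.1.1 + shiftX t.1, t.2.1.2 + shiftY t.1), t.2.2.surv h.ne_zero t.1⟩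
  have he : Function.Bijective e := by
    constructor
    · rintro (_ | ⟨m, ⟨p, s⟩, ht⟩) (_ | ⟨m', ⟨p', s'⟩, ht'⟩) hee
      · rfl
      · have := congrArg Subtype.val hee
        simp only [e, Option.elim, Prod.mk.injEq] at this
        obtain ⟨rfl, h1, h2⟩ := this
        simp [shiftX] at h1
      · have := congrArg Subtype.val hee
        simp only [e, Option.elim, Prod.mk.injEq] at this
        obtain ⟨rfl, h1, h2⟩ := this
        simp [shiftX] at h1
      · have := congrArg Subtype.val hee
        simp only [e, Option.elim, Prod.mk.injEq] at this
        obtain ⟨rfl, h1, h2⟩ := this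
        obtain rfl : p = p' := by omega
        obtain rfl : s = s' := by omega
        rfl
    · rintro ⟨⟨m, p, s⟩, ht⟩
      change Surv q m p s at ht
      fin_cases m
      · exact ⟨some (0, ⟨(p, s), surv_zero.1 ht⟩), rfl⟩
      · rcases p with _ | p
        · exact absurd (surv_one_zero.1 ht) (h.edge _)
        · exact ⟨some (1, ⟨(p, s), (surv_one_succ h.ne_zero).1 ht⟩), rfl⟩
      · rcases s with _ | s
        · exact absurd (surv_two_zero.1 ht) (h.edge _)
        · exact ⟨some (2, ⟨(p, s), (surv_two_succ h.ne_zero).1 ht⟩), rfl⟩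
      · rcases p with _ | p <;> rcases s with _ | s
        · exact ⟨none, rfl⟩
        · exact absurd (surv_three_zero_succ.1 ht) (h.edge _)
        · exact absurd (surv_three_succ_zero.1 ht) (h.edge _)
        · exact ⟨some (3, ⟨(p, s), (surv_three_succ h.ne_zero).1 ht⟩), rfl⟩
  refine ⟨B.reindex (Equiv.ofBijective e he).symm, ?_, fun t => ?_⟩
  · rw [Module.Basis.reindex_apply, Equiv.symm_symm, Equiv.ofBijective_apply, hB]
    rfl
  · rw [Module.Basis.reindex_apply, Equiv.symm_symm, Equiv.ofBijective_apply, hB]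
    rfl

/-- In positive degree `yx` survives only as the last corner of a square, that is, in degrees
congruent to `2` modulo `d * r`, whereas `p + s` is a multiple of `d * r`. Hence `z wᵢ = 0`. -/
theorem Sparse.monCls_three_eq_zero (h : Sparse q d r) {p s : ℕ} (hs : Sq q p s) (h0 : 0 < p + s) :
    monCls q 3 p s = 0 := by
  refine cls_mon_eq_zero h.ne_zero fun ht => ?_
  obtain ⟨c, t, -, e, -⟩ := (h.sq_iff _ _).1 hs
  rcases p with _ | p <;> rcases s with _ | s
  · omega
  · exact h.edge _ (surv_three_zero_succ.1 ht)
  · exact h.edge _ (surv_three_succ_zero.1 ht)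
  · obtain ⟨c', t', -, e', -⟩ := (h.sq_iff _ _).1 ((surv_three_succ h.ne_zero).1 ht)
    exact absurd (h.degree_unique (c := c) (c' := c') (i := 0) (j := 2) (by omega) (by omega)
      (by omega)).2 (by omega)

variable (q) in
/-- The classes `u₀` and `u₁` of degree one. -/
noncomputable def extCls : Fin 2 → HHRing k (Lam q) := ![monCls q 1 1 0, monCls q 2 0 1]

theorem surv_u0 (hq : q ≠ 0) : Surv q 1 1 0 := sq_zero_zero.surv hq 1

theorem surv_u1 (hq : q ≠ 0) : Surv q 2 0 1 := sq_zero_zero.surv hq 2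

theorem extCls_mul_self (hq : q ≠ 0) (i : Fin 2) : extCls q i * extCls q i = 0 := by
  fin_cases i
  · exact (monCls_mul (surv_u0 hq) (surv_u0 hq)).trans (by simp [monCoeff])
  · exact (monCls_mul (surv_u1 hq) (surv_u1 hq)).trans (by simp [monCoeff])

theorem extCls_zero_mul_one (hq : q ≠ 0) : extCls q 0 * extCls q 1 = -q • monCls q 3 1 1 :=
  (monCls_mul (surv_u0 hq) (surv_u1 hq)).trans (by simp [monCoeff, monIdx])

theorem extCls_one_mul_zero (hq : q ≠ 0) : extCls q 1 * extCls q 0 = q • monCls q 3 1 1 :=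
  (monCls_mul (surv_u1 hq) (surv_u0 hq)).trans (by simp [monCoeff, monIdx])

theorem extCls_mul_comm (hq : q ≠ 0) (i j : Fin 2) :
    extCls q i * extCls q j = -(extCls q j * extCls q i) := by
  fin_cases i <;> fin_cases j
  · simp [extCls_mul_self hq]
  · simp [extCls_zero_mul_one hq, extCls_one_mul_zero hq]
  · simp [extCls_zero_mul_one hq, extCls_one_mul_zero hq]
  · simp [extCls_mul_self hq]

theorem monCls_zero_mul_extCls (hq : q ≠ 0) {p s : ℕ} (h : Sq q p s) (hs : q ^ s = 1)
    (hp : q ^ p = 1) (i : Fin 2) :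
    monCls q 0 p s * extCls q i = extCls q i * monCls q 0 p s := by
  fin_cases i
  · refine (monCls_mul (surv_zero.2 h) (surv_u0 hq)).trans
      (Eq.trans ?_ (monCls_mul (surv_u0 hq) (surv_zero.2 h)).symm)
    simp [monCoeff, monIdx, hs, add_comm]
  · refine (monCls_mul (surv_zero.2 h) (surv_u1 hq)).trans
      (Eq.trans ?_ (monCls_mul (surv_u1 hq) (surv_zero.2 h)).symm)
    simp [monCoeff, monIdx, hp, add_comm]

variable (q) in
/-- The coefficients of the products of `1, u₀, u₁, u₀u₁` with the classes of tuples of scalars. -/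
def extCoeff : Fin 4 → k := ![1, 1, 1, -q]

theorem extMon_extCls_mul (hq : q ≠ 0) {p s : ℕ} (h : Sq q p s) (hp : q ^ p = 1) (m : Fin 4) :
    extMon (extCls q) m * monCls q 0 p s =
      extCoeff q m • monCls q m (p + shiftX m) (s + shiftY m) := by
  fin_cases m
  · simp [extMon, extCoeff, shiftX, shiftY]
  · exact (monCls_mul (surv_u0 hq) (surv_zero.2 h)).trans
      (by simp [monCoeff, monIdx, extCoeff, shiftX, shiftY, add_comm])
  · exact (monCls_mul (surv_u1 hq) (surv_zero.2 h)).trans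
      (by simp [monCoeff, monIdx, extCoeff, shiftX, shiftY, add_comm, hp])
  · change extCls q 0 * extCls q 1 * _ = _
    rw [extCls_zero_mul_one hq, smul_mul_assoc,
      monCls_mul (show Surv q 3 1 1 from sq_zero_zero.surv hq 3) (surv_zero.2 h)]
    simp [monCoeff, monIdx, extCoeff, shiftX, shiftY, add_comm, hp]

theorem extCoeff_ne_zero (hq : q ≠ 0) (m : Fin 4) : extCoeff q m ≠ 0 := by
  fin_cases m <;> simp [extCoeff, hq]

/-- The Hochschild cohomology ring in the sparse case is the fibre product of `k[z]/(z²)` and a ring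
that is spanned by products of exterior monomials and monomials in central elements. -/
theorem Sparse.exists_equiv (h : Sparse q d r) (hr : q ^ r = 1) {S : Type*} [Ring S] [Algebra k S]
    (g : S →ₐ[k] k) (Φ : S →ₐ[k] HHRing k (Lam q)) {n : ℕ} (u : Fin 2 → S) (w : Fin n → S)
    (hgen : ∀ A : Subalgebra k S, (∀ i, u i ∈ A) → (∀ i, w i ∈ A) → A = ⊤)
    (hgu : ∀ i, g (u i) = 0) (hgw : ∀ i, g (w i) = 0) (hu : ∀ i, Φ (u i) = extCls q i)
    (a b : Fin n → ℕ) (hab : ∀ i, Sq q (a i) (b i)) (hpos : ∀ i, 0 < a i + b i)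
    (hw : ∀ i, Φ (w i) = monCls q 0 (a i) (b i)) (hu0 : ∀ i, u i * u i = 0)
    (hu1 : u 1 * u 0 = -(u 0 * u 1)) (hwu : ∀ i j, w i * u j = u j * w i) (W : ℕ → ℕ → S)
    (hW0 : W 0 0 = 1) (hW : ∀ i p s, Sq q p s → w i * W p s = W (p + a i) (s + b i))
    (hΦW : ∀ p s, Sq q p s → Φ (W p s) = monCls q 0 p s) :
    ∃ ψ : HHRing k (Lam q) ≃ₐ[k] FibreProduct (TrivSqZeroExt.fstHom k k k : DualNumber k →ₐ[k] k) g,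
      Sends (fun a => (ψ a).1) 0 (eVec (Lam.y q * Lam.x q) 0) (DualNumber.eps, 0) ∧
      Sends (fun a => (ψ a).1) 1 (eVec (Lam.x q) 0) (0, u 0) ∧
      Sends (fun a => (ψ a).1) 1 (eVec (Lam.y q) 1) (0, u 1) ∧
      ∀ i, Sends (fun a => (ψ a).1) (a i + b i) (eVec 1 (b i)) (0, w i) := by
  have hq := h.ne_zero
  have s3 := surv_three_zero_zero (q := q)
  -- The generators annihilate `z` on both sides, so the whole algebra acts on `z` through the
  -- augmentation, as a fibre product requires.
  have hacts : augActs g Φ (monCls q 3 0 0) = ⊤ := by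
    refine hgen _ (fun i => ?_) fun i => ?_
    · change Φ (u i) * _ = g (u i) • _ ∧ _ * Φ (u i) = g (u i) • _
      rw [hu, hgu, zero_smul]
      fin_cases i
      · exact ⟨(monCls_mul (surv_u0 hq) s3).trans (by simp [monCoeff]),
          (monCls_mul s3 (surv_u0 hq)).trans (by simp [monCoeff])⟩
      · exact ⟨(monCls_mul (surv_u1 hq) s3).trans (by simp [monCoeff]),
          (monCls_mul s3 (surv_u1 hq)).trans (by simp [monCoeff])⟩
    · change Φ (w i) * _ = g (w i) • _ ∧ _ * Φ (w i) = g (w i) • _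
      have e := h.monCls_three_eq_zero (hab i) (hpos i)
      rw [hw, hgw, zero_smul, monCls_mul (surv_zero.2 (hab i)) s3,
        monCls_mul s3 (surv_zero.2 (hab i))]
      simp [monIdx, e]
  have hz (s : S) : Φ s * monCls q 3 0 0 = g s • monCls q 3 0 0 ∧
      monCls q 3 0 0 * Φ s = g s • monCls q 3 0 0 := by
    have : s ∈ augActs g Φ (monCls q 3 0 0) := by rw [hacts]; trivial
    exact this
  have hzz : monCls q 3 0 0 * monCls q 3 0 0 = 0 := (monCls_mul s3 s3).trans (by simp [monCoeff])
  obtain ⟨B, hB0, hB⟩ := h.exists_basis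
  have hbij := fibreLift_bijective Φ _ hzz (fun s => (hz s).1) (fun s => (hz s).2) B hB0
    (fun t => extMon u t.1 * W t.2.1.1 t.2.1.2)
    (span_extMon_mul_eq_top u w hgen hu0 hu1 hwu
      (fun t : {t : ℕ × ℕ // Sq q t.1 t.2} => W t.1.1 t.1.2)
      ⟨⟨(0, 0), sq_zero_zero⟩, hW0⟩
      fun j i => ⟨⟨(i.1.1 + a j, i.1.2 + b j), i.2.add (hab j)⟩, hW j _ _ i.2⟩)
    (fun t => extCoeff q t.1) (fun t => extCoeff_ne_zero hq t.1) (fun t => by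
      have e : Φ (extMon u t.1) = extMon (extCls q) t.1 := by
        obtain ⟨m, t⟩ := t
        fin_cases m <;> simp [extMon, hu]
      rw [map_mul, e, hΦW _ _ t.2.2, extMon_extCls_mul hq t.2.2 (h.sq_pow hr t.2.2).2, hB])
  let Ψ := AlgEquiv.ofBijective _ hbij
  have h1 : Ψ (fibreEps g) = monCls q 3 0 0 :=
    fibreLift_fibreEps Φ _ hzz (fun s => (hz s).1) (fun s => (hz s).2)
  have h2 (s : S) : Ψ (fibreSection g s) = Φ s :=
    fibreLift_fibreSection Φ _ hzz (fun s => (hz s).1) (fun s => (hz s).2) s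
  have h3 (s : S) (hs : g s = 0) : (fibreSection g s).1 = (0, s) := by
    change (algebraMap k (DualNumber k) (g s), s) = (0, s)
    rw [hs, map_zero]
  exact ⟨Ψ.symm, sends_symm Ψ (fun y => y.1) (p := 0) rfl s3.mem h1 rfl,
    sends_symm Ψ (fun y => y.1) (p := 1) rfl (surv_u0 hq).mem ((h2 _).trans (hu 0)) (h3 _ (hgu 0)),
    sends_symm Ψ (fun y => y.1) (p := 0) rfl (surv_u1 hq).mem ((h2 _).trans (hu 1)) (h3 _ (hgu 1)),
    fun i => sends_symm Ψ (fun y => y.1) (p := a i) rfl (surv_zero.2 (hab i)).mem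
      ((h2 _).trans (hw i)) (h3 _ (hgw i))⟩

theorem exists_extPoly_lift (hq : q ≠ 0) {n : ℕ} (a b : Fin n → ℕ) (hab : ∀ i, Sq q (a i) (b i))
    (ha : ∀ i, q ^ a i = 1) (hb : ∀ i, q ^ b i = 1) :
    ∃ Φ : Poly k (ExtAlg k 2) n →ₐ[k] HHRing k (Lam q), (∀ i, Φ (cst (extGen k i)) = extCls q i) ∧
      ∀ i, Φ (polyVar k (ExtAlg k 2) i) = monCls q 0 (a i) (b i) := by
  obtain ⟨Φ, hΦ⟩ := exists_extAlg_lift (k := k) (extCls q) (extCls_mul_self hq) (extCls_mul_comm hq)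
  obtain ⟨Ψ, h1, h2⟩ := exists_poly_lift Φ (fun i => monCls q 0 (a i) (b i))
    (fun i j => by
      rw [monCls_zero_mul (hab i) (hb i) (hab j), monCls_zero_mul (hab j) (hb j) (hab i),
        add_comm, add_comm (b i)])
    (fun i x => by
      have : (commutant (monCls q 0 (a i) (b i))).comap Φ = ⊤ := extAlg_subalgebra_eq_top fun j =>
        (mem_commutant (k := k)).2 (by
          change _ * Φ (extGen k j) = Φ (extGen k j) * _
          rw [hΦ, monCls_zero_mul_extCls hq (hab i) (hb i) (ha i)])
      have hx : x ∈ (commutant (monCls q 0 (a i) (b i))).comap Φ := by rw [this]; trivial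
      exact (mem_commutant (k := k)).1 hx)
  exact ⟨Ψ, fun i => by rw [h1, hΦ], h2⟩

theorem cst_mul_cst {R : Type*} [Ring R] [Algebra k R] {n : ℕ} (a b : R) :
    (cst a * cst b : Poly k R n) = cst (a * b) := by
  simp [cst]

theorem polyVar_mul_cst {R : Type*} [Ring R] [Algebra k R] {n : ℕ} (i : Fin n) (a : R) :
    polyVar k R i * cst a = cst a * polyVar k R i := by
  simp [cst, polyVar]

theorem polyVar_mul_comm {R : Type*} [Ring R] [Algebra k R] {n : ℕ} (i j : Fin n) :
    polyVar k R i * polyVar k R j = polyVar k R j * polyVar k R i := by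
  simp [polyVar, mul_comm]

theorem cst_neg {R : Type*} [Ring R] [Algebra k R] {n : ℕ} (a : R) :
    (cst (-a) : Poly k R n) = -cst a := by
  simp [cst, TensorProduct.neg_tmul]

theorem cst_zero {R : Type*} [Ring R] [Algebra k R] {n : ℕ} :
    (cst (0 : R) : Poly k R n) = 0 := by
  simp [cst]

theorem Sparse.exists_presB (h : Sparse q 1 r) (hr : q ^ r = 1) :
    ∃ ψ : HHRing k (Lam q) ≃ₐ[k] PresB k,
      Sends (fun a => (ψ a).1) 0 (eVec (Lam.y q * Lam.x q) 0) (DualNumber.eps, 0) ∧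
      Sends (fun a => (ψ a).1) 1 (eVec (Lam.x q) 0) (0, cst (extGen k 0)) ∧
      Sends (fun a => (ψ a).1) 1 (eVec (Lam.y q) 1) (0, cst (extGen k 1)) ∧
      ∀ i : Fin 2, Sends (fun a => (ψ a).1) r (eVec 1 (i * r)) (0, polyVar k (ExtAlg k 2) i) := by
  have hq := h.ne_zero
  have hr0 := h.r_pos
  let a : Fin 2 → ℕ := ![r, 0]
  let b : Fin 2 → ℕ := ![0, r]
  have hab (i : Fin 2) : Sq q (a i) (b i) := by
    refine (h.sq_iff _ _).2 ⟨1, i, ?_⟩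
    fin_cases i <;> simp [a, b]
  have hd (p s : ℕ) (hs : Sq q p s) : ∃ c t, p = c * r ∧ s = t * r := by
    obtain ⟨c, t, ht, e, rfl⟩ := (h.sq_iff _ _).1 hs
    refine ⟨c - t, t, ?_, rfl⟩
    rw [Nat.sub_mul]
    rw [one_mul] at e
    omega
  obtain ⟨Φ, hΦu, hΦw⟩ := exists_extPoly_lift hq a b hab (fun i => (h.sq_pow hr (hab i)).2)
    fun i => (h.sq_pow hr (hab i)).1
  let w : Fin 2 → Poly k (ExtAlg k 2) 2 := polyVar k (ExtAlg k 2)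
  have hw01 : Commute (w 1) (w 0) := polyVar_mul_comm 1 0
  -- The monomials are indexed by positions `(p, s)`, and multiplication by a generator adds its
  -- position.
  have hW (i : Fin 2) (p s : ℕ) : w i * (w 0 ^ (p / r) * w 1 ^ (s / r)) =
      w 0 ^ ((p + a i) / r) * w 1 ^ ((s + b i) / r) := by
    fin_cases i
    · change w 0 * _ = _ ^ ((p + r) / r) * _ ^ ((s + 0) / r)
      rw [Nat.add_div_right p hr0, add_zero, pow_succ', mul_assoc]
    · change w 1 * _ = _ ^ ((p + 0) / r) * _ ^ ((s + r) / r)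
      rw [Nat.add_div_right s hr0, add_zero, pow_succ', ← mul_assoc, ← mul_assoc,
        (hw01.pow_right _).eq]
  have hΦW (p s : ℕ) (hs : Sq q p s) : Φ (w 0 ^ (p / r) * w 1 ^ (s / r)) = monCls q 0 p s := by
    obtain ⟨c, t, rfl, rfl⟩ := hd p s hs
    obtain ⟨s0, e0⟩ := monCls_zero_pow (hab 0) (pow_zero q) c
    obtain ⟨s1, e1⟩ := monCls_zero_pow (hab 1) hr t
    rw [map_mul, map_pow, map_pow, hΦw, hΦw, Nat.mul_div_cancel _ hr0, Nat.mul_div_cancel _ hr0, e0,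
      e1, monCls_zero_mul s0 (by simp [b]) s1]
    simp [a, b]
  obtain ⟨ψ, h1, h2, h3, h4⟩ := h.exists_equiv hr (extPolyAug k 2 2) Φ (fun i => cst (extGen k i)) w
    (fun A h1 h2 => extPoly_subalgebra_eq_top h1 h2)
    (fun i => by simp [extPolyAug, ExteriorAlgebra.algebraMapInv])
    (fun i => by simp [extPolyAug, w]) hΦu a b hab (fun i => by fin_cases i <;> simp [a, b, hr0])
    hΦw (fun i => by rw [cst_mul_cst, extGen_mul_self, cst_zero])
    (by rw [cst_mul_cst, cst_mul_cst, extGen_mul_comm, cst_neg])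
    (fun i j => polyVar_mul_cst i _) _ (by rw [Nat.zero_div, pow_zero, pow_zero, mul_one])
    (fun i p s _ => hW i p s) hΦW
  refine ⟨ψ, h1, h2, h3, fun i => ?_⟩
  have h5 := h4 i
  have e1 : a i + b i = r := by fin_cases i <;> simp [a, b]
  have e2 : b i = i * r := by fin_cases i <;> simp [b]
  rwa [e1, e2] at h5

theorem Sparse.exists_presA (h : Sparse q 2 r) (hr : q ^ r = 1) :
    ∃ ψ : HHRing k (Lam q) ≃ₐ[k] PresA k,
      Sends (fun a => (ψ a).1) 0 (eVec (Lam.y q * Lam.x q) 0) (DualNumber.eps, 0) ∧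
      Sends (fun a => (ψ a).1) 1 (eVec (Lam.x q) 0)
        (0, quotMk k (conicRel k) (cst (extGen k 0))) ∧
      Sends (fun a => (ψ a).1) 1 (eVec (Lam.y q) 1)
        (0, quotMk k (conicRel k) (cst (extGen k 1))) ∧
      ∀ i : Fin 3, Sends (fun a => (ψ a).1) (2 * r) (eVec 1 (i * r))
        (0, quotMk k (conicRel k) (polyVar k (ExtAlg k 2) i)) := by
  have hq := h.ne_zero
  have hr0 := h.r_pos
  let a : Fin 3 → ℕ := ![2 * r, r, 0]
  let b : Fin 3 → ℕ := ![0, r, 2 * r]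
  have e1 (i : Fin 3) : a i + b i = 2 * r := by fin_cases i <;> simp [a, b, two_mul]
  have e2 (i : Fin 3) : b i = i * r := by fin_cases i <;> simp [b]
  have hab (i : Fin 3) : Sq q (a i) (b i) :=
    (h.sq_iff _ _).2 ⟨1, i, by omega, by rw [e1, mul_one], e2 i⟩
  have hd (p s : ℕ) (hs : Sq q p s) : ∃ c t, p = c * r ∧ s = t * r ∧ Even (c + t) := by
    obtain ⟨c, t, ht, e, rfl⟩ := (h.sq_iff _ _).1 hs
    refine ⟨2 * c - t, t, ?_, rfl, c, by omega⟩
    rw [Nat.sub_mul]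
    omega
  obtain ⟨Φ', hΦu', hΦw'⟩ := exists_extPoly_lift hq a b hab (fun i => (h.sq_pow hr (hab i)).2)
    fun i => (h.sq_pow hr (hab i)).1
  -- Both `w₀w₂` and `w₁²` are the class of `1` at the position `(2r, 2r)`.
  obtain ⟨Φ, hΦ⟩ := exists_quot_lift (S := conicRel k) Φ' (by
    rintro _ rfl
    rw [map_sub, map_mul, map_pow, hΦw', hΦw', hΦw', sub_eq_zero, sq,
      monCls_zero_mul (hab 0) (pow_zero q) (hab 2), monCls_zero_mul (hab 1) hr (hab 1)]
    simp [a, b, two_mul])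
  let π := quotMk k (conicRel k)
  let w : Fin 3 → QuotBy (conicRel k) := fun i => π (polyVar k (ExtAlg k 2) i)
  let u : Fin 2 → QuotBy (conicRel k) := fun i => π (cst (extGen k i))
  have hΦw (i : Fin 3) : Φ (w i) = monCls q 0 (a i) (b i) := by rw [hΦ, hΦw']
  have hw (i j : Fin 3) : w i * w j = w j * w i := by
    rw [← map_mul, polyVar_mul_comm, map_mul]
  have hc : w 0 * w 2 = w 1 ^ 2 := by
    rw [← sub_eq_zero, ← map_mul, ← map_pow, ← map_sub]
    exact quotMk_eq_zero rfl
  have hW (i : Fin 3) (p s : ℕ) (hs : Sq q p s) : w i * conicMon w (p / r) (s / r) =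
      conicMon w ((p + a i) / r) ((s + b i) / r) := by
    obtain ⟨c, t, rfl, rfl, hct⟩ := hd p s hs
    have e3 (m n : ℕ) : (m * r + n * r) / r = m + n := by
      rw [← add_mul, Nat.mul_div_cancel _ hr0]
    have e4 (m : ℕ) : (m * r + r) / r = m + 1 := by
      simpa using e3 m 1
    rw [Nat.mul_div_cancel _ hr0, Nat.mul_div_cancel _ hr0]
    fin_cases i
    · change w 0 * _ = conicMon w ((c * r + 2 * r) / r) ((t * r + 0) / r)
      rw [e3, add_zero, Nat.mul_div_cancel _ hr0, mul_conicMon_zero]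
    · change w 1 * _ = conicMon w ((c * r + r) / r) ((t * r + r) / r)
      rw [e4, e4, mul_conicMon_one w hw hc hct]
    · change w 2 * _ = conicMon w ((c * r + 0) / r) ((t * r + 2 * r) / r)
      rw [e3, add_zero, Nat.mul_div_cancel _ hr0, mul_conicMon_two w hw]
  have hΦW (p s : ℕ) (hs : Sq q p s) : Φ (conicMon w (p / r) (s / r)) = monCls q 0 p s := by
    obtain ⟨c, t, rfl, rfl, hct⟩ := hd p s hs
    rw [Nat.mul_div_cancel _ hr0, Nat.mul_div_cancel _ hr0,
      ← monCls_conicMon (p := r) (s := r) (hab 0) (hab 1) (hab 2) hr hct, map_conicMon]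
    congr 1
    funext i
    rw [hΦw]
    fin_cases i <;> rfl
  obtain ⟨ψ, h1, h2, h3, h4⟩ := h.exists_equiv hr (conicAug k) Φ u w
    (fun A h1 h2 => quot_subalgebra_eq_top (extPoly_subalgebra_eq_top h1 h2))
    (fun i => (RingQuot.liftAlgHom_mkAlgHom_apply k _ _ _).trans
      (by simp [extPolyAug, ExteriorAlgebra.algebraMapInv]))
    (fun i => (RingQuot.liftAlgHom_mkAlgHom_apply k _ _ _).trans (by simp [extPolyAug]))
    (fun i => by rw [hΦ, hΦu']) a b hab (fun i => by rw [e1]; omega)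
    hΦw (fun i => by rw [← map_mul, cst_mul_cst, extGen_mul_self, cst_zero, map_zero])
    (by rw [← map_mul, ← map_mul, cst_mul_cst, cst_mul_cst, extGen_mul_comm, cst_neg, map_neg])
    (fun i j => by rw [← map_mul, polyVar_mul_cst, map_mul]) _ (by simp [conicMon]) hW hΦW
  refine ⟨ψ, h1, h2, h3, fun i => ?_⟩
  have h5 := h4 i
  rwa [e1, e2] at h5

end Sparse

end QuantumPlane

/-! ### Central coefficients, and the ring for `q = 1` in characteristic `2`. -/

namespace QuantumPlane

universe u
variable {k : Type u} [Field k] {q : k}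

theorem eVec_mem_koszulCocycles (h : ∀ m, Surv q m 0 0) (a : Lam q) :
    eVec a 0 ∈ koszulCocycles q 0 := by
  have e : eVec a 0 = ∑ m, Lam.coord q m a • eVec (mon q m) 0 := by
    conv_lhs => rw [← sum_coord_smul_mon a]
    funext i
    simp only [eVec, Finset.sum_apply, Pi.smul_apply, Pi.single_apply]
    split_ifs <;> simp
  rw [e]
  exact Submodule.sum_mem _ fun m _ => Submodule.smul_mem _ _ (h m).mem

/-- If all elements of `Λ_q` are central, then `Λ_q` is the degree zero part of the Hochschild
cohomology ring. -/
theorem exists_lam_lift (h : ∀ m, Surv q m 0 0) :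
    ∃ Φ : Lam q →ₐ[k] HHRing k (Lam q), ∀ a, Φ a = cls a 0 0 := by
  have hc := eVec_mem_koszulCocycles h
  have he (a : Lam q) : cls a 0 0 = DirectSum.of (HH k (Lam q)) 0 (koszulClass q 0 ⟨_, hc a⟩) :=
    cls_eq rfl (hc a)
  refine ⟨AlgHom.ofLinearMap
    { toFun := fun a => cls a 0 0
      map_add' := fun a b => ?_
      map_smul' := fun c a => cls_smul c a 0 0 } monCls_zero ?_, fun a => rfl⟩
  · rw [he, he, he, ← map_add, ← map_add]
    congr 2
  · intro a b
    refine Eq.trans ?_ (cls_mul_cls (hc a) (hc b)).symm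
    simp

theorem cls_mul_monCls_zero {a : Lam q} (ha : eVec a 0 ∈ koszulCocycles q 0) {p s : ℕ}
    (h : Sq q p s) : cls a 0 0 * monCls q 0 p s = cls a p s := by
  refine (cls_mul_cls ha (surv_zero.2 h).mem).trans ?_
  simp [mon]

theorem monCls_zero_mul_cls {a : Lam q} (ha : eVec a 0 ∈ koszulCocycles q 0) {p s : ℕ}
    (h : Sq q p s) : monCls q 0 p s * cls a 0 0 = cls a p s := by
  refine (cls_mul_cls (surv_zero.2 h).mem ha).trans ?_
  simp [mon]

theorem span_cst_mul_pow_eq_top {R ι : Type*} [Ring R] [Algebra k R] (b : ι → R)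
    (hb : Submodule.span k (Set.range b) = ⊤) :
    Submodule.span k (Set.range fun t : ι × ℕ × ℕ =>
      (cst (b t.1) * (polyVar k R 0 ^ t.2.1 * polyVar k R 1 ^ t.2.2) : Poly k R 2)) = ⊤ := by
  set f : ι × ℕ × ℕ → Poly k R 2 := fun t =>
    cst (b t.1) * (polyVar k R 0 ^ t.2.1 * polyVar k R 1 ^ t.2.2) with hf
  have mem (r : R) (i j : ℕ) : (cst r * (polyVar k R 0 ^ i * polyVar k R 1 ^ j) : Poly k R 2) ∈
      Submodule.span k (Set.range f) := by
    have : Submodule.span k (Set.range b) ≤ (Submodule.span k (Set.range f)).comap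
        ((LinearMap.mulRight k (polyVar k R 0 ^ i * polyVar k R 1 ^ j)) ∘ₗ
          (Algebra.TensorProduct.includeLeft : R →ₐ[k] Poly k R 2).toLinearMap) := by
      rw [Submodule.span_le]
      rintro _ ⟨m, rfl⟩
      exact Submodule.subset_span ⟨(m, i, j), rfl⟩
    rw [hb] at this
    exact this (x := r) trivial
  have hc : Commute (polyVar k R (1 : Fin 2)) (polyVar k R 0) := polyVar_mul_comm 1 0
  refine eq_top_of_leftStable ?_ (poly_subalgebra_eq_top (fun a => mem_leftStable_span ?_)
    fun a => mem_leftStable_span ?_)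
  · have := mem 1 0 0
    rwa [pow_zero, pow_zero, mul_one, mul_one] at this
  · rintro ⟨m, i, j⟩
    simp only [hf]
    rw [← mul_assoc, cst_mul_cst]
    exact mem _ _ _
  · rintro ⟨m, i, j⟩
    simp only [hf]
    rw [← mul_assoc, polyVar_mul_cst, mul_assoc]
    fin_cases a
    · change cst (b m) * (polyVar k R 0 * _) ∈ _
      rw [← mul_assoc (polyVar k R 0), ← pow_succ']
      exact mem _ _ _
    · change cst (b m) * (polyVar k R 1 * _) ∈ _
      rw [← mul_assoc (polyVar k R 1), (hc.pow_right i).eq, mul_assoc (_ ^ i), ← pow_succ']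
      exact mem _ _ _

theorem span_mon_eq_top : Submodule.span k (Set.range (mon q)) = ⊤ := by
  rw [eq_top_iff]
  rintro a -
  rw [← sum_coord_smul_mon a]
  exact Submodule.sum_mem _ fun m _ => Submodule.smul_mem _ _ (Submodule.subset_span ⟨m, rfl⟩)

/-- All arrows vanish, so every monomial tuple is a basis class; with `q = 1` it is the product of
its entry and powers of `w₀` and `w₁`. -/
theorem exists_presC (h2 : ringChar k = 2) : ∃ ψ : HHRing k (Lam (1 : k)) ≃ₐ[k] PresC (1 : k),
    (∀ a : Lam (1 : k), Sends ψ 0 (eVec a 0) (cst a)) ∧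
    ∀ i : Fin 2, Sends ψ 1 (eVec 1 i) (polyVar k (Lam (1 : k)) i) := by
  have hS := surv_of_char_two h2
  have hsq := sq_of_char_two h2
  have hc := eVec_mem_koszulCocycles fun m => hS m 0 0
  obtain ⟨Φ, hΦ⟩ := exists_lam_lift fun m => hS m 0 0
  let a : Fin 2 → ℕ := ![1, 0]
  let b : Fin 2 → ℕ := ![0, 1]
  obtain ⟨Ψ, h1, hw⟩ := exists_poly_lift Φ (fun i => monCls (1 : k) 0 (a i) (b i))
    (fun i j => by
      rw [monCls_zero_mul (hsq _ _) (one_pow _) (hsq _ _),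
        monCls_zero_mul (hsq _ _) (one_pow _) (hsq _ _), add_comm, add_comm (b i)])
    (fun i x => by
      rw [hΦ, monCls_zero_mul_cls (hc x) (hsq _ _), cls_mul_monCls_zero (hc x) (hsq _ _)])
  obtain ⟨B, hB⟩ := exists_hhBasis (one_ne_zero (α := k))
  have hbij : Function.Bijective Ψ := by
    refine bijective_of_span B Ψ.toLinearMap (fun t => cst (mon 1 t.1.1) *
      (polyVar k (Lam (1 : k)) 0 ^ t.1.2.1 * polyVar k (Lam (1 : k)) 1 ^ t.1.2.2)) ?_ (fun _ => 1)
      (fun _ => one_ne_zero) fun t => ?_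
    · rw [← span_cst_mul_pow_eq_top (mon (1 : k)) span_mon_eq_top]
      congr 1
      ext v
      constructor
      · rintro ⟨t, rfl⟩
        exact ⟨t.1, rfl⟩
      · rintro ⟨t, rfl⟩
        exact ⟨⟨t, hS _ _ _⟩, rfl⟩
    · obtain ⟨⟨m, p, s⟩, ht⟩ := t
      have e0 := (monCls_zero_pow (hsq 1 0) (one_pow _) p).2
      have e1 := (monCls_zero_pow (hsq 0 1) (one_pow _) s).2
      rw [one_smul, hB, AlgHom.toLinearMap_apply, map_mul, map_mul, map_pow, map_pow, h1, hw, hw, hΦ]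
      change cls (mon 1 m) 0 0 * (monCls 1 0 1 0 ^ p * monCls 1 0 0 1 ^ s) = cls (mon 1 m) p s
      rw [e0, e1, monCls_zero_mul (hsq _ _) (one_pow _) (hsq _ _), cls_mul_monCls_zero (hc _) (hsq _ _)]
      simp
  let E := AlgEquiv.ofBijective Ψ hbij
  refine ⟨E.symm, fun x => sends_symm E id (p := 0) rfl (hc x) ((h1 x).trans (hΦ x)) rfl, fun i => ?_⟩
  fin_cases i
  · exact sends_symm E id (p := 1) rfl (hS 0 1 0).mem (hw 0) rfl
  · exact sends_symm E id (p := 0) rfl (hS 0 0 1).mem (hw 1) rfl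

end QuantumPlane

/-! ### The ring for `q = -1`. -/

namespace QuantumPlane

universe u
variable {k : Type u} [Field k]

/-- The indices of the basis of the Hochschild cohomology ring for `q = -1`: the products of
`1, u₀, u₁, u₀u₁` with `w₀^a w₁^b`, and `x w₁^b`, `x u₁ w₁^b`, `y w₀^a`, `y u₀ w₀^a`, `yx`. -/
inductive NegOneIdx : Type
  | sq (m : Fin 4) (a b : ℕ)
  | x (b : ℕ)
  | xu (b : ℕ)
  | y (a : ℕ)
  | yu (a : ℕ)
  | yx

/-- The index of the monomial class that corresponds to a product of generators. -/
def NegOneIdx.toTriple : NegOneIdx → Fin 4 × ℕ × ℕ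
  | sq m a b => (m, 2 * a + shiftX m, 2 * b + shiftY m)
  | x b => (1, 0, 2 * b)
  | xu b => (3, 0, 2 * b + 1)
  | y a => (2, 2 * a, 0)
  | yu a => (3, 2 * a + 1, 0)
  | yx => (3, 0, 0)

theorem NegOneIdx.toTriple_injective : Function.Injective NegOneIdx.toTriple := by
  have hx : shiftX 3 = 1 := rfl
  have hy : shiftY 3 = 1 := rfl
  have hx' : shiftX 1 = 1 := rfl
  have hy' : shiftY 2 = 1 := rfl
  intro s t h
  cases s <;> cases t <;> simp only [toTriple, Prod.mk.injEq] at h <;>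
    first
      | (obtain ⟨rfl, h1, h2⟩ := h
         first
          | (exfalso; omega)
          | (congr 1 <;> omega))
      | (exfalso; obtain ⟨h0, -, -⟩ := h; exact absurd h0 (by decide))
      | (obtain ⟨-, h1, h2⟩ := h
         first
          | (exfalso; omega)
          | (congr 1; omega))

theorem NegOneIdx.surv (h2 : ringChar k ≠ 2) (t : NegOneIdx) :
    Surv (-1 : k) t.toTriple.1 t.toTriple.2.1 t.toTriple.2.2 := by
  cases t with
  | sq m a b => exact Sq.surv (by simp) ((sq_neg_one_iff h2).2 (by simp)) m
  | x b => exact surv_one_zero.2 ((edge_neg_one_iff h2).2 (even_two_mul _))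
  | xu b => exact surv_three_zero_succ.2 ((edge_neg_one_iff h2).2 (even_two_mul _))
  | y a => exact surv_two_zero.2 ((edge_neg_one_iff h2).2 (even_two_mul _))
  | yu a => exact surv_three_succ_zero.2 ((edge_neg_one_iff h2).2 (even_two_mul _))
  | yx => exact surv_three_zero_zero

theorem NegOneIdx.exists_of_surv (h2 : ringChar k ≠ 2) {m : Fin 4} {p s : ℕ}
    (h : Surv (-1 : k) m p s) : ∃ t : NegOneIdx, t.toTriple = (m, p, s) := by
  have hq : (-1 : k) ≠ 0 := by simp
  have hsq {p s : ℕ} (h : Sq (-1 : k) p s) : ∃ a b, p = 2 * a ∧ s = 2 * b := by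
    obtain ⟨⟨a, ha⟩, b, hb⟩ := (sq_neg_one_iff h2).1 h
    exact ⟨a, b, by omega, by omega⟩
  have he {n : ℕ} (h : 1 + (-1) ^ n * (-1 : k) = 0) : ∃ a, n = 2 * a := by
    obtain ⟨a, ha⟩ := (edge_neg_one_iff h2).1 h
    exact ⟨a, by omega⟩
  fin_cases m
  · obtain ⟨a, b, rfl, rfl⟩ := hsq (surv_zero.1 h)
    exact ⟨.sq 0 a b, rfl⟩
  · rcases p with _ | p
    · obtain ⟨b, rfl⟩ := he (surv_one_zero.1 h)
      exact ⟨.x b, rfl⟩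
    · obtain ⟨a, b, rfl, rfl⟩ := hsq ((surv_one_succ hq).1 h)
      exact ⟨.sq 1 a b, rfl⟩
  · rcases s with _ | s
    · obtain ⟨b, rfl⟩ := he (surv_two_zero.1 h)
      exact ⟨.y b, rfl⟩
    · obtain ⟨a, b, rfl, rfl⟩ := hsq ((surv_two_succ hq).1 h)
      exact ⟨.sq 2 a b, rfl⟩
  · rcases p with _ | p <;> rcases s with _ | s
    · exact ⟨.yx, rfl⟩
    · obtain ⟨b, rfl⟩ := he (surv_three_zero_succ.1 h)
      exact ⟨.xu b, rfl⟩
    · obtain ⟨b, rfl⟩ := he (surv_three_succ_zero.1 h)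
      exact ⟨.yu b, rfl⟩
    · obtain ⟨a, b, rfl, rfl⟩ := hsq ((surv_three_succ hq).1 h)
      exact ⟨.sq 3 a b, rfl⟩

theorem exists_negOneBasis (h2 : ringChar k ≠ 2) :
    ∃ B : Module.Basis NegOneIdx k (HHRing k (Lam (-1 : k))),
      ∀ t, B t = monCls (-1 : k) t.toTriple.1 t.toTriple.2.1 t.toTriple.2.2 := by
  obtain ⟨B, hB⟩ := exists_hhBasis (q := (-1 : k)) (by simp)
  let e : NegOneIdx → SurvIdx (-1 : k) := fun t => ⟨t.toTriple, t.surv h2⟩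
  have he : Function.Bijective e := by
    refine ⟨fun s t h => NegOneIdx.toTriple_injective (congrArg Subtype.val h), ?_⟩
    rintro ⟨⟨m, p, s⟩, h⟩
    obtain ⟨t, ht⟩ := NegOneIdx.exists_of_surv h2 h
    exact ⟨t, Subtype.ext ht⟩
  refine ⟨B.reindex (Equiv.ofBijective e he).symm, fun t => ?_⟩
  rw [Module.Basis.reindex_apply, Equiv.symm_symm, Equiv.ofBijective_apply, hB]

section Span

variable {T : Type*} [Ring T]

/-- The product of generators with a given index. -/
def NegOneIdx.prod (x y : T) (u w : Fin 2 → T) : NegOneIdx → T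
  | sq m a b => extMon u m * (w 0 ^ a * w 1 ^ b)
  | .x b => x * w 1 ^ b
  | xu b => x * u 1 * w 1 ^ b
  | .y a => y * w 0 ^ a
  | yu a => y * u 0 * w 0 ^ a
  | yx => y * x

/-- A product of generators is zero or one of the listed ones. -/
theorem exists_negOneIdx_prod {x y : T} {u w : Fin 2 → T} (hxu : x * u 0 = 0) (hyu : y * u 1 = 0)
    (hxw : x * w 0 = 0) (hyw : y * w 1 = 0) (hxy : x * y = y * x)
    (hu : u 0 * u 1 = -(u 1 * u 0))
    (hwu : ∀ i j, w i * u j = u j * w i) (hww : w 1 * w 0 = w 0 * w 1) (m m' : Fin 4) (a b : ℕ) :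
    (![1, x, y, y * x] : Fin 4 → T) m * extMon u m' * (w 0 ^ a * w 1 ^ b) = 0 ∨
    ∃ t : NegOneIdx, (![1, x, y, y * x] : Fin 4 → T) m * extMon u m' * (w 0 ^ a * w 1 ^ b) =
      t.prod x y u w := by
  have hwE (i : Fin 2) (m : Fin 4) : extMon u m * w i = w i * extMon u m := by
    fin_cases m
    · simp [extMon]
    · exact (hwu i 0).symm
    · exact (hwu i 1).symm
    · change u 0 * u 1 * w i = w i * (u 0 * u 1)
      rw [← mul_assoc, hwu, mul_assoc, ← hwu, mul_assoc]
  have hxE (m : Fin 4) (h : m = 1 ∨ m = 3) : x * extMon u m = 0 := by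
    rcases h with rfl | rfl
    · exact hxu
    · change x * (u 0 * u 1) = 0
      rw [← mul_assoc, hxu, zero_mul]
  have hyE (m : Fin 4) (h : m = 2 ∨ m = 3) : y * extMon u m = 0 := by
    rcases h with rfl | rfl
    · exact hyu
    · change y * (u 0 * u 1) = 0
      -- The factors `u₀` and `u₁` are exchanged to bring `u₁` next to `y`.
      rw [hu, mul_neg, ← mul_assoc, hyu, zero_mul, neg_zero]
  have hxW (m : Fin 4) (a b : ℕ) : x * extMon u m * (w 0 ^ (a + 1) * w 1 ^ b) = 0 := by
    rw [pow_succ', mul_assoc (w 0), ← mul_assoc, mul_assoc x, hwE, ← mul_assoc x, hxw]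
    simp
  have hyW (m : Fin 4) (a b : ℕ) : y * extMon u m * (w 0 ^ a * w 1 ^ (b + 1)) = 0 := by
    rw [pow_succ', ← mul_assoc (w 0 ^ a), ((show Commute (w 1) (w 0) from hww).pow_right a).symm.eq,
      mul_assoc (w 1), ← mul_assoc, mul_assoc y, hwE, ← mul_assoc y, hyw]
    simp
  fin_cases m
  · exact .inr ⟨.sq m' a b, by simp [NegOneIdx.prod]⟩
  · change x * extMon u m' * (w 0 ^ a * w 1 ^ b) = 0 ∨
      ∃ t : NegOneIdx, x * extMon u m' * (w 0 ^ a * w 1 ^ b) = t.prod x y u w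
    rcases a with _ | a
    · by_cases h : m' = 1 ∨ m' = 3
      · left; rw [hxE m' h, zero_mul]
      · right
        obtain rfl | rfl : m' = 0 ∨ m' = 2 := by omega
        · exact ⟨.x b, by simp [NegOneIdx.prod, extMon]⟩
        · exact ⟨.xu b, by simp [NegOneIdx.prod, extMon]⟩
    · exact .inl (hxW _ _ _)
  · change y * extMon u m' * (w 0 ^ a * w 1 ^ b) = 0 ∨
      ∃ t : NegOneIdx, y * extMon u m' * (w 0 ^ a * w 1 ^ b) = t.prod x y u w
    rcases b with _ | b
    · by_cases h : m' = 2 ∨ m' = 3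
      · left; rw [hyE m' h, zero_mul]
      · right
        obtain rfl | rfl : m' = 0 ∨ m' = 1 := by omega
        · exact ⟨.y a, by simp [NegOneIdx.prod, extMon]⟩
        · exact ⟨.yu a, by simp [NegOneIdx.prod, extMon]⟩
    · exact .inl (hyW _ _ _)
  · change y * x * extMon u m' * (w 0 ^ a * w 1 ^ b) = 0 ∨
      ∃ t : NegOneIdx, y * x * extMon u m' * (w 0 ^ a * w 1 ^ b) = t.prod x y u w
    rcases a with _ | a
    · rcases b with _ | b
      · by_cases h : m' = 1 ∨ m' = 3
        · left; rw [mul_assoc y, hxE m' h, mul_zero, zero_mul]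
        · obtain rfl | rfl : m' = 0 ∨ m' = 2 := by omega
          · exact .inr ⟨.yx, by simp [NegOneIdx.prod, extMon]⟩
          · left; rw [← hxy, mul_assoc x, hyE 2 (.inl rfl), mul_zero, zero_mul]
      · left; rw [← hxy, mul_assoc, mul_assoc, ← mul_assoc y, hyW, mul_zero]
    · left; rw [mul_assoc, mul_assoc, ← mul_assoc x, hxW, mul_zero]

end Span

end QuantumPlane

namespace QuantumPlane

universe u
variable {k : Type u} [Field k]

theorem commute_extAlg {T : Type*} [Ring T] [Algebra k T] {n : ℕ} {Φ : ExtAlg k n →ₐ[k] T} {t : T}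
    (h : ∀ i, t * Φ (extGen k i) = Φ (extGen k i) * t) (a : ExtAlg k n) : t * Φ a = Φ a * t := by
  have : (commutant t).comap Φ = ⊤ := extAlg_subalgebra_eq_top fun j => (mem_commutant (k := k)).2 (h j)
  have ha : a ∈ (commutant t).comap Φ := by rw [this]; trivial
  exact (mem_commutant (k := k)).1 ha

theorem span_extMon_eq_top :
    Submodule.span k (Set.range (extMon fun i : Fin 2 => extGen k i)) = ⊤ := by
  have := span_extMon_mul_eq_top (k := k) (fun i : Fin 2 => extGen k i) (fun i : Fin 0 => i.elim0)
    (fun A h _ => extAlg_subalgebra_eq_top h) (fun i => extGen_mul_self i) (extGen_mul_comm 1 0)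
    (fun i => i.elim0) (fun _ : Unit => 1) ⟨(), rfl⟩ (fun i => i.elim0)
  rw [← this]
  congr 1
  ext v
  constructor
  · rintro ⟨m, rfl⟩
    exact ⟨(m, ()), mul_one _⟩
  · rintro ⟨⟨m, -⟩, rfl⟩
    exact ⟨m, (mul_one _).symm⟩

theorem span_tmul_eq_top {A B ι κ : Type*} [Ring A] [Algebra k A] [Ring B] [Algebra k B] {f : ι → A}
    {g : κ → B} (hf : Submodule.span k (Set.range f) = ⊤) (hg : Submodule.span k (Set.range g) = ⊤) :
    Submodule.span k (Set.range fun t : ι × κ => f t.1 ⊗ₜ[k] g t.2) = ⊤ := by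
  rw [← TensorProduct.map₂_mk_top_top_eq_top k A B, ← hf, ← hg, Submodule.map₂_span_span,
    Set.image2_range]
  rfl

/-- The coefficients of the classes of the products of generators. -/
def NegOneIdx.coeff : NegOneIdx → k
  | sq m _ _ => extCoeff (-1) m
  | _ => 1

theorem NegOneIdx.coeff_ne_zero (t : NegOneIdx) : t.coeff (k := k) ≠ 0 := by
  cases t with
  | sq m a b => exact extCoeff_ne_zero (by simp) m
  | _ => exact one_ne_zero

/-- The powers of `q` drop out since the generators `w₀` and `w₁` sit at even positions; only the
product `u₀u₁` could contribute a sign. -/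
theorem NegOneIdx.prod_monCls (h2 : ringChar k ≠ 2) (t : NegOneIdx) :
    t.prod (monCls (-1 : k) 1 0 0) (monCls (-1 : k) 2 0 0) (extCls (-1 : k))
      ![monCls (-1 : k) 0 2 0, monCls (-1 : k) 0 0 2] =
      t.coeff (k := k) • monCls (-1 : k) t.toTriple.1 t.toTriple.2.1 t.toTriple.2.2 := by
  have hq : (-1 : k) ≠ 0 := by simp
  have h1 (n : ℕ) : (-1 : k) ^ (2 * n) = 1 := by rw [pow_mul]; simp
  have hsq (a b : ℕ) : Sq (-1 : k) (2 * a) (2 * b) := (sq_neg_one_iff h2).2 (by simp)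
  have hw0 (a : ℕ) : monCls (-1 : k) 0 2 0 ^ a = monCls (-1 : k) 0 (2 * a) 0 := by
    have := (monCls_zero_pow (hsq 1 0) (h1 0) a).2
    simpa [mul_comm] using this
  have hw1 (b : ℕ) : monCls (-1 : k) 0 0 2 ^ b = monCls (-1 : k) 0 0 (2 * b) := by
    have := (monCls_zero_pow (hsq 0 1) (h1 1) b).2
    simpa [mul_comm] using this
  have s1 : Surv (-1 : k) 1 0 0 := (NegOneIdx.x 0).surv h2
  have s2 : Surv (-1 : k) 2 0 0 := (NegOneIdx.y 0).surv h2
  have s3 : Surv (-1 : k) 3 0 1 := (NegOneIdx.xu 0).surv h2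
  have s4 : Surv (-1 : k) 3 1 0 := (NegOneIdx.yu 0).surv h2
  cases t with
  | sq m a b =>
    change extMon (extCls (-1 : k)) m * (monCls (-1 : k) 0 2 0 ^ a * monCls (-1 : k) 0 0 2 ^ b) = _
    rw [hw0, hw1, monCls_zero_mul (hsq a 0) (h1 0) (hsq 0 b), mul_zero, zero_add, add_zero,
      extMon_extCls_mul hq (hsq a b) (h1 a)]
    rfl
  | x b =>
    change monCls (-1 : k) 1 0 0 * monCls (-1 : k) 0 0 2 ^ b = (1 : k) • monCls (-1 : k) 1 0 (2 * b)
    rw [hw1, one_smul]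
    exact cls_mul_monCls_zero s1.mem (hsq 0 b)
  | xu b =>
    change monCls (-1 : k) 1 0 0 * monCls (-1 : k) 2 0 1 * monCls (-1 : k) 0 0 2 ^ b =
      (1 : k) • monCls (-1 : k) 3 0 (2 * b + 1)
    rw [hw1, monCls_mul s1 (surv_u1 hq), smul_mul_assoc]
    change (_ * - -1 : k) • (monCls (-1 : k) 3 0 1 * _) = _
    rw [monCls_mul s3 (surv_zero.2 (hsq 0 b))]
    simp [monCoeff, monIdx, add_comm]
  | y a =>
    change monCls (-1 : k) 2 0 0 * monCls (-1 : k) 0 2 0 ^ a = (1 : k) • monCls (-1 : k) 2 (2 * a) 0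
    rw [hw0, one_smul]
    exact cls_mul_monCls_zero s2.mem (hsq a 0)
  | yu a =>
    change monCls (-1 : k) 2 0 0 * monCls (-1 : k) 1 1 0 * monCls (-1 : k) 0 2 0 ^ a =
      (1 : k) • monCls (-1 : k) 3 (2 * a + 1) 0
    rw [hw0, monCls_mul s2 (surv_u0 hq), smul_mul_assoc]
    change (_ * 1 : k) • (monCls (-1 : k) 3 1 0 * _) = _
    rw [monCls_mul s4 (surv_zero.2 (hsq a 0))]
    simp [monCoeff, monIdx, add_comm]
  | yx =>
    change monCls (-1 : k) 2 0 0 * monCls (-1 : k) 1 0 0 = (1 : k) • monCls (-1 : k) 3 0 0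
    rw [monCls_mul s2 s1]
    simp [monCoeff, monIdx]

theorem map_negOneIdx_prod {S T : Type*} [Ring S] [Ring T] [Algebra k S] [Algebra k T]
    (Φ : S →ₐ[k] T) (x y : S) (u w : Fin 2 → S) (t : NegOneIdx) :
    Φ (t.prod x y u w) = t.prod (Φ x) (Φ y) (fun i => Φ (u i)) fun i => Φ (w i) := by
  cases t with
  | sq m a b => fin_cases m <;> simp [NegOneIdx.prod, extMon]
  | _ => simp [NegOneIdx.prod]

/-- The map to the Hochschild cohomology ring before division by the relations. -/
theorem exists_negOne_lift (h2 : ringChar k ≠ 2) :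
    ∃ Ψ : Poly k (Lam (-1 : k) ⊗[k] ExtAlg k 2) 2 →ₐ[k] HHRing k (Lam (-1 : k)),
      (∀ a, Ψ (cst (a ⊗ₜ 1)) = cls a 0 0) ∧ (∀ i, Ψ (cst (1 ⊗ₜ extGen k i)) = extCls (-1) i) ∧
      ∀ i, Ψ (polyVar k _ i) =
        (![monCls (-1 : k) 0 2 0, monCls (-1 : k) 0 0 2] : Fin 2 → HHRing k (Lam (-1 : k))) i := by
  have hq : (-1 : k) ≠ 0 := by simp
  have s0 : ∀ m, Surv (-1 : k) m 0 0 := by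
    intro m
    fin_cases m
    exacts [(NegOneIdx.sq 0 0 0).surv h2, (NegOneIdx.x 0).surv h2, (NegOneIdx.y 0).surv h2,
      surv_three_zero_zero]
  have hc := eVec_mem_koszulCocycles s0
  obtain ⟨Φ, hΦ⟩ := exists_lam_lift s0
  obtain ⟨Θ, hΘ⟩ := exists_extAlg_lift (k := k) (extCls (-1 : k)) (extCls_mul_self hq)
    (extCls_mul_comm hq)
  have hcom (a : Lam (-1 : k)) (i : Fin 2) : Φ a * extCls (-1) i = extCls (-1) i * Φ a := by
    rw [← sum_coord_smul_mon a, map_sum, Finset.sum_mul, Finset.mul_sum]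
    refine Finset.sum_congr rfl fun m _ => ?_
    rw [map_smul, smul_mul_assoc, mul_smul_comm, hΦ]
    congr 1
    fin_cases i
    · refine (monCls_mul (s0 m) (surv_u0 hq)).trans (Eq.trans ?_ (monCls_mul (surv_u0 hq) (s0 m)).symm)
      fin_cases m <;> simp [monCoeff, monIdx]
    · refine (monCls_mul (s0 m) (surv_u1 hq)).trans (Eq.trans ?_ (monCls_mul (surv_u1 hq) (s0 m)).symm)
      fin_cases m <;> simp [monCoeff, monIdx]
  have hcom' (a : Lam (-1 : k)) (e : ExtAlg k 2) : Commute (Φ a) (Θ e) :=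
    commute_extAlg (fun i => by rw [hΘ, hcom]) e
  let a : Fin 2 → ℕ := ![2, 0]
  let b : Fin 2 → ℕ := ![0, 2]
  have hab (i : Fin 2) : Sq (-1 : k) (a i) (b i) := by
    rw [sq_neg_one_iff h2]
    fin_cases i <;> simp [a, b]
  have ha (i : Fin 2) : (-1 : k) ^ a i = 1 := by fin_cases i <;> simp [a]
  have hb (i : Fin 2) : (-1 : k) ^ b i = 1 := by fin_cases i <;> simp [b]
  obtain ⟨Ξ, hΞ1, hΞ2⟩ : ∃ Ξ : Lam (-1 : k) ⊗[k] ExtAlg k 2 →ₐ[k] HHRing k (Lam (-1 : k)),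
      (∀ a, Ξ (a ⊗ₜ 1) = Φ a) ∧ ∀ e, Ξ (1 ⊗ₜ e) = Θ e :=
    ⟨Algebra.TensorProduct.lift Φ Θ hcom', by simp, by simp⟩
  have hΞw (i : Fin 2) (x : Lam (-1 : k) ⊗[k] ExtAlg k 2) :
      monCls (-1 : k) 0 (a i) (b i) * Ξ x = Ξ x * monCls (-1 : k) 0 (a i) (b i) := by
    have ht : (commutant (monCls (-1 : k) 0 (a i) (b i))).comap Ξ = ⊤ := by
      refine tensor_subalgebra_eq_top (fun y => (mem_commutant (k := k)).2 ?_)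
        fun e => (mem_commutant (k := k)).2 ?_
      · change _ * Ξ (y ⊗ₜ 1) = Ξ (y ⊗ₜ 1) * _
        rw [hΞ1, hΦ, monCls_zero_mul_cls (hc y) (hab i), cls_mul_monCls_zero (hc y) (hab i)]
      · change _ * Ξ (1 ⊗ₜ e) = Ξ (1 ⊗ₜ e) * _
        rw [hΞ2]
        exact commute_extAlg (fun j => by
          rw [hΘ, monCls_zero_mul_extCls hq (hab i) (hb i) (ha i)]) e
    have hx : x ∈ (commutant (monCls (-1 : k) 0 (a i) (b i))).comap Ξ := by rw [ht]; trivial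
    exact (mem_commutant (k := k)).1 hx
  obtain ⟨Ψ, h3, h4⟩ := exists_poly_lift (R := Lam (-1 : k) ⊗[k] ExtAlg k 2) Ξ
    (fun i => monCls (-1 : k) 0 (a i) (b i))
    (fun i j => by
      rw [monCls_zero_mul (hab i) (hb i) (hab j), monCls_zero_mul (hab j) (hb j) (hab i),
        add_comm, add_comm (b i)]) hΞw
  refine ⟨Ψ, fun x => ?_, fun i => ?_, fun i => ?_⟩
  · rw [h3, hΞ1, hΦ]
  · rw [h3, hΞ2, hΘ]
  · rw [h4]
    fin_cases i <;> rfl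

/-- Before division by the relations the algebra is spanned by products of a monomial of `Λ`, an
exterior monomial and powers of `w₀` and `w₁`. By `exists_negOneIdx_prod` the relations kill all of
them except the indexed ones. -/
theorem span_negOneIdx_prod_eq_top {T : Type*} [Ring T] [Algebra k T]
    (π : Poly k (Lam (-1 : k) ⊗[k] ExtAlg k 2) 2 →ₐ[k] T) (hs : Function.Surjective π)
    (h : ∀ a ∈ relD (-1 : k), π a = 0) :
    Submodule.span k (Set.range fun t : NegOneIdx => t.prod (π (cst (Lam.x (-1 : k) ⊗ₜ 1)))
      (π (cst (Lam.y (-1 : k) ⊗ₜ 1))) (fun i => π (cst (1 ⊗ₜ extGen k i)))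
      fun i => π (polyVar k _ i)) = ⊤ := by
  have hxu (a : Lam (-1 : k)) (e : ExtAlg k 2) :
      π (cst (a ⊗ₜ 1)) * π (cst (1 ⊗ₜ e)) = π (cst (a ⊗ₜ e)) := by
    rw [← map_mul, cst_mul_cst, Algebra.TensorProduct.tmul_mul_tmul, mul_one, one_mul]
  have hxx (a b : Lam (-1 : k)) :
      π (cst (a ⊗ₜ 1)) * π (cst (b ⊗ₜ 1)) = π (cst ((a * b) ⊗ₜ 1)) := by
    rw [← map_mul, cst_mul_cst, Algebra.TensorProduct.tmul_mul_tmul, mul_one]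
  have huu (a b : ExtAlg k 2) :
      π (cst (1 ⊗ₜ a)) * π (cst (1 ⊗ₜ b)) = π (cst (1 ⊗ₜ (a * b))) := by
    rw [← map_mul, cst_mul_cst, Algebra.TensorProduct.tmul_mul_tmul, mul_one]
  have h1 : π (cst (1 ⊗ₜ 1)) = 1 := map_one π
  have hwc (i : Fin 2) (a : Lam (-1 : k) ⊗[k] ExtAlg k 2) :
      π (polyVar k _ i) * π (cst a) = π (cst a) * π (polyVar k _ i) := by
    rw [← map_mul, polyVar_mul_cst, map_mul]
  have hww : π (polyVar k _ 1) * π (polyVar k _ 0) = π (polyVar k _ 0) * π (polyVar k _ 1) := by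
    rw [← map_mul, polyVar_mul_comm, map_mul]
  have hxw : π (cst (Lam.x (-1 : k) ⊗ₜ 1)) * π (polyVar k _ 0) = 0 := by
    rw [← map_mul]
    exact h _ (by simp)
  have hyw : π (cst (Lam.y (-1 : k) ⊗ₜ 1)) * π (polyVar k _ 1) = 0 := by
    rw [← map_mul]
    exact h _ (by simp)
  have hxy : Lam.x (-1 : k) * Lam.y (-1 : k) = Lam.y (-1 : k) * Lam.x (-1 : k) := by
    rw [Lam.x_mul_y, neg_neg, one_smul]
  have hxu0 := (hxu (Lam.x (-1 : k)) (extGen k 0)).trans (h _ (by simp))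
  have hyu1 := (hxu (Lam.y (-1 : k)) (extGen k 1)).trans (h _ (by simp))
  have hu : π (cst (1 ⊗ₜ extGen k 0)) * π (cst (1 ⊗ₜ extGen k 1)) =
      -(π (cst (1 ⊗ₜ extGen k 1)) * π (cst (1 ⊗ₜ extGen k 0))) := by
    rw [huu, huu, extGen_mul_comm 0 1, TensorProduct.tmul_neg, cst_neg, map_neg]
  have hprod := exists_negOneIdx_prod (u := fun i => π (cst (1 ⊗ₜ extGen k i)))
    (w := fun i => π (polyVar k _ i)) hxu0 hyu1 hxw hyw (by rw [hxx, hxx, hxy]) hu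
    (fun i j => hwc i _) hww
  have hmon (m : Fin 4) : π (cst (mon (-1) m ⊗ₜ 1)) = (![1, π (cst (Lam.x (-1 : k) ⊗ₜ 1)),
      π (cst (Lam.y (-1 : k) ⊗ₜ 1)), π (cst (Lam.y (-1 : k) ⊗ₜ 1)) * π (cst (Lam.x (-1 : k) ⊗ₜ 1))] :
        Fin 4 → T) m := by
    fin_cases m
    exacts [h1, rfl, rfl, (hxx _ _).symm]
  have hext (m : Fin 4) : π (cst (1 ⊗ₜ extMon (fun i : Fin 2 => extGen k i) m)) =
      extMon (fun i => π (cst (1 ⊗ₜ extGen k i))) m := by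
    fin_cases m
    exacts [h1, rfl, rfl, (huu _ _).symm]
  have htop := span_cst_mul_pow_eq_top _ (span_tmul_eq_top (span_mon_eq_top (q := (-1 : k)))
    (span_extMon_eq_top (k := k)))
  rw [eq_top_iff]
  rw [← (LinearMap.range_eq_top (f := π.toLinearMap)).2 hs, LinearMap.range_eq_map, ← htop,
    Submodule.map_span, Submodule.span_le]
  rintro _ ⟨_, ⟨⟨⟨m, m'⟩, a, b⟩, rfl⟩, rfl⟩
  have e : π (cst (mon (-1) m ⊗ₜ extMon (fun i : Fin 2 => extGen k i) m') *
      (polyVar k _ 0 ^ a * polyVar k _ 1 ^ b)) =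
      π (cst (mon (-1) m ⊗ₜ 1)) * π (cst (1 ⊗ₜ extMon (fun i : Fin 2 => extGen k i) m')) *
        (π (polyVar k _ 0) ^ a * π (polyVar k _ 1) ^ b) := by
    rw [map_mul, hxu, map_mul, map_pow, map_pow]
  change π (cst (mon (-1) m ⊗ₜ extMon (fun i : Fin 2 => extGen k i) m') *
    (polyVar k _ 0 ^ a * polyVar k _ 1 ^ b)) ∈ _
  rw [e, hmon, hext]
  rcases hprod m m' a b with h | ⟨t, ht⟩
  · rw [h]; exact Submodule.zero_mem _
  · rw [ht]; exact Submodule.subset_span ⟨t, rfl⟩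

theorem exists_presD (h2 : ringChar k ≠ 2) : ∃ ψ : HHRing k (Lam (-1 : k)) ≃ₐ[k] PresD (-1 : k),
    (∀ a : Lam (-1 : k), Sends ψ 0 (eVec a 0) (quotMk k (relD (-1 : k)) (cst (a ⊗ₜ 1)))) ∧
    Sends ψ 1 (eVec (Lam.x (-1 : k)) 0) (quotMk k (relD (-1 : k)) (cst (1 ⊗ₜ extGen k 0))) ∧
    Sends ψ 1 (eVec (Lam.y (-1 : k)) 1) (quotMk k (relD (-1 : k)) (cst (1 ⊗ₜ extGen k 1))) ∧
    Sends ψ 2 (eVec 1 0) (quotMk k (relD (-1 : k)) (polyVar k _ 0)) ∧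
    Sends ψ 2 (eVec 1 2) (quotMk k (relD (-1 : k)) (polyVar k _ 1)) := by
  have hq : (-1 : k) ≠ 0 := by simp
  have s0 : ∀ m, Surv (-1 : k) m 0 0 := by
    intro m
    fin_cases m
    exacts [(NegOneIdx.sq 0 0 0).surv h2, (NegOneIdx.x 0).surv h2, (NegOneIdx.y 0).surv h2,
      surv_three_zero_zero]
  have sw0 : Surv (-1 : k) 0 2 0 := (NegOneIdx.sq 0 1 0).surv h2
  have sw1 : Surv (-1 : k) 0 0 2 := (NegOneIdx.sq 0 0 1).surv h2
  obtain ⟨Φ, hΦa, hΦu, hΦw⟩ := exists_negOne_lift h2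
  have hΦxu (a : Lam (-1 : k)) (i : Fin 2) : Φ (cst (a ⊗ₜ extGen k i)) = cls a 0 0 * extCls (-1) i := by
    rw [← hΦa, ← hΦu, ← map_mul, cst_mul_cst, Algebra.TensorProduct.tmul_mul_tmul, mul_one, one_mul]
  obtain ⟨Ψ, hΨ⟩ := exists_quot_lift (S := relD (-1 : k)) Φ (by
    rintro _ (rfl | rfl | rfl | rfl)
    · rw [hΦxu]
      exact (monCls_mul (s0 1) (surv_u0 hq)).trans (by simp [monCoeff])
    · rw [hΦxu]
      exact (monCls_mul (s0 2) (surv_u1 hq)).trans (by simp [monCoeff])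
    · rw [map_mul, hΦa, hΦw]
      -- The product `x w₀` is `x` at the position `(2, 0)`, a corner of the square at `(1, 0)`,
      -- which does not survive because `1` is odd. The product `y w₁` is treated symmetrically.
      refine (cls_mul_monCls_zero (s0 1).mem (surv_zero.1 sw0)).trans (cls_mon_eq_zero hq fun h => ?_)
      have := (sq_neg_one_iff h2).1 ((surv_one_succ hq).1 h)
      exact absurd this.1 (by decide)
    · rw [map_mul, hΦa, hΦw]
      refine (cls_mul_monCls_zero (s0 2).mem (surv_zero.1 sw1)).trans (cls_mon_eq_zero hq fun h => ?_)
      have := (sq_neg_one_iff h2).1 ((surv_two_succ hq).1 h)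
      exact absurd this.2 (by decide))
  have hspan := span_negOneIdx_prod_eq_top (quotMk k (relD (-1 : k)))
    (RingQuot.mkAlgHom_surjective k _) fun a ha => quotMk_eq_zero ha
  have hu (i : Fin 2) : Ψ (quotMk k (relD (-1 : k)) (cst (1 ⊗ₜ extGen k i))) = extCls (-1 : k) i :=
    (hΨ _).trans (hΦu i)
  have hw (i : Fin 2) : Ψ (quotMk k (relD (-1 : k)) (polyVar k _ i)) =
      (![monCls (-1 : k) 0 2 0, monCls (-1 : k) 0 0 2] : Fin 2 → HHRing k (Lam (-1 : k))) i :=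
    (hΨ _).trans (hΦw i)
  obtain ⟨B, hB⟩ := exists_negOneBasis h2
  have hbij : Function.Bijective Ψ :=
    bijective_of_span B Ψ.toLinearMap _ hspan (fun t => t.coeff) (fun t => t.coeff_ne_zero)
      fun t => by
        rw [hB, ← NegOneIdx.prod_monCls h2, AlgHom.toLinearMap_apply, map_negOneIdx_prod, hΨ, hΨ, hΦa, hΦa]
        simp only [hu, hw]
        rfl
  let E := AlgEquiv.ofBijective Ψ hbij
  exact ⟨E.symm, fun a => sends_symm E id (p := 0) rfl (eVec_mem_koszulCocycles s0 a)
      ((hΨ _).trans (hΦa a)) rfl,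
    sends_symm E id (p := 1) rfl (surv_u0 hq).mem (hu 0) rfl,
    sends_symm E id (p := 0) rfl (surv_u1 hq).mem (hu 1) rfl,
    sends_symm E id (p := 2) rfl sw0.mem (hw 0) rfl,
    sends_symm E id (p := 0) rfl sw1.mem (hw 1) rfl⟩

end QuantumPlane

/-! ### The ring for `q = 1` in characteristic different from `2`. -/

namespace QuantumPlane

universe u
variable {k : Type u} [Field k]

section Span

variable {T : Type*} [Ring T]

/-- The common value of `a W(p - 1, s)` and `b W(p, s - 1)` for the monomials `W` on the conic. -/
def pairMon (a b : T) (w : Fin 3 → T) (p s : ℕ) : T :=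
  if p = 0 then b * conicMon w 0 (s - 1) else a * conicMon w (p - 1) s

theorem mul_conicMon_left (a b : T) (w : Fin 3 → T) (p s : ℕ) :
    a * conicMon w p s = pairMon a b w (p + 1) s := by
  rw [pairMon, if_neg (by omega), Nat.add_sub_cancel]

/-- According to parity a factor `w₁` or `w₀` is split off from the monomial and exchanged by `b w₁
= a w₂` or `b w₀ = a w₁`. Thus multiples of `b` reduce to multiples of `a` as soon as `p > 0`. -/
theorem mul_conicMon_right {a b : T} {w : Fin 3 → T} (hw : ∀ i j, w i * w j = w j * w i)
    (hc : w 0 * w 2 = w 1 ^ 2) (h1 : a * w 1 = b * w 0) (h2 : a * w 2 = b * w 1) {p s : ℕ}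
    (h : Even (p + s)) : b * conicMon w p s = pairMon a b w p (s + 1) := by
  rcases p with _ | p
  · rw [pairMon, if_pos rfl, Nat.add_sub_cancel]
  rw [pairMon, if_neg (by omega), Nat.add_sub_cancel]
  rcases Nat.even_or_odd p with hp | hp
  · obtain ⟨s, rfl⟩ : ∃ s', s = s' + 1 := ⟨s - 1, by
      obtain ⟨c, hc⟩ := hp
      obtain ⟨d, hd⟩ := h
      omega⟩
    have h' : Even (p + s) := by
      obtain ⟨d, hd⟩ := h
      exact ⟨d - 1, by omega⟩
    rw [← mul_conicMon_one w hw hc h', ← mul_assoc, ← h2, mul_assoc, mul_conicMon_two w hw]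
  · obtain ⟨p, rfl⟩ : ∃ p', p = p' + 1 := ⟨p - 1, by
      obtain ⟨c, hc⟩ := hp
      omega⟩
    have h' : Even (p + s) := by
      obtain ⟨d, hd⟩ := h
      exact ⟨d - 1, by omega⟩
    rw [← mul_conicMon_zero, ← mul_assoc, ← h1, mul_assoc, mul_conicMon_one w hw hc h']

theorem pairMon_cases (a b : T) (w : Fin 3 → T) {p s : ℕ} (h : Even (p + s + 1)) :
    (∃ p', p = p' + 1 ∧ Even (p' + s) ∧ pairMon a b w p s = a * conicMon w p' s) ∨
    ∃ s', p = 0 ∧ s = s' + 1 ∧ Even (0 + s') ∧ pairMon a b w p s = b * conicMon w 0 s' := by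
  obtain ⟨d, hd⟩ := h
  rcases p with _ | p
  · exact .inr ⟨s - 1, rfl, by omega, ⟨d - 1, by omega⟩, by rw [pairMon, if_pos rfl]⟩
  · exact .inl ⟨p, rfl, ⟨d - 1, by omega⟩, (mul_conicMon_left a b w p s).symm⟩

/-- The products of generators that form a basis for `q = 1`. -/
def oneProd (z : T) (u : Fin 4 → T) (w : Fin 3 → T) (m : Fin 4) (p s : ℕ) : T :=
  (![conicMon w p s, pairMon (u 0) (u 2) w p s, pairMon (u 1) (u 3) w p s, z * conicMon w p s] :
    Fin 4 → T) m

/-- The span contains `1` and is stable under left multiplication by the generators: `z` kills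
itself and the `uᵢ`, a product of two `uᵢ` is a multiple of some `z wₗ`, and the `wᵢ` are central
and move along the conic. -/
theorem span_oneProd_eq_top [Algebra k T] (h2 : ringChar k ≠ 2) {z : T} {u : Fin 4 → T}
    {w : Fin 3 → T} (hgen : ∀ A : Subalgebra k T, z ∈ A → (∀ i, u i ∈ A) → (∀ i, w i ∈ A) → A = ⊤)
    (hww : ∀ i j, w i * w j = w j * w i) (hc : w 0 * w 2 = w 1 ^ 2) (hwz : ∀ i, w i * z = z * w i)
    (hwu : ∀ i j, w i * u j = u j * w i) (hzz : z * z = 0) (hzu : ∀ i, z * u i = 0)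
    (huz : ∀ i, u i * z = 0) (huu : ∀ i j, ∃ (c : k) (l : Fin 3), u i * u j = c • (z * w l))
    (h01 : u 0 * w 1 = u 2 * w 0) (h02 : u 0 * w 2 = u 2 * w 1) (h11 : u 1 * w 1 = u 3 * w 0)
    (h12 : u 1 * w 2 = u 3 * w 1) :
    Submodule.span k (Set.range fun t : SurvIdx (1 : k) => oneProd z u w t.1.1 t.1.2.1 t.1.2.2) =
      ⊤ := by
  set V := Submodule.span k
    (Set.range fun t : SurvIdx (1 : k) => oneProd z u w t.1.1 t.1.2.1 t.1.2.2) with hV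
  have mem {m : Fin 4} {p s : ℕ} (h : Surv (1 : k) m p s) : oneProd z u w m p s ∈ V :=
    Submodule.subset_span ⟨⟨(m, p, s), h⟩, rfl⟩
  have memW {p s : ℕ} (h : Even (p + s)) : conicMon w p s ∈ V :=
    mem (m := 0) ((surv_one_iff h2).2 (by simpa using h))
  have memZ {p s : ℕ} (h : Even (p + s)) : z * conicMon w p s ∈ V :=
    mem (m := 3) ((surv_one_iff h2).2 (by simpa using h))
  have memU (i : Fin 4) {p s : ℕ} (h : Even (p + s)) : u i * conicMon w p s ∈ V := by
    have e1 : Even (p + 1 + s + 1) := by obtain ⟨d, hd⟩ := h; exact ⟨d + 1, by omega⟩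
    have e2 : Even (p + (s + 1) + 1) := by obtain ⟨d, hd⟩ := h; exact ⟨d + 1, by omega⟩
    fin_cases i
    · exact (mul_conicMon_left (u 0) (u 2) w p s) ▸
        mem (m := 1) (p := p + 1) ((surv_one_iff h2).2 (by simpa using e1))
    · exact (mul_conicMon_left (u 1) (u 3) w p s) ▸
        mem (m := 2) (p := p + 1) ((surv_one_iff h2).2 (by simpa using e1))
    · exact (mul_conicMon_right hww hc h01 h02 h) ▸
        mem (m := 1) (s := s + 1) ((surv_one_iff h2).2 (by simpa using e2))
    · exact (mul_conicMon_right hww hc h11 h12 h) ▸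
        mem (m := 2) (s := s + 1) ((surv_one_iff h2).2 (by simpa using e2))
  have hwW (i : Fin 3) {p s : ℕ} (h : Even (p + s)) :
      ∃ p' s', Even (p' + s') ∧ w i * conicMon w p s = conicMon w p' s' := by
    obtain ⟨d, hd⟩ := h
    fin_cases i
    · exact ⟨p + 2, s, ⟨d + 1, by omega⟩, mul_conicMon_zero w p s⟩
    · exact ⟨p + 1, s + 1, ⟨d + 1, by omega⟩, mul_conicMon_one w hww hc ⟨d, hd⟩⟩
    · exact ⟨p, s + 2, ⟨d + 1, by omega⟩, mul_conicMon_two w hww p s⟩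
  have key (c : T) (h0 : ∀ p s, Even (p + s) → c * conicMon w p s ∈ V)
      (h1 : ∀ i p s, Even (p + s) → c * (u i * conicMon w p s) ∈ V)
      (h3 : ∀ p s, Even (p + s) → c * (z * conicMon w p s) ∈ V) : c ∈ leftStable V := by
    refine mem_leftStable_span ?_
    rintro ⟨⟨m, p, s⟩, ht⟩
    change Surv (1 : k) m p s at ht
    change c * oneProd z u w m p s ∈ V
    rw [surv_one_iff h2] at ht
    fin_cases m
    · exact h0 p s (by simpa using ht)
    · have ht : Even (p + s + 1) := by simpa using ht
      change c * pairMon (u 0) (u 2) w p s ∈ V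
      rcases pairMon_cases (u 0) (u 2) w ht with ⟨_, -, he, e⟩ | ⟨_, -, -, he, e⟩
      · rw [e]; exact h1 0 _ _ he
      · rw [e]; exact h1 2 _ _ he
    · have ht : Even (p + s + 1) := by simpa using ht
      change c * pairMon (u 1) (u 3) w p s ∈ V
      rcases pairMon_cases (u 1) (u 3) w ht with ⟨_, -, he, e⟩ | ⟨_, -, -, he, e⟩
      · rw [e]; exact h1 1 _ _ he
      · rw [e]; exact h1 3 _ _ he
    · exact h3 p s (by simpa using ht)
  refine eq_top_of_leftStable ?_ (hgen _ (key z (fun p s h => memZ h) ?_ ?_)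
    (fun i => key (u i) (fun p s h => memU i h) ?_ ?_) fun i => key (w i) ?_ ?_ ?_)
  · simpa [conicMon] using memW (p := 0) (s := 0) (by simp)
  · intro i p s h
    rw [← mul_assoc, hzu, zero_mul]
    exact V.zero_mem
  · intro p s h
    rw [← mul_assoc, hzz, zero_mul]
    exact V.zero_mem
  · intro j p s h
    obtain ⟨c, l, e⟩ := huu i j
    obtain ⟨p', s', h', e'⟩ := hwW l h
    rw [← mul_assoc, e, smul_mul_assoc, mul_assoc, e']
    exact V.smul_mem _ (memZ h')
  · intro p s h
    rw [← mul_assoc, huz, zero_mul]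
    exact V.zero_mem
  · intro p s h
    obtain ⟨p', s', h', e'⟩ := hwW i h
    rw [e']
    exact memW h'
  · intro j p s h
    obtain ⟨p', s', h', e'⟩ := hwW i h
    rw [← mul_assoc, hwu, mul_assoc, e']
    exact memU j h'
  · intro p s h
    obtain ⟨p', s', h', e'⟩ := hwW i h
    rw [← mul_assoc, hwz, mul_assoc, e']
    exact memZ h'

theorem map_oneProd {S : Type*} [Ring S] [Algebra k S] [Algebra k T] (Φ : S →ₐ[k] T) (z : S)
    (u : Fin 4 → S) (w : Fin 3 → S) (m : Fin 4) (p s : ℕ) : Φ (oneProd z u w m p s) =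
      oneProd (Φ z) (fun i => Φ (u i)) (fun i => Φ (w i)) m p s := by
  have h (a b : S) : Φ (pairMon a b w p s) = pairMon (Φ a) (Φ b) (fun i => Φ (w i)) p s := by
    rw [pairMon, pairMon]
    split_ifs <;> rw [map_mul, map_conicMon]
  fin_cases m
  · exact map_conicMon Φ w p s
  · exact h _ _
  · exact h _ _
  · change Φ (z * _) = _
    rw [map_mul, map_conicMon]
    rfl

end Span

variable (k) in
/-- The classes `u₀, u₁, u₂, u₃` for `q = 1`. -/
noncomputable def oneU : Fin 4 → HHRing k (Lam (1 : k)) :=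
  ![monCls 1 1 1 0, monCls 1 2 1 0, monCls 1 1 0 1, monCls 1 2 0 1]

variable (k) in
/-- The classes `w₀, w₁, w₂` for `q = 1`. -/
noncomputable def oneW : Fin 3 → HHRing k (Lam (1 : k)) :=
  ![monCls 1 0 2 0, monCls 1 0 1 1, monCls 1 0 0 2]

theorem monCls_one_mul {m m' : Fin 4} {p s p' s' : ℕ} (h : Surv (1 : k) m p s)
    (h' : Surv (1 : k) m' p' s') : monCls (1 : k) m p s * monCls (1 : k) m' p' s' =
      monCoeff (1 : k) m m' • monCls (1 : k) (monIdx m m') (p + p') (s + s') := by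
  rw [monCls_mul h h', one_pow, one_mul]

/-- No powers of `q` occur, so each normal form is exactly one basis class; the parity in
`surv_one_iff` is the one under which conic monomials are defined by their position. -/
theorem oneProd_monCls (h2 : ringChar k ≠ 2) {m : Fin 4} {p s : ℕ} (h : Surv (1 : k) m p s) :
    oneProd (monCls (1 : k) 3 0 0) (oneU k) (oneW k) m p s = monCls (1 : k) m p s := by
  have hsq {p s : ℕ} (h : Even (p + s)) : Sq (1 : k) p s := (sq_one_iff h2).2 h
  have hW {p s : ℕ} (h : Even (p + s)) : conicMon (oneW k) p s = monCls (1 : k) 0 p s := by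
    have := monCls_conicMon (q := (1 : k)) (p := 1) (s := 1) (hsq (by decide)) (hsq (by decide))
      (hsq (by decide)) (one_pow _) h
    simp only [mul_one] at this
    exact this
  have su {m : Fin 4} {p s : ℕ} (hm : m = 1 ∨ m = 2) (h : Even (p + s + 1)) :
      Surv (1 : k) m p s := by
    rw [surv_one_iff h2, if_pos hm]
    exact h
  rw [surv_one_iff h2] at h
  have hpair (m : Fin 4) (hm : m = 1 ∨ m = 2) {p s : ℕ} (h : Even (p + s + 1)) :
      pairMon (monCls (1 : k) m 1 0) (monCls (1 : k) m 0 1) (oneW k) p s = monCls (1 : k) m p s := by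
    have hm' : monIdx m 0 = m ∧ monCoeff (1 : k) m 0 = 1 := by
      rcases hm with rfl | rfl <;> exact ⟨rfl, rfl⟩
    rcases pairMon_cases (monCls (1 : k) m 1 0) (monCls (1 : k) m 0 1) (oneW k) h with
      ⟨p', rfl, he, e⟩ | ⟨s', rfl, rfl, he, e⟩
    · rw [e, hW he, monCls_one_mul (su hm (by decide)) (surv_zero.2 (hsq he)), hm'.1, hm'.2, one_smul,
        add_comm, zero_add]
    · rw [e, hW he, monCls_one_mul (su hm (by decide)) (surv_zero.2 (hsq he)), hm'.1, hm'.2, one_smul,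
        add_comm 1, zero_add]
  fin_cases m
  · exact hW (by simpa using h)
  · exact hpair 1 (.inl rfl) (by simpa using h)
  · exact hpair 2 (.inr rfl) (by simpa using h)
  · have h : Even (p + s) := by simpa using h
    change _ * conicMon _ _ _ = _
    rw [hW h, monCls_one_mul surv_three_zero_zero (surv_zero.2 (hsq h))]
    simp [monCoeff, monIdx]

end QuantumPlane

namespace QuantumPlane

universe u
variable {k : Type u} [Field k]

theorem polyE_subalgebra_eq_top {A : Subalgebra k (Poly k (BaseE k) 3)} (hz : zE k ∈ A)
    (hu : ∀ i, uE k i ∈ A) (hw : ∀ i, wE k i ∈ A) : A = ⊤ := by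
  refine poly_subalgebra_eq_top (fun a => ?_) hw
  let g : ExtAlg k 4 →ₐ[k] k := ExteriorAlgebra.algebraMapInv
  let ι : BaseE k →ₐ[k] Poly k (BaseE k) 3 := Algebra.TensorProduct.includeLeft
  have h1 : (A.comap ι).comap (fibreSection g) = ⊤ := extAlg_subalgebra_eq_top fun i => by
    have e : fibreSection g (extGen k i) =
        ⟨(0, extGen k i), by simp [g, ExteriorAlgebra.algebraMapInv]⟩ := by
      refine Subtype.ext ?_
      change (algebraMap k (DualNumber k) (g (extGen k i)), extGen k i) = (0, extGen k i)
      rw [show g (extGen k i) = 0 by simp [g, ExteriorAlgebra.algebraMapInv], map_zero]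
    change fibreSection g (extGen k i) ∈ A.comap ι
    rw [e]
    exact hu i
  have h2 (e : ExtAlg k 4) : fibreSection g e ∈ A.comap ι := by
    have : e ∈ (A.comap ι).comap (fibreSection g) := by rw [h1]; trivial
    exact this
  have h3 : a ∈ A.comap ι := by
    rw [fibre_eq a]
    exact Subalgebra.add_mem _ (h2 _) (Subalgebra.smul_mem _ (show fibreEps g ∈ A.comap ι from hz) _)
  exact h3

/-- The parity of the indices of the generators for `q = 1`. -/
theorem surv_oneU (h2 : ringChar k ≠ 2) :
    (Surv (1 : k) 1 1 0 ∧ Surv (1 : k) 2 1 0) ∧ Surv (1 : k) 1 0 1 ∧ Surv (1 : k) 2 0 1 := by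
  refine ⟨⟨?_, ?_⟩, ?_, ?_⟩ <;> rw [surv_one_iff h2] <;> decide

theorem surv_oneW (h2 : ringChar k ≠ 2) :
    Surv (1 : k) 0 2 0 ∧ Surv (1 : k) 0 1 1 ∧ Surv (1 : k) 0 0 2 := by
  refine ⟨?_, ?_, ?_⟩ <;> rw [surv_one_iff h2] <;> decide

theorem oneU_mul_self (h2 : ringChar k ≠ 2) (i : Fin 4) : oneU k i * oneU k i = 0 := by
  obtain ⟨⟨s0, s1⟩, s2, s3⟩ := surv_oneU h2
  fin_cases i
  · exact (monCls_one_mul s0 s0).trans (by simp [monCoeff])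
  · exact (monCls_one_mul s1 s1).trans (by simp [monCoeff])
  · exact (monCls_one_mul s2 s2).trans (by simp [monCoeff])
  · exact (monCls_one_mul s3 s3).trans (by simp [monCoeff])

/-- The positions commute, and the sign is that of `xy = -yx`; products of entries `x` with `x` or
`y` with `y` are zero. -/
theorem oneU_mul_of_lt (h2 : ringChar k ≠ 2) {i j : Fin 4} (h : i < j) :
    oneU k i * oneU k j = -(oneU k j * oneU k i) := by
  obtain ⟨⟨s0, s1⟩, s2, s3⟩ := surv_oneU h2
  have key {m m' : Fin 4} {p s p' s' : ℕ} (h : Surv (1 : k) m p s) (h' : Surv (1 : k) m' p' s')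
      (hc : monIdx m m' = monIdx m' m) (hm : monCoeff (1 : k) m m' = -monCoeff (1 : k) m' m) :
      monCls (1 : k) m p s * monCls (1 : k) m' p' s' =
        -(monCls (1 : k) m' p' s' * monCls (1 : k) m p s) := by
    rw [monCls_one_mul h h', monCls_one_mul h' h, hc, hm, neg_smul, add_comm, add_comm s]
  fin_cases i <;> fin_cases j <;> first
    | exact absurd h (by decide)
    | exact key ‹_› ‹_› rfl (by simp [monCoeff])

theorem oneU_mul_comm (h2 : ringChar k ≠ 2) (i j : Fin 4) :
    oneU k i * oneU k j = -(oneU k j * oneU k i) := by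
  rcases lt_trichotomy i j with h | rfl | h
  · exact oneU_mul_of_lt h2 h
  · rw [oneU_mul_self h2, neg_zero]
  · rw [oneU_mul_of_lt h2 h, neg_neg]

theorem oneU_mul_z (h2 : ringChar k ≠ 2) (i : Fin 4) :
    oneU k i * monCls 1 3 0 0 = 0 ∧ monCls 1 3 0 0 * oneU k i = 0 := by
  obtain ⟨⟨s0, s1⟩, s2, s3⟩ := surv_oneU h2
  have sz := surv_three_zero_zero (q := (1 : k))
  fin_cases i
  · exact ⟨(monCls_one_mul s0 sz).trans (by simp [monCoeff]),
      (monCls_one_mul sz s0).trans (by simp [monCoeff])⟩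
  · exact ⟨(monCls_one_mul s1 sz).trans (by simp [monCoeff]),
      (monCls_one_mul sz s1).trans (by simp [monCoeff])⟩
  · exact ⟨(monCls_one_mul s2 sz).trans (by simp [monCoeff]),
      (monCls_one_mul sz s2).trans (by simp [monCoeff])⟩
  · exact ⟨(monCls_one_mul s3 sz).trans (by simp [monCoeff]),
      (monCls_one_mul sz s3).trans (by simp [monCoeff])⟩

theorem exists_surv_oneW (h2 : ringChar k ≠ 2) (i : Fin 3) :
    ∃ p s, Surv (1 : k) 0 p s ∧ oneW k i = monCls 1 0 p s := by
  obtain ⟨s0, s1, s2⟩ := surv_oneW h2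
  fin_cases i
  exacts [⟨_, _, s0, rfl⟩, ⟨_, _, s1, rfl⟩, ⟨_, _, s2, rfl⟩]

theorem exists_surv_oneU (h2 : ringChar k ≠ 2) (i : Fin 4) :
    ∃ m p s, Surv (1 : k) m p s ∧ oneU k i = monCls 1 m p s := by
  obtain ⟨⟨s0, s1⟩, s2, s3⟩ := surv_oneU h2
  fin_cases i
  exacts [⟨_, _, _, s0, rfl⟩, ⟨_, _, _, s1, rfl⟩, ⟨_, _, _, s2, rfl⟩, ⟨_, _, _, s3, rfl⟩]

theorem oneW_mul_monCls (h2 : ringChar k ≠ 2) (i : Fin 3) {m : Fin 4} {p s : ℕ}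
    (h : Surv (1 : k) m p s) : oneW k i * monCls 1 m p s = monCls 1 m p s * oneW k i := by
  obtain ⟨p', s', h', e⟩ := exists_surv_oneW h2 i
  rw [e, monCls_one_mul h' h, monCls_one_mul h h', add_comm, add_comm s']
  fin_cases m <;> rfl

/-- The map to the Hochschild cohomology ring before division by the relations. -/
theorem exists_one_lift (h2 : ringChar k ≠ 2) :
    ∃ Ψ : Poly k (BaseE k) 3 →ₐ[k] HHRing k (Lam (1 : k)), Ψ (zE k) = monCls 1 3 0 0 ∧
      (∀ i, Ψ (uE k i) = oneU k i) ∧ ∀ i, Ψ (wE k i) = oneW k i := by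
  have sz := surv_three_zero_zero (q := (1 : k))
  obtain ⟨Φ, hΦ⟩ := exists_extAlg_lift (k := k) (oneU k) (oneU_mul_self h2) (oneU_mul_comm h2)
  let g : ExtAlg k 4 →ₐ[k] k := ExteriorAlgebra.algebraMapInv
  have hg (i : Fin 4) : g (extGen k i) = 0 := by simp [g, ExteriorAlgebra.algebraMapInv]
  have hacts : augActs g Φ (monCls 1 3 0 0) = ⊤ := extAlg_subalgebra_eq_top fun i => by
    change Φ (extGen k i) * _ = g (extGen k i) • _ ∧ _ * Φ (extGen k i) = g (extGen k i) • _
    rw [hΦ, hg, zero_smul]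
    exact oneU_mul_z h2 i
  have hz (s : ExtAlg k 4) : Φ s * monCls (1 : k) 3 0 0 = g s • monCls (1 : k) 3 0 0 ∧
      monCls (1 : k) 3 0 0 * Φ s = g s • monCls (1 : k) 3 0 0 := by
    have : s ∈ augActs g Φ (monCls 1 3 0 0) := by rw [hacts]; trivial
    exact this
  have hzz : monCls (1 : k) 3 0 0 * monCls (1 : k) 3 0 0 = 0 :=
    (monCls_one_mul sz sz).trans (by simp [monCoeff])
  have hww (i j : Fin 3) : oneW k i * oneW k j = oneW k j * oneW k i := by
    obtain ⟨p, s, h, e⟩ := exists_surv_oneW h2 j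
    rw [e, oneW_mul_monCls h2 i h]
  obtain ⟨Ξ, hΞ⟩ : ∃ Ξ : BaseE k →ₐ[k] HHRing k (Lam (1 : k)),
      ∀ a, Ξ a = Φ a.1.2 + a.1.1.snd • monCls (1 : k) 3 0 0 :=
    ⟨fibreLift Φ (monCls 1 3 0 0) hzz (fun s => (hz s).1) (fun s => (hz s).2), fun _ => rfl⟩
  obtain ⟨Ψ, h3, h4⟩ := exists_poly_lift (R := BaseE k) Ξ (oneW k) hww (fun i a => by
    have h1 : oneW k i * Φ a.1.2 = Φ a.1.2 * oneW k i := commute_extAlg (fun j => by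
      obtain ⟨m, p, s, h, e⟩ := exists_surv_oneU h2 j
      rw [hΦ, e, oneW_mul_monCls h2 i h]) _
    rw [hΞ, mul_add, add_mul, h1, mul_smul_comm, smul_mul_assoc, oneW_mul_monCls h2 i sz])
  refine ⟨Ψ, ?_, fun i => ?_, h4⟩
  · rw [h3, hΞ]
    change Φ 0 + (1 : k) • monCls (1 : k) 3 0 0 = _
    rw [map_zero, zero_add, one_smul]
  · rw [h3, hΞ]
    change Φ (extGen k i) + (0 : k) • monCls (1 : k) 3 0 0 = _
    rw [zero_smul, add_zero, hΦ]

/-- In each binomial relation both terms are multiples of one monomial at one position. The signs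
follow the order of the factors: `xy = -yx` gives the relations with `+ z wₗ`, and `yx` the one with
`- z w₁`. -/
theorem map_relE_eq_zero (h2 : ringChar k ≠ 2) {Ψ : Poly k (BaseE k) 3 →ₐ[k] HHRing k (Lam (1 : k))}
    (hz : Ψ (zE k) = monCls 1 3 0 0) (hu : ∀ i, Ψ (uE k i) = oneU k i)
    (hw : ∀ i, Ψ (wE k i) = oneW k i) : ∀ a ∈ relE k, Ψ a = 0 := by
  obtain ⟨⟨s0, s1⟩, s2, s3⟩ := surv_oneU h2
  obtain ⟨t0, t1, t2⟩ := surv_oneW h2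
  have sz := surv_three_zero_zero (q := (1 : k))
  have u0 : Ψ (uE k 0) = monCls 1 1 1 0 := hu 0
  have u1 : Ψ (uE k 1) = monCls 1 2 1 0 := hu 1
  have u2 : Ψ (uE k 2) = monCls 1 1 0 1 := hu 2
  have u3 : Ψ (uE k 3) = monCls 1 2 0 1 := hu 3
  have w0 : Ψ (wE k 0) = monCls 1 0 2 0 := hw 0
  have w1 : Ψ (wE k 1) = monCls 1 0 1 1 := hw 1
  have w2 : Ψ (wE k 2) = monCls 1 0 0 2 := hw 2
  rintro _ (rfl | rfl | rfl | rfl | rfl | rfl | rfl | rfl | rfl | rfl | rfl)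
  · rw [map_mul, u0, u2, monCls_one_mul s0 s2]
    simp [monCoeff]
  · rw [map_mul, u1, u3, monCls_one_mul s1 s3]
    simp [monCoeff]
  · rw [map_add, map_mul, map_mul, u0, u1, hz, w0, monCls_one_mul s0 s1, monCls_one_mul sz t0]
    simp [monCoeff, monIdx]
  · rw [map_add, map_mul, map_mul, u0, u3, hz, w1, monCls_one_mul s0 s3, monCls_one_mul sz t1]
    simp [monCoeff, monIdx]
  · rw [map_add, map_mul, map_mul, u2, u3, hz, w2, monCls_one_mul s2 s3, monCls_one_mul sz t2]
    simp [monCoeff, monIdx]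
  · rw [map_sub, map_mul, map_mul, u1, u2, hz, w1, monCls_one_mul s1 s2, monCls_one_mul sz t1]
    simp [monCoeff, monIdx]
  · rw [map_sub, map_mul, map_mul, u0, w1, u2, w0, monCls_one_mul s0 t1, monCls_one_mul s2 t0]
    simp [monCoeff, monIdx]
  · rw [map_sub, map_mul, map_mul, u1, w1, u3, w0, monCls_one_mul s1 t1, monCls_one_mul s3 t0]
    simp [monCoeff, monIdx]
  · rw [map_sub, map_mul, map_mul, u0, w2, u2, w1, monCls_one_mul s0 t2, monCls_one_mul s2 t1]
    simp [monCoeff, monIdx]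
  · rw [map_sub, map_mul, map_mul, u1, w2, u3, w1, monCls_one_mul s1 t2, monCls_one_mul s3 t1]
    simp [monCoeff, monIdx]
  · rw [map_sub, map_mul, map_pow, w0, w2, w1, sq, monCls_one_mul t0 t2, monCls_one_mul t1 t1]
    simp [monCoeff, monIdx]

theorem uE_mul_self (i : Fin 4) : uE k i * uE k i = 0 := by
  rw [cst_mul_cst]
  have : (⟨(0, extGen k i), by simp [ExteriorAlgebra.algebraMapInv]⟩ : BaseE k) *
      ⟨(0, extGen k i), by simp [ExteriorAlgebra.algebraMapInv]⟩ = 0 :=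
    Subtype.ext (Prod.ext (mul_zero _) (extGen_mul_self i))
  rw [this, cst_zero]

theorem uE_mul_comm (i j : Fin 4) : uE k i * uE k j = -(uE k j * uE k i) := by
  rw [cst_mul_cst, cst_mul_cst, ← cst_neg]
  congr 1
  refine Subtype.ext (Prod.ext ?_ (extGen_mul_comm i j))
  change (0 : DualNumber k) * 0 = -(0 * 0)
  simp

theorem zE_mul_self : zE k * zE k = 0 := by
  rw [cst_mul_cst]
  have : (⟨(DualNumber.eps, 0), by simp⟩ : BaseE k) * ⟨(DualNumber.eps, 0), by simp⟩ = 0 :=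
    Subtype.ext (Prod.ext DualNumber.eps_mul_eps (mul_zero _))
  rw [this, cst_zero]

theorem zE_mul_uE (i : Fin 4) : zE k * uE k i = 0 ∧ uE k i * zE k = 0 := by
  have h1 : (⟨(DualNumber.eps, 0), by simp⟩ : BaseE k) *
      ⟨(0, extGen k i), by simp [ExteriorAlgebra.algebraMapInv]⟩ = 0 :=
    Subtype.ext (Prod.ext (mul_zero _) (zero_mul _))
  have h2 : (⟨(0, extGen k i), by simp [ExteriorAlgebra.algebraMapInv]⟩ : BaseE k) *
      ⟨(DualNumber.eps, 0), by simp⟩ = 0 :=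
    Subtype.ext (Prod.ext (zero_mul _) (mul_zero _))
  rw [cst_mul_cst, cst_mul_cst, h1, h2, cst_zero]
  exact ⟨rfl, rfl⟩

theorem span_presE_eq_top (h2 : ringChar k ≠ 2) {T : Type*} [Ring T] [Algebra k T]
    (π : Poly k (BaseE k) 3 →ₐ[k] T) (hs : Function.Surjective π) (h : ∀ a ∈ relE k, π a = 0) :
    Submodule.span k (Set.range fun t : SurvIdx (1 : k) => oneProd (π (zE k))
      (fun i => π (uE k i)) (fun i => π (wE k i)) t.1.1 t.1.2.1 t.1.2.2) = ⊤ := by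
  have huu (i j : Fin 4) : π (uE k i) * π (uE k j) = -(π (uE k j) * π (uE k i)) := by
    rw [← map_mul, ← map_mul, uE_mul_comm, map_neg]
  have hii (i : Fin 4) : π (uE k i) * π (uE k i) = 0 := by
    rw [← map_mul, uE_mul_self, map_zero]
  have r02 : π (uE k 0) * π (uE k 2) = 0 := by rw [← map_mul]; exact h _ (.inl rfl)
  have r13 : π (uE k 1) * π (uE k 3) = 0 := by rw [← map_mul]; exact h _ (.inr (.inl rfl))
  have r01 : π (uE k 0) * π (uE k 1) = -(π (zE k) * π (wE k 0)) := by
    refine eq_neg_of_add_eq_zero_left ?_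
    rw [← map_mul, ← map_mul, ← map_add]; exact h _ (.inr (.inr (.inl rfl)))
  have r03 : π (uE k 0) * π (uE k 3) = -(π (zE k) * π (wE k 1)) := by
    refine eq_neg_of_add_eq_zero_left ?_
    rw [← map_mul, ← map_mul, ← map_add]; exact h _ (.inr (.inr (.inr (.inl rfl))))
  have r23 : π (uE k 2) * π (uE k 3) = -(π (zE k) * π (wE k 2)) := by
    refine eq_neg_of_add_eq_zero_left ?_
    rw [← map_mul, ← map_mul, ← map_add]; exact h _ (.inr (.inr (.inr (.inr (.inl rfl)))))
  have r12 : π (uE k 1) * π (uE k 2) = π (zE k) * π (wE k 1) := by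
    rw [← sub_eq_zero, ← map_mul, ← map_mul, ← map_sub]; exact h _ (.inr (.inr (.inr (.inr (.inr (.inl rfl))))))
  have e01 : π (uE k 0) * π (wE k 1) = π (uE k 2) * π (wE k 0) := by
    rw [← sub_eq_zero, ← map_mul, ← map_mul, ← map_sub]; exact h _ (.inr (.inr (.inr (.inr (.inr (.inr (.inl rfl)))))))
  have e11 : π (uE k 1) * π (wE k 1) = π (uE k 3) * π (wE k 0) := by
    rw [← sub_eq_zero, ← map_mul, ← map_mul, ← map_sub]; exact h _ (.inr (.inr (.inr (.inr (.inr (.inr (.inr (.inl rfl))))))))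
  have e02 : π (uE k 0) * π (wE k 2) = π (uE k 2) * π (wE k 1) := by
    rw [← sub_eq_zero, ← map_mul, ← map_mul, ← map_sub]; exact h _ (.inr (.inr (.inr (.inr (.inr (.inr (.inr (.inr (.inl rfl)))))))))
  have e12 : π (uE k 1) * π (wE k 2) = π (uE k 3) * π (wE k 1) := by
    rw [← sub_eq_zero, ← map_mul, ← map_mul, ← map_sub]; exact h _ (.inr (.inr (.inr (.inr (.inr (.inr (.inr (.inr (.inr (.inl rfl))))))))))
  have hc : π (wE k 0) * π (wE k 2) = π (wE k 1) ^ 2 := by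
    rw [← sub_eq_zero, ← map_mul, ← map_pow, ← map_sub]; exact h _ (.inr (.inr (.inr (.inr (.inr (.inr (.inr (.inr (.inr (.inr rfl))))))))))
  -- The quadratic relations express each product of two different `uᵢ` through `z wₗ`;
  -- anticommutation then covers the opposite order.
  have hlt {i j : Fin 4} (hij : i < j) :
      ∃ (c : k) (l : Fin 3), π (uE k i) * π (uE k j) = c • (π (zE k) * π (wE k l)) := by
    fin_cases i <;> fin_cases j <;> first
      | exact absurd hij (by decide)
      | skip
    · exact ⟨-1, 0, r01.trans (neg_one_smul k _).symm⟩
    · exact ⟨0, 0, r02.trans (zero_smul k _).symm⟩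
    · exact ⟨-1, 1, r03.trans (neg_one_smul k _).symm⟩
    · exact ⟨1, 1, r12.trans (one_smul k _).symm⟩
    · exact ⟨0, 0, r13.trans (zero_smul k _).symm⟩
    · exact ⟨-1, 2, r23.trans (neg_one_smul k _).symm⟩
  refine span_oneProd_eq_top h2 (fun A hz hu hw => ?_)
    (fun i j => by rw [← map_mul, polyVar_mul_comm, map_mul]) hc
    (fun i => by rw [← map_mul, polyVar_mul_cst, map_mul])
    (fun i j => by rw [← map_mul, polyVar_mul_cst, map_mul])
    (by rw [← map_mul, zE_mul_self, map_zero])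
    (fun i => by rw [← map_mul, (zE_mul_uE i).1, map_zero])
    (fun i => by rw [← map_mul, (zE_mul_uE i).2, map_zero]) (fun i j => ?_) e01 e02 e11 e12
  · have ht : A.comap π = ⊤ := polyE_subalgebra_eq_top hz hu hw
    rw [eq_top_iff]
    rintro v -
    obtain ⟨v, rfl⟩ := hs v
    have : v ∈ A.comap π := by rw [ht]; trivial
    exact this
  · rcases lt_trichotomy i j with hij | rfl | hij
    · exact hlt hij
    · exact ⟨0, 0, (hii i).trans (zero_smul k _).symm⟩
    · obtain ⟨c, l, e⟩ := hlt hij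
      exact ⟨-c, l, by rw [huu, e, neg_smul]⟩

theorem bijective_of_relE (h2 : ringChar k ≠ 2) {T : Type*} [Ring T] [Algebra k T]
    (π : Poly k (BaseE k) 3 →ₐ[k] T) (hs : Function.Surjective π) (h : ∀ a ∈ relE k, π a = 0)
    (Ψ : T →ₐ[k] HHRing k (Lam (1 : k))) (hz : Ψ (π (zE k)) = monCls 1 3 0 0)
    (hu : ∀ i, Ψ (π (uE k i)) = oneU k i) (hw : ∀ i, Ψ (π (wE k i)) = oneW k i) :
    Function.Bijective Ψ := by
  obtain ⟨B, hB⟩ := exists_hhBasis (one_ne_zero (α := k))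
  refine bijective_of_span B Ψ.toLinearMap _ (span_presE_eq_top h2 π hs h) (fun _ => 1)
    (fun _ => one_ne_zero) fun t => ?_
  rw [hB, AlgHom.toLinearMap_apply, map_oneProd, hz, one_smul]
  simp only [hu, hw]
  exact oneProd_monCls h2 t.2

theorem exists_presE (h2 : ringChar k ≠ 2) : ∃ ψ : HHRing k (Lam (1 : k)) ≃ₐ[k] PresE k,
    Sends ψ 0 (eVec (Lam.y (1 : k) * Lam.x (1 : k)) 0) (quotMk k (relE k) (zE k)) ∧
    Sends ψ 1 (eVec (Lam.x (1 : k)) 0) (quotMk k (relE k) (uE k 0)) ∧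
    Sends ψ 1 (eVec (Lam.y (1 : k)) 0) (quotMk k (relE k) (uE k 1)) ∧
    Sends ψ 1 (eVec (Lam.x (1 : k)) 1) (quotMk k (relE k) (uE k 2)) ∧
    Sends ψ 1 (eVec (Lam.y (1 : k)) 1) (quotMk k (relE k) (uE k 3)) ∧
    ∀ i : Fin 3, Sends ψ 2 (eVec 1 i) (quotMk k (relE k) (wE k i)) := by
  obtain ⟨⟨s0, s1⟩, s2, s3⟩ := surv_oneU h2
  obtain ⟨t0, t1, t2⟩ := surv_oneW h2
  have sz := surv_three_zero_zero (q := (1 : k))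
  obtain ⟨Φ, hz', hu', hw'⟩ := exists_one_lift h2
  obtain ⟨Ψ, hΨ⟩ := exists_quot_lift (S := relE k) Φ (map_relE_eq_zero h2 hz' hu' hw')
  have hz : Ψ (quotMk k (relE k) (zE k)) = monCls 1 3 0 0 := (hΨ _).trans hz'
  have hu (i : Fin 4) : Ψ (quotMk k (relE k) (uE k i)) = oneU k i := (hΨ _).trans (hu' i)
  have hw (i : Fin 3) : Ψ (quotMk k (relE k) (wE k i)) = oneW k i := (hΨ _).trans (hw' i)
  have hbij : Function.Bijective Ψ := bijective_of_relE h2 (quotMk k (relE k))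
    (RingQuot.mkAlgHom_surjective k _) (fun a ha => quotMk_eq_zero ha) Ψ hz hu hw
  let E := AlgEquiv.ofBijective Ψ hbij
  refine ⟨E.symm, sends_symm E id (p := 0) rfl sz.mem hz rfl,
    sends_symm E id (p := 1) rfl s0.mem (hu 0) rfl, sends_symm E id (p := 1) rfl s1.mem (hu 1) rfl,
    sends_symm E id (p := 0) rfl s2.mem (hu 2) rfl, sends_symm E id (p := 0) rfl s3.mem (hu 3) rfl,
    fun i => ?_⟩
  fin_cases i
  · exact sends_symm E id (p := 2) rfl t0.mem (hw 0) rfl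
  · exact sends_symm E id (p := 1) rfl t1.mem (hw 1) rfl
  · exact sends_symm E id (p := 0) rfl t2.mem (hw 2) rfl

end QuantumPlane

/-! ### Assembly of the cases. -/

theorem mainTheorem3 {k : Type*} [Field k] :
    (∀ (q : k) (r : ℕ), 0 < r → IsPrimitiveRoot q r →
      -- `r > 1` odd, characteristic different from `2`
      (1 < r → Odd r → ringChar k ≠ 2 →
        RepBasis q 0 {eVec 1 0, eVec (Lam.y q * Lam.x q) 0} ∧
        (∀ s, 1 ≤ s → RepBasis q (2 * s * r) {v | ∃ t ≤ 2 * s, v = eVec 1 (t * r)}) ∧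
        (∀ s, RepBasis q (2 * s * r + 1)
          {v | ∃ t ≤ 2 * s, v = eVec (Lam.x q) (t * r) ∨ v = eVec (Lam.y q) (t * r + 1)}) ∧
        (∀ s, RepBasis q (2 * s * r + 2)
          {v | ∃ t ≤ 2 * s, v = eVec (Lam.y q * Lam.x q) (t * r + 1)}) ∧
        (∀ n, 2 < n → (∀ s, n ≠ 2 * s * r ∧ n ≠ 2 * s * r + 1 ∧ n ≠ 2 * s * r + 2) →
          RepBasis q n ∅) ∧
        (∃ ψ : HHRing k (Lam q) ≃ₐ[k] PresA k,
          Sends (fun a => (ψ a).1) 0 (eVec (Lam.y q * Lam.x q) 0) (DualNumber.eps, 0) ∧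
          Sends (fun a => (ψ a).1) 1 (eVec (Lam.x q) 0)
            (0, quotMk k (conicRel k) (cst (extGen k 0))) ∧
          Sends (fun a => (ψ a).1) 1 (eVec (Lam.y q) 1)
            (0, quotMk k (conicRel k) (cst (extGen k 1))) ∧
          ∀ i : Fin 3, Sends (fun a => (ψ a).1) (2 * r) (eVec 1 (i * r))
            (0, quotMk k (conicRel k) (polyVar k (ExtAlg k 2) i))) ∧
        HasHilbertSeries k (Lam q) (1 + (1 + PowerSeries.X) ^ 2 * (1 + PowerSeries.X ^ (2 * r)) *
          ((1 - PowerSeries.X ^ (2 * r)) ^ 2)⁻¹) ∧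
        FirstNonzeroFromThree k (Lam q) (2 * r)) ∧
      -- characteristic `2` and `q ≠ 1`, or characteristic different from `2` and `r > 2` even
      ((ringChar k = 2 ∧ q ≠ 1) ∨ (ringChar k ≠ 2 ∧ 2 < r ∧ Even r) →
        RepBasis q 0 {eVec 1 0, eVec (Lam.y q * Lam.x q) 0} ∧
        (∀ s, 1 ≤ s → RepBasis q (s * r) {v | ∃ t ≤ s, v = eVec 1 (t * r)}) ∧
        (∀ s, RepBasis q (s * r + 1)
          {v | ∃ t ≤ s, v = eVec (Lam.x q) (t * r) ∨ v = eVec (Lam.y q) (t * r + 1)}) ∧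
        (∀ s, RepBasis q (s * r + 2)
          {v | ∃ t ≤ s, v = eVec (Lam.y q * Lam.x q) (t * r + 1)}) ∧
        (∀ n, 2 < n → (∀ s, n ≠ s * r ∧ n ≠ s * r + 1 ∧ n ≠ s * r + 2) → RepBasis q n ∅) ∧
        (∃ ψ : HHRing k (Lam q) ≃ₐ[k] PresB k,
          Sends (fun a => (ψ a).1) 0 (eVec (Lam.y q * Lam.x q) 0) (DualNumber.eps, 0) ∧
          Sends (fun a => (ψ a).1) 1 (eVec (Lam.x q) 0) (0, cst (extGen k 0)) ∧
          Sends (fun a => (ψ a).1) 1 (eVec (Lam.y q) 1) (0, cst (extGen k 1)) ∧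
          ∀ i : Fin 2, Sends (fun a => (ψ a).1) r (eVec 1 (i * r))
            (0, polyVar k (ExtAlg k 2) i)) ∧
        HasHilbertSeries k (Lam q)
          (1 + (1 + PowerSeries.X) ^ 2 * ((1 - PowerSeries.X ^ r) ^ 2)⁻¹) ∧
        FirstNonzeroFromThree k (Lam q) r) ∧
      -- characteristic `2` and `q = 1`
      (ringChar k = 2 → q = 1 →
        (∀ n, RepBasis q n {v | ∃ j ≤ n, v = eVec 1 j ∨ v = eVec (Lam.x q) j ∨
          v = eVec (Lam.y q) j ∨ v = eVec (Lam.y q * Lam.x q) j}) ∧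
        (∃ ψ : HHRing k (Lam q) ≃ₐ[k] PresC q,
          (∀ a : Lam q, Sends ψ 0 (eVec a 0) (cst a)) ∧
          ∀ i : Fin 2, Sends ψ 1 (eVec 1 i) (polyVar k (Lam q) i)) ∧
        HasHilbertSeries k (Lam q) (4 * ((1 - PowerSeries.X) ^ 2)⁻¹)) ∧
      -- characteristic different from `2` and `q = -1`
      (ringChar k ≠ 2 → q = -1 →
        RepBasis q 0 {eVec 1 0, eVec (Lam.x q) 0, eVec (Lam.y q) 0,
          eVec (Lam.y q * Lam.x q) 0} ∧
        (∀ m, 1 ≤ m → RepBasis q (2 * m)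
          ({v | ∃ t ≤ m, v = eVec 1 (2 * t)} ∪ {eVec (Lam.y q) 0, eVec (Lam.x q) (2 * m)} ∪
            {v | ∃ t < m, v = eVec (Lam.y q * Lam.x q) (2 * t + 1)})) ∧
        (∀ m, RepBasis q (2 * m + 1)
          ({v | ∃ t ≤ m, v = eVec (Lam.x q) (2 * t) ∨ v = eVec (Lam.y q) (2 * t + 1)} ∪
            {eVec (Lam.y q * Lam.x q) 0, eVec (Lam.y q * Lam.x q) (2 * m + 1)})) ∧
        (∃ ψ : HHRing k (Lam q) ≃ₐ[k] PresD q,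
          (∀ a : Lam q, Sends ψ 0 (eVec a 0) (quotMk k (relD q) (cst (a ⊗ₜ 1)))) ∧
          Sends ψ 1 (eVec (Lam.x q) 0) (quotMk k (relD q) (cst (1 ⊗ₜ extGen k 0))) ∧
          Sends ψ 1 (eVec (Lam.y q) 1) (quotMk k (relD q) (cst (1 ⊗ₜ extGen k 1))) ∧
          Sends ψ 2 (eVec 1 0) (quotMk k (relD q) (polyVar k _ 0)) ∧
          Sends ψ 2 (eVec 1 2) (quotMk k (relD q) (polyVar k _ 1))) ∧
        HasHilbertSeries k (Lam q)
          ((4 - 4 * PowerSeries.X + PowerSeries.X ^ 2) * ((1 - PowerSeries.X) ^ 2)⁻¹)) ∧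
      -- characteristic different from `2` and `q = 1`
      (ringChar k ≠ 2 → q = 1 →
        (∀ n, Even n → RepBasis q n
          {v | ∃ j ≤ n, v = eVec 1 j ∨ v = eVec (Lam.y q * Lam.x q) j}) ∧
        (∀ n, Odd n → RepBasis q n
          {v | ∃ j ≤ n, v = eVec (Lam.x q) j ∨ v = eVec (Lam.y q) j}) ∧
        (∃ ψ : HHRing k (Lam q) ≃ₐ[k] PresE k,
          Sends ψ 0 (eVec (Lam.y q * Lam.x q) 0) (quotMk k (relE k) (zE k)) ∧
          Sends ψ 1 (eVec (Lam.x q) 0) (quotMk k (relE k) (uE k 0)) ∧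
          Sends ψ 1 (eVec (Lam.y q) 0) (quotMk k (relE k) (uE k 1)) ∧
          Sends ψ 1 (eVec (Lam.x q) 1) (quotMk k (relE k) (uE k 2)) ∧
          Sends ψ 1 (eVec (Lam.y q) 1) (quotMk k (relE k) (uE k 3)) ∧
          ∀ i : Fin 3, Sends ψ 2 (eVec 1 i) (quotMk k (relE k) (wE k i))) ∧
        HasHilbertSeries k (Lam q) (2 * ((1 - PowerSeries.X) ^ 2)⁻¹))) ∧
    -- if `k` contains all roots of unity, the gap can be made arbitrarily large
    ((∀ r : ℕ, (r : k) ≠ 0 → ∃ ζ : k, IsPrimitiveRoot ζ r) →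
      ∀ M : ℕ, ∃ (r : ℕ) (q : k) (N : ℕ), 0 < r ∧ IsPrimitiveRoot q r ∧ M < N ∧
        FirstNonzeroFromThree k (Lam q) N) := by
  refine ⟨fun q r hr h => ⟨fun h1 ho h2 => ?_, fun hc => ?_, fun h2 hq => ?_, fun h2 hq => ?_,
    fun h2 hq => ?_⟩, fun h M => exists_firstNonzeroFromThree h M⟩
  · have hS := sparse_of_odd h h1 ho h2
    exact ⟨hS.repBasis_zero, fun s hs => hS.repBasis_one hs, fun s => hS.repBasis_two s,
      fun s => hS.repBasis_three s, fun n hn hc => hS.repBasis_empty hn hc,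
      hS.exists_presA h.pow_eq_one, hS.hasHilbertSeries_two, hS.firstNonzeroFromThree⟩
  · have hS := sparse_of_even hr h hc
    refine ⟨hS.repBasis_zero, fun s hs => ?_, fun s => ?_, fun s => ?_, fun n hn hc => ?_,
      hS.exists_presB h.pow_eq_one, hS.hasHilbertSeries_one, ?_⟩
    · simpa only [one_mul] using hS.repBasis_one hs
    · simpa only [one_mul] using hS.repBasis_two s
    · simpa only [one_mul] using hS.repBasis_three s
    · exact hS.repBasis_empty hn (by simpa only [one_mul] using hc)
    · simpa only [one_mul] using hS.firstNonzeroFromThree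
  · subst hq
    exact ⟨fun n => repBasis_one_of_char_two h2 n, exists_presC h2,
      hasHilbertSeries_one_of_char_two h2⟩
  · subst hq
    exact ⟨repBasis_neg_one_zero h2, fun m hm => repBasis_neg_one_even h2 hm,
      fun m => repBasis_neg_one_odd h2 m, exists_presD h2, hasHilbertSeries_neg_one h2⟩
  · subst hq
    exact ⟨fun n hn => repBasis_one_of_even h2 hn, fun n hn => repBasis_one_of_odd h2 hn,
      exists_presE h2, hasHilbertSeries_one h2⟩
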